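/- For an algebraically closed field $\mathbb{K}$ and a Zariski closed set $V\subseteq\mathbb{A}^N_{\mathbb{K}}$, the complexity $\mathrm{cmp}(V)$ is the smallest positive integer $M\ge N$ such that the ideal of all polynomials vanishing on $V$ is generated by at most $M$ polynomials of degree at most $M$. Closed subgroups of $\mathrm{GL}_n$ are regarded as closed subsets of $\mathbb{A}^{n^2+1}$ through the standard embedding $g\mapsto(g,\det(g)^{-1})$. There is a (strictly) increasing function $C:\mathbb{N}\to\mathbb{N}$ such that the following holds. Let $n$ be a positive integer, let $\mathbb{K}$ be an algebraically closed field of characteristic $p>n$, and let $G$ be a Zariski closed connected subgroup of $\mathrm{GL}_n(\mathbb{K})$ with complexity $M$. Let $U$ be the unipotent radical of $G$, that is, its largest closed connected normal unipotent subgroup. Then $$\mathrm{cmp}(U)\le C(M).$$ Moreover, let $\mathfrak{u}$ be the Lie subalgebra of $M_n(\mathbb{K})$ generated by $\log(U)$, where $\log(A)=-\sum_{k=1}^n\frac{(I-A)^k}{k}$ for unipotent $A$. Then $\mathfrak{u}$ consists of nilpotent matrices, and $$U=(\exp(\mathfrak{u})\cap G)^0,$$ where $\exp(X)=\sum_{k=0}^n\frac{X^k}{k!}$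 for nilpotent $X$, and $(\cdot)^0$ is the Zariski connected component of the identity. -/

import Mathlib

namespace UnipRad

noncomputable section

open MvPolynomial Topology

attribute [local instance] LieRing.ofAssociativeRing

/-- The Zariski topology on affine space `K^σ`: the closed sets are the zero loci of ideals of
`K[x_i : i ∈ σ]`. -/
@[reducible]
def zariski (K : Type*) [Field K] (σ : Type*) : TopologicalSpace (σ → K) :=
  TopologicalSpace.ofClosed
    {Z | ∃ I : Ideal (MvPolynomial σ K), Z = zeroLocus K I}
    ⟨⊤, by simp⟩
    (by
      intro A hA
      refine ⟨sSup {I | zeroLocus K I ∈ A}, ?_⟩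
      have h : zeroLocus K (sSup {I : Ideal (MvPolynomial σ K) | zeroLocus K I ∈ A}) =
          ⋂ I ∈ {I : Ideal (MvPolynomial σ K) | zeroLocus K I ∈ A}, zeroLocus K I := by
        refine Set.Subset.antisymm ?_ ?_
        · exact Set.subset_iInter₂ fun I hI => zeroLocus_anti_mono (le_sSup hI)
        · refine le_zeroLocus_iff_le_vanishingIdeal.2 (sSup_le fun I hI => ?_)
          exact le_zeroLocus_iff_le_vanishingIdeal.1 (Set.biInter_subset_of_mem hI)
      rw [h]
      ext x
      simp only [Set.mem_sInter, Set.mem_iInter, Set.mem_ofPred_eq]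
      constructor
      · intro hx I hI
        exact hx _ hI
      · intro hx Z hZ
        obtain ⟨I, rfl⟩ := hA hZ
        exact hx I hZ)
    (by
      rintro _ ⟨I, rfl⟩ _ ⟨J, rfl⟩
      refine ⟨I * J, ?_⟩
      ext x
      constructor
      · rintro (hx | hx) p hp
        · exact hx p (Ideal.mul_le_left hp)
        · exact hx p (Ideal.mul_le_right hp)
      · intro hx
        by_contra hcon
        simp only [Set.mem_union, mem_zeroLocus_iff, not_or, not_forall] at hcon
        obtain ⟨⟨p, hp, hpx⟩, q, hq, hqx⟩ := hcon
        have := hx _ (Ideal.mul_mem_mul hp hq)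
        rw [map_mul] at this
        exact (mul_ne_zero hpx hqx) this)

/-- `M ≥ 1`, `M` is at least the dimension of the ambient affine space, and the ideal of polynomials
vanishing on `V` is generated by at most `M` polynomials of total degree at most `M`. -/
def ComplexityBound {K σ : Type*} [Field K] [Fintype σ] (V : Set (σ → K)) (M : ℕ) : Prop :=
  0 < M ∧ Fintype.card σ ≤ M ∧
    ∃ S : Finset (MvPolynomial σ K), S.card ≤ M ∧ (∀ f ∈ S, f.totalDegree ≤ M) ∧
      Ideal.span (S : Set (MvPolynomial σ K)) = vanishingIdeal K V

/-- The set over which the minimum in `complexity` is taken is never empty. -/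
theorem exists_complexityBound {K σ : Type*} [Field K] [Fintype σ] (V : Set (σ → K)) :
    ∃ M, ComplexityBound V M := by
  obtain ⟨S, hS⟩ := (isNoetherianRing_iff_ideal_fg (MvPolynomial σ K)).1 inferInstance
    (vanishingIdeal K V)
  refine ⟨1 + Fintype.card σ + S.card + S.sup totalDegree, by omega, by omega, S, by omega,
    fun f hf => ?_, hS⟩
  have := Finset.le_sup (f := totalDegree) hf
  omega

/-- The complexity `cmp(V)` of `V ⊆ K^σ`: the least `M` with `ComplexityBound V M`. -/
def complexity {K σ : Type*} [Field K] [Fintype σ] (V : Set (σ → K)) : ℕ :=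
  sInf {M | ComplexityBound V M}

variable {n : ℕ} {K : Type*} [Field K]

/-- The standard closed embedding `g ↦ (g, det(g)⁻¹)` of `GL_n` in affine space of dimension
`n ^ 2 + 1`. -/
def glEmbed (g : GL (Fin n) K) : Option (Fin n × Fin n) → K
  | some (i, j) => (g : Matrix (Fin n) (Fin n) K) i j
  | none => ((g : Matrix (Fin n) (Fin n) K).det)⁻¹

/-- The Zariski topology on `GL_n(K)`. -/
@[reducible]
def zariskiGL (n : ℕ) (K : Type*) [Field K] : TopologicalSpace (GL (Fin n) K) :=
  TopologicalSpace.induced glEmbed (zariski K (Option (Fin n × Fin n)))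

/-- Algebraic subgroups of `GL_n` are the Zariski closed subgroups. -/
def IsAlgebraic (G : Subgroup (GL (Fin n) K)) : Prop :=
  IsClosed[zariskiGL n K] (G : Set (GL (Fin n) K))

/-- Connectedness in the Zariski topology. -/
def IsConn (G : Subgroup (GL (Fin n) K)) : Prop :=
  @IsConnected _ (zariskiGL n K) (G : Set (GL (Fin n) K))

/-- Every element of the group is a unipotent matrix. -/
def IsUnip (G : Subgroup (GL (Fin n) K)) : Prop :=
  ∀ g ∈ G, IsNilpotent ((g : Matrix (Fin n) (Fin n) K) - 1)

/-- The complexity of a subgroup of `GL_n`, with respect to the standard embedding of `GL_n` in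
affine space of dimension `n ^ 2 + 1`. -/
def groupComplexity (G : Subgroup (GL (Fin n) K)) : ℕ :=
  complexity (glEmbed '' (G : Set (GL (Fin n) K)))

/-- The unipotent radical of `G`: the subgroup generated by all closed connected normal unipotent
subgroups of `G` (it is itself such a subgroup, hence the largest one). -/
def unipotentRadical (G : Subgroup (GL (Fin n) K)) : Subgroup (GL (Fin n) K) :=
  sSup {V | V ≤ G ∧ (V.subgroupOf G).Normal ∧ IsAlgebraic V ∧ IsConn V ∧ IsUnip V}

/-- The Zariski connected component of the identity in a subset of `GL_n(K)`. -/
def identityComponent (S : Set (GL (Fin n) K)) : Set (GL (Fin n) K) :=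
  @connectedComponentIn _ (zariskiGL n K) S 1

/-- `exp(A) = ∑_{k=0}^n A^k / k!`, meant for nilpotent `A` and characteristic `0` or `> n`. -/
def matExp (A : Matrix (Fin n) (Fin n) K) : Matrix (Fin n) (Fin n) K :=
  ∑ k ∈ Finset.range (n + 1), ((k.factorial : K)⁻¹) • A ^ k

/-- `log(A) = -∑_{k=1}^n (1 - A)^k / k`, meant for unipotent `A` and characteristic `0` or `> n`. -/
def matLog (A : Matrix (Fin n) (Fin n) K) : Matrix (Fin n) (Fin n) K :=
  -∑ k ∈ Finset.Icc 1 n, ((k : K)⁻¹) • (1 - A) ^ k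

/-- The Lie subalgebra of `M_n(K)` generated by `log(U)`. -/
def logLieAlgebra (U : Subgroup (GL (Fin n) K)) : LieSubalgebra K (Matrix (Fin n) (Fin n) K) :=
  LieSubalgebra.lieSpan K (Matrix (Fin n) (Fin n) K)
    {X | ∃ g ∈ U, X = matLog (g : Matrix (Fin n) (Fin n) K)}

/-- The elements of `GL_n(K)` of the form `exp(X)` with `X ∈ L`. -/
def expSet (L : LieSubalgebra K (Matrix (Fin n) (Fin n) K)) : Set (GL (Fin n) K) :=
  {g | ∃ X ∈ L, (g : Matrix (Fin n) (Fin n) K) = matExp X}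

end

end UnipRad

namespace UnipRad

open MvPolynomial Topology TopologicalSpace

/-! The statement on exponentials is elementary. For a unipotent group U, the span A of the matrices
g - 1 (g ∈ U) is closed under products and has trace zero; when p > n, a matrix whose positive
powers all have trace zero is nilpotent, so A consists of nilpotent matrices
(`isNilpotent_of_mem_unipSpan`). Now A contains log(U), hence 𝔲, and exp(𝔲) ⊆ 1 + A. For U the
unipotent radical of G, G ∩ (1 + A) is a normal unipotent subgroup of G, so the identity component
of its closure lies in U. Conversely U = exp(log U) is connected and lies in exp(𝔲) ∩ G.

The bound follows by compactness. If it failed for some n and M, there would be groups G_i of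
complexity M with radicals U_i of unbounded complexity. Over a nonprincipal ultraproduct of the
fields, the polynomials that vanish on U_i for almost all i form a prime ideal, generated in some
degree D. Let J_i be generated by the elements of I(U_i) of degree at most D. For each fixed t,
almost every J_i contains all elements of I(U_i) of degree at most t. The claim is J_i = I(U_i) for
almost all i; counting monomials then bounds the complexity. Once D is large, the zero set V_i of
J_i is a closed normal unipotent subgroup of G_i, with identity component U_i by maximality. Two
points remain (`lowSpan_eq_glIdeal`).

Reducedness. The ultraproduct is algebraically closed, hence perfect, so the limit prime is
described generically by a separable primitive element: a `GenericPresentation`. This is a finite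
amount of data and descends to J_i with uniform degree bounds. It shows that J_i is radical away
from the zeros of some δ ∉ I(U_i) of bounded degree; translating δ by U_i covers every point.

Connectedness, V_i = U_i. If p_i > Dn, each g ∈ V_i is joined to 1 by the curve t ↦ g^t. Otherwise
the characteristic p is almost everywhere constant. The indicator function b of U_i on V_i satisfies
b^p = b, which in a generic presentation becomes a system ψ_l^p = ∑ N_ml ψ_m whose solutions have
bounded degree (`frobeniusSystem_integral`, `frobeniusSystem_degree`). So b is generically e/δ with
e of bounded degree. But polynomials of bounded degree cannot separate U_i from its other cosets in
V_i. -/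

theorem mem_connectedComponentIn_of_isPreconnected {Γ : Type*} [TopologicalSpace Γ] [One Γ] {S T : Set Γ} {x : Γ}
    (hT : IsPreconnected T) (hTS : T ⊆ S) (hT1 : (1 : Γ) ∈ T) (hx : x ∈ T) :
    x ∈ connectedComponentIn S 1 :=
  hT.subset_connectedComponentIn hT1 hTS hx

/-! ### Noetherian groups with separately continuous multiplication -/

section NoetherianGroup

variable {Γ : Type*} [Group Γ] [TopologicalSpace Γ] [SeparatelyContinuousMul Γ]

/-- With separate continuity only, the argument runs one variable at a time: each x * Y lies in `Z₁`
or in `Z₂`, and the two sets of such x are closed and cover X. -/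
theorem isIrreducible_mul {X Y : Set Γ} (hX : IsIrreducible X) (hY : IsIrreducible Y) :
    IsIrreducible {z | ∃ x ∈ X, ∃ y ∈ Y, x * y = z} := by
  obtain ⟨x₀, hx₀⟩ := hX.1
  obtain ⟨y₀, hy₀⟩ := hY.1
  refine ⟨⟨_, x₀, hx₀, y₀, hy₀, rfl⟩, isPreirreducible_iff_isClosed_union_isClosed.2 ?_⟩
  intro Z₁ Z₂ h₁ h₂ hsub
  have key : ∀ Z : Set Γ, IsClosed Z → IsClosed {x | ∀ y ∈ Y, x * y ∈ Z} := by
    intro Z hZ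
    have : {x | ∀ y ∈ Y, x * y ∈ Z} = ⋂ y ∈ Y, (fun x => x * y) ⁻¹' Z := by ext; simp
    rw [this]
    exact isClosed_biInter fun y _ =>
      hZ.preimage (SeparatelyContinuousMul.continuous_mul_const (a := y))
  have hcov : X ⊆ {x | ∀ y ∈ Y, x * y ∈ Z₁} ∪ {x | ∀ y ∈ Y, x * y ∈ Z₂} := by
    intro x hx
    have hc : Continuous fun y => x * y := SeparatelyContinuousMul.continuous_const_mul (a := x)
    rcases isPreirreducible_iff_isClosed_union_isClosed.1 hY.2 _ _ (h₁.preimage hc)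
      (h₂.preimage hc) (fun y hy => hsub ⟨x, hx, y, hy, rfl⟩) with h | h
    · exact Or.inl fun y hy => h hy
    · exact Or.inr fun y hy => h hy
  rcases isPreirreducible_iff_isClosed_union_isClosed.1 hX.2 _ _ (key _ h₁) (key _ h₂) hcov
    with h | h
  · left
    rintro _ ⟨x, hx, y, hy, rfl⟩
    exact h hx y hy
  · right
    rintro _ ⟨x, hx, y, hy, rfl⟩
    exact h hx y hy

theorem isClosed_leftCoset {X : Set Γ} (hX : IsClosed X) (g : Γ) :
    IsClosed {z | g⁻¹ * z ∈ X} :=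
  hX.preimage (SeparatelyContinuousMul.continuous_const_mul (a := g⁻¹))

theorem isIrreducible_leftTranslate {X : Set Γ} (hX : IsIrreducible X) (g : Γ) :
    IsIrreducible ((fun x => g * x) '' X) :=
  hX.image _ (SeparatelyContinuousMul.continuous_const_mul (a := g)).continuousOn

/-- If every irreducible subset containing `1` of a closed subgroup `H` of a Noetherian group lies
in the closed subset `X`, which is a subgroup, then the complement of `X` in `H` is closed. -/
theorem isClosed_diff_of_irreducible_subset [NoetherianSpace Γ] {H X : Subgroup Γ}
    (hH : IsClosed (H : Set Γ)) (hX : IsClosed (X : Set Γ))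
    (h : ∀ Y : Set Γ, IsIrreducible Y → Y ⊆ H → (1 : Γ) ∈ Y → Y ⊆ X) :
    IsClosed ((H : Set Γ) \ X) := by
  obtain ⟨S, hSf, -, hSi, hSU⟩ := NoetherianSpace.exists_finite_set_isClosed_irreducible hH
  have hS : ∀ t ∈ S, ∃ z ∈ t, ∀ w ∈ t, z⁻¹ * w ∈ X := by
    intro t ht
    obtain ⟨z, hz⟩ := (hSi t ht).1
    have htH : t ⊆ H := by rw [hSU]; exact Set.subset_sUnion_of_mem ht
    refine ⟨z, hz, fun w hw => ?_⟩
    refine h _ (isIrreducible_leftTranslate (hSi t ht) z⁻¹) ?_ ⟨z, hz, by simp⟩ ⟨w, hw, rfl⟩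
    rintro _ ⟨v, hv, rfl⟩
    exact H.mul_mem (H.inv_mem (htH hz)) (htH hv)
  choose! c hc hcX using hS
  -- Every component t lies in the single coset of X through `c t`, because its translate by the
  -- inverse of `c t` is irreducible and contains 1. The complement of X is therefore cut out by
  -- finitely many closed cosets.
  have : (H : Set Γ) \ X = (H : Set Γ) ∩ ⋃ t ∈ {t ∈ S | c t ∉ X}, {z | (c t)⁻¹ * z ∈ X} := by
    ext z
    simp only [Set.mem_sdiff, SetLike.mem_coe, Set.mem_inter_iff, Set.mem_iUnion, Set.mem_ofPred_eq,
      exists_prop]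
    refine and_congr_right fun hzH => ⟨fun hz => ?_, ?_⟩
    · have : z ∈ ⋃₀ S := hSU ▸ hzH
      obtain ⟨t, ht, hzt⟩ := this
      refine ⟨t, ⟨ht, fun hct => hz ?_⟩, hcX t ht z hzt⟩
      have := X.mul_mem hct (hcX t ht z hzt)
      simpa using this
    · rintro ⟨t, ⟨ht, hct⟩, hzt⟩ hz
      apply hct
      have := X.mul_mem hz (X.inv_mem hzt)
      simpa using this
  rw [this]
  refine hH.inter (Set.Finite.isClosed_biUnion (hSf.subset fun t ht => ht.1) fun t _ => ?_)
  exact isClosed_leftCoset hX _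

theorem closure_mul_mem (H : Subgroup Γ) {a b : Γ} (ha : a ∈ closure (H : Set Γ))
    (hb : b ∈ closure (H : Set Γ)) : a * b ∈ closure (H : Set Γ) := by
  have h1 : ∀ x ∈ H, ∀ y ∈ closure (H : Set Γ), x * y ∈ closure (H : Set Γ) := fun x hx y hy =>
    map_mem_closure (SeparatelyContinuousMul.continuous_const_mul (a := x)) hy
      fun z hz => H.mul_mem hx hz
  have := map_mem_closure (SeparatelyContinuousMul.continuous_mul_const (a := b)) ha
    (t := closure (H : Set Γ)) fun x hx => h1 x hx b hb
  rwa [closure_closure] at this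

theorem conj_continuous (g : Γ) : Continuous fun x : Γ => g * x * g⁻¹ :=
  (SeparatelyContinuousMul.continuous_mul_const (a := g⁻¹)).comp
    (SeparatelyContinuousMul.continuous_const_mul (a := g))

variable [ContinuousInv Γ]

/-- The closure of a subgroup in a group whose multiplication is separately continuous. -/
def closureSubgroup (H : Subgroup Γ) : Subgroup Γ where
  carrier := closure (H : Set Γ)
  mul_mem' := closure_mul_mem H
  one_mem' := subset_closure H.one_mem
  inv_mem' := fun ha => map_mem_closure continuous_inv ha fun _ hx => H.inv_mem hx

theorem closureSubgroup_conj {H : Subgroup Γ} {g : Γ} (h : ∀ x ∈ H, g * x * g⁻¹ ∈ H) {x : Γ}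
    (hx : x ∈ closureSubgroup H) : g * x * g⁻¹ ∈ closureSubgroup H :=
  map_mem_closure (f := fun x => g * x * g⁻¹) (conj_continuous g) hx fun y hy => h y hy

/-- The identity component of a subgroup. -/
def componentSubgroup (H : Subgroup Γ) : Subgroup Γ where
  carrier := connectedComponentIn (H : Set Γ) 1
  one_mem' := mem_connectedComponentIn H.one_mem
  mul_mem' := by
    intro a b ha hb
    have hpre := isPreconnected_connectedComponentIn (F := (H : Set Γ)) (x := 1)
    have hsub := connectedComponentIn_subset (H : Set Γ) 1
    have h1 := mem_connectedComponentIn (F := (H : Set Γ)) H.one_mem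
    have hc : Continuous fun x : Γ => a * x := SeparatelyContinuousMul.continuous_const_mul (a := a)
    refine mem_connectedComponentIn_of_isPreconnected
      (T := connectedComponentIn (H : Set Γ) 1 ∪ (fun x => a * x) '' connectedComponentIn (H : Set Γ) 1)
      (IsPreconnected.union a ha ⟨1, h1, mul_one a⟩ hpre (hpre.image _ hc.continuousOn)) ?_
      (Or.inl h1) (Or.inr ⟨b, hb, rfl⟩)
    rintro _ (h | ⟨y, hy, rfl⟩)
    · exact hsub h
    · exact H.mul_mem (hsub ha) (hsub hy)
  inv_mem' := by
    intro a ha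
    have hpre := isPreconnected_connectedComponentIn (F := (H : Set Γ)) (x := 1)
    have hsub := connectedComponentIn_subset (H : Set Γ) 1
    refine mem_connectedComponentIn_of_isPreconnected
      (hpre.image _ (continuous_inv (G := Γ)).continuousOn) ?_
      ⟨1, mem_connectedComponentIn H.one_mem, inv_one⟩ ⟨a, ha, rfl⟩
    rintro _ ⟨y, hy, rfl⟩
    exact H.inv_mem (hsub hy)

theorem componentSubgroup_le (H : Subgroup Γ) : componentSubgroup H ≤ H :=
  connectedComponentIn_subset (H : Set Γ) 1

theorem isConnected_componentSubgroup (H : Subgroup Γ) :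
    IsConnected (componentSubgroup H : Set Γ) :=
  ⟨⟨1, (componentSubgroup H).one_mem⟩, isPreconnected_connectedComponentIn⟩

theorem isClosed_componentSubgroup {H : Subgroup Γ} (hH : IsClosed (H : Set Γ)) :
    IsClosed (componentSubgroup H : Set Γ) := by
  refine isClosed_of_closure_subset fun x hx => ?_
  exact mem_connectedComponentIn_of_isPreconnected
    (isPreconnected_connectedComponentIn (F := (H : Set Γ)) (x := 1)).closure
    (hH.closure_subset_iff.2 (componentSubgroup_le H))
    (subset_closure (componentSubgroup H).one_mem) hx

theorem componentSubgroup_conj {H : Subgroup Γ} {g : Γ} (h : ∀ x ∈ H, g * x * g⁻¹ ∈ H) {x : Γ}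
    (hx : x ∈ componentSubgroup H) : g * x * g⁻¹ ∈ componentSubgroup H := by
  refine mem_connectedComponentIn_of_isPreconnected
    ((isPreconnected_connectedComponentIn (F := (H : Set Γ)) (x := 1)).image _
      (conj_continuous g).continuousOn) ?_
      ⟨1, (componentSubgroup H).one_mem, by simp⟩ ⟨x, hx, rfl⟩
  rintro _ ⟨y, hy, rfl⟩
  exact h y (componentSubgroup_le H hy)

theorem isClosed_diff_componentSubgroup [NoetherianSpace Γ] {H : Subgroup Γ}
    (hH : IsClosed (H : Set Γ)) : IsClosed ((H : Set Γ) \ componentSubgroup H) :=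
  isClosed_diff_of_irreducible_subset hH (isClosed_componentSubgroup hH)
    fun _ hY hYH h1 _ hy =>
      mem_connectedComponentIn_of_isPreconnected hY.2.isPreconnected hYH h1 hy

/-- A connected closed subgroup of a Noetherian group is irreducible. -/
theorem isIrreducible_of_isConnected [NoetherianSpace Γ] {H : Subgroup Γ}
    (hH : IsClosed (H : Set Γ)) (hc : IsConnected (H : Set Γ)) : IsIrreducible (H : Set Γ) := by
  obtain ⟨S, hSf, hSc, hSi, hSU⟩ := NoetherianSpace.exists_finite_set_isClosed_irreducible hH
  -- a maximal irreducible subset of `H` containing `1`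
  obtain ⟨X, hXm⟩ : ∃ X, Maximal (fun Y : Set Γ => IsIrreducible Y ∧ Y ⊆ H ∧ (1 : Γ) ∈ Y) X := by
    have hfin : {t ∈ S | (1 : Γ) ∈ t}.Finite := hSf.subset fun t ht => ht.1
    obtain ⟨t₀, ht₀, h1⟩ : (1 : Γ) ∈ ⋃₀ S := hSU ▸ H.one_mem
    obtain ⟨X, hX⟩ := hfin.exists_maximal ⟨t₀, ht₀, h1⟩
    refine ⟨X, ⟨hSi X hX.prop.1, ?_, hX.prop.2⟩, ?_⟩
    · rw [hSU]; exact Set.subset_sUnion_of_mem hX.prop.1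
    · rintro Y ⟨hYi, hYH, -⟩ hXY
      lift S to Finset (Set Γ) using hSf
      obtain ⟨t, ht, hYt⟩ := isIrreducible_iff_sUnion_isClosed.1 hYi S hSc (hSU ▸ hYH)
      exact hYt.trans (hX.le_of_ge ⟨ht, hYt (hXY hX.prop.2)⟩ (hXY.trans hYt))
  obtain ⟨hXi, hXH, hX1⟩ := hXm.prop
  -- X * Y is irreducible and contains both X and Y; maximality of X gives Y ⊆ X. Applied to X * X
  -- and to the inverse of X, this makes X a subgroup.
  have hall : ∀ Y : Set Γ, IsIrreducible Y → Y ⊆ H → (1 : Γ) ∈ Y → Y ⊆ X := by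
    intro Y hY hYH hY1
    have hXY := hXm.le_of_ge (y := {z | ∃ x ∈ X, ∃ y ∈ Y, x * y = z})
      ⟨isIrreducible_mul hXi hY, by
        rintro _ ⟨x, hx, y, hy, rfl⟩
        exact H.mul_mem (hXH hx) (hYH hy), ⟨1, hX1, 1, hY1, mul_one 1⟩⟩
      (fun x hx => ⟨x, hx, 1, hY1, mul_one x⟩)
    exact fun y hy => hXY ⟨1, hX1, y, hy, one_mul y⟩
  let X' : Subgroup Γ :=
    { carrier := X
      one_mem' := hX1
      mul_mem' := by
        intro a b ha hb
        refine hall _ (isIrreducible_mul hXi hXi) ?_ ⟨1, hX1, 1, hX1, mul_one 1⟩ ⟨a, ha, b, hb, rfl⟩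
        rintro _ ⟨x, hx, y, hy, rfl⟩
        exact H.mul_mem (hXH hx) (hXH hy)
      inv_mem' := by
        intro a ha
        refine hall _ (hXi.image _ (continuous_inv (G := Γ)).continuousOn) ?_ ⟨1, hX1, inv_one⟩
          ⟨a, ha, rfl⟩
        rintro _ ⟨x, hx, rfl⟩
        exact H.inv_mem (hXH hx) }
  have hXcl : IsClosed (X' : Set Γ) := by
    refine isClosed_of_closure_subset ?_
    exact hall _ hXi.closure (hH.closure_subset_iff.2 hXH) (subset_closure hX1)
  -- X is now a closed subgroup with closed complement in H, so connectedness leaves no room for the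
  -- complement.
  have hdiff := isClosed_diff_of_irreducible_subset (X := X') hH hXcl hall
  have hpre := isPreconnected_closed_iff.1 hc.2 _ _ hXcl hdiff (by
    intro z hz
    by_cases h : z ∈ X'
    · exact Or.inl h
    · exact Or.inr ⟨hz, h⟩) ⟨1, H.one_mem, hX1⟩
  have : (H : Set Γ) ⊆ X := by
    intro z hz
    by_contra hzX
    obtain ⟨w, -, hw, hw'⟩ := hpre ⟨z, hz, hz, hzX⟩
    exact hw'.2 hw
  rwa [this.antisymm hXH]

end NoetherianGroup

end UnipRad


namespace UnipRad

noncomputable section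

open MvPolynomial Topology TopologicalSpace

/-! ### Degrees under substitution -/

section Degrees

theorem totalDegree_aeval_le {R σ τ : Type*} [CommRing R] (φ : σ → MvPolynomial τ R) (d : ℕ)
    (hφ : ∀ s, (φ s).totalDegree ≤ d) (f : MvPolynomial σ R) :
    (aeval φ f).totalDegree ≤ f.totalDegree * d := by
  rw [aeval_def, eval₂_eq]
  refine totalDegree_finsetSum_le fun m hm => ?_
  refine (totalDegree_mul _ _).trans ?_
  rw [algebraMap_eq, totalDegree_C, zero_add]
  refine (totalDegree_finsetProd _ _).trans ?_
  calc ∑ i ∈ m.support, (φ i ^ m i).totalDegree ≤ ∑ i ∈ m.support, m i * d :=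
        Finset.sum_le_sum fun i _ =>
          (totalDegree_pow _ _).trans (Nat.mul_le_mul_left _ (hφ i))
    _ = (∑ i ∈ m.support, m i) * d := by rw [Finset.sum_mul]
    _ ≤ f.totalDegree * d := Nat.mul_le_mul_right _ (le_totalDegree hm)

theorem natDegree_aeval_le {R σ : Type*} [CommRing R] (φ : σ → Polynomial R) (d : ℕ)
    (hφ : ∀ s, (φ s).natDegree ≤ d) (f : MvPolynomial σ R) :
    (aeval φ f).natDegree ≤ f.totalDegree * d := by
  rw [aeval_def, eval₂_eq]
  refine Polynomial.natDegree_sum_le_of_forall_le _ _ fun m hm => ?_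
  refine Polynomial.natDegree_mul_le.trans ?_
  rw [Polynomial.algebraMap_eq, Polynomial.natDegree_C, zero_add]
  refine (Polynomial.natDegree_prod_le _ _).trans ?_
  calc ∑ i ∈ m.support, (φ i ^ m i).natDegree ≤ ∑ i ∈ m.support, m i * d :=
        Finset.sum_le_sum fun i _ =>
          Polynomial.natDegree_pow_le.trans (Nat.mul_le_mul_left _ (hφ i))
    _ = (∑ i ∈ m.support, m i) * d := by rw [Finset.sum_mul]
    _ ≤ f.totalDegree * d := Nat.mul_le_mul_right _ (le_totalDegree hm)

end Degrees

/-! ### The Zariski topology of the general linear group -/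

variable {n : ℕ} {K : Type*} [Field K]

/-- The generic `n × n` matrix. -/
def genMat (n : ℕ) (K : Type*) [Field K] :
    Matrix (Fin n) (Fin n) (MvPolynomial (Option (Fin n × Fin n)) K) :=
  Matrix.of fun i j => X (some (i, j))

theorem genMat_map (g : GL (Fin n) K) :
    (genMat n K).map (aeval (R := K) (glEmbed g)) = (g : Matrix (Fin n) (Fin n) K) := by
  ext i j
  simp [genMat, glEmbed]

/-- Substitution of `a * x * b` for `x` in polynomial functions on `GL_n`. -/
def transl (a b : GL (Fin n) K) :
    MvPolynomial (Option (Fin n × Fin n)) K →ₐ[K] MvPolynomial (Option (Fin n × Fin n)) K :=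
  aeval fun o => match o with
    | some (i, j) => ∑ k, ∑ l, C ((a : Matrix (Fin n) (Fin n) K) i k *
        (b : Matrix (Fin n) (Fin n) K) l j) * X (some (k, l))
    | none => C ((a : Matrix (Fin n) (Fin n) K).det⁻¹ * (b : Matrix (Fin n) (Fin n) K).det⁻¹) *
        X none

theorem aeval_transl (a b g : GL (Fin n) K) (f : MvPolynomial (Option (Fin n × Fin n)) K) :
    aeval (R := K) (glEmbed g) (transl a b f) = aeval (R := K) (glEmbed (a * g * b)) f := by
  have : (aeval (R := K) (glEmbed g)).comp (transl a b) =
      aeval (R := K) (glEmbed (a * g * b)) := by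
    ext o
    rcases o with _ | ⟨i, j⟩
    · simp [transl, glEmbed]
      ring
    · simp only [transl, AlgHom.coe_comp, Function.comp_apply, aeval_X, map_sum, map_mul, aeval_C,
        Algebra.algebraMap_self, RingHom.id_apply, glEmbed, Units.val_mul, Matrix.mul_apply,
        Finset.sum_mul]
      rw [Finset.sum_comm]
      refine Finset.sum_congr rfl fun l _ => Finset.sum_congr rfl fun k _ => by ring
  exact DFunLike.congr_fun this f

theorem totalDegree_transl_le (a b : GL (Fin n) K)
    (f : MvPolynomial (Option (Fin n × Fin n)) K) :
    (transl a b f).totalDegree ≤ f.totalDegree := by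
  have := totalDegree_aeval_le (fun o : Option (Fin n × Fin n) => match o with
    | some (i, j) => ∑ k, ∑ l, C ((a : Matrix (Fin n) (Fin n) K) i k *
        (b : Matrix (Fin n) (Fin n) K) l j) * X (some (k, l))
    | none => C ((a : Matrix (Fin n) (Fin n) K).det⁻¹ * (b : Matrix (Fin n) (Fin n) K).det⁻¹) *
        (X none : MvPolynomial (Option (Fin n × Fin n)) K)) 1 ?_ f
  · rwa [mul_one] at this
  · have h : ∀ (c : K) (o : Option (Fin n × Fin n)), (C c * X o).totalDegree ≤ 1 := fun c o =>
      (totalDegree_mul _ _).trans (by simp)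
    rintro (_ | ⟨i, j⟩)
    · exact h _ _
    · exact totalDegree_finsetSum_le fun k _ => totalDegree_finsetSum_le fun l _ => h _ _

/-- This is an identity of polynomials on the whole affine space, not only of functions on GL_n. It
can therefore be applied modulo ideals not yet known to be radical. -/
theorem transl_transl_inv (a b : GL (Fin n) K) (f : MvPolynomial (Option (Fin n × Fin n)) K) :
    transl a b (transl a⁻¹ b⁻¹ f) = f := by
  have hdet : ∀ g : GL (Fin n) K, (g : Matrix (Fin n) (Fin n) K).det ≠ 0 := fun g =>
    (Matrix.isUnits_det_units g).ne_zero
  have : (transl a b).comp (transl a⁻¹ b⁻¹) = AlgHom.id K _ := by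
    ext1 o
    rcases o with _ | ⟨i, j⟩
    · simp only [transl, AlgHom.coe_comp, Function.comp_apply, aeval_X, map_mul, algHom_C,
        algebraMap_eq, AlgHom.coe_id, id_eq]
      rw [← mul_assoc]
      simp only [← map_mul C]
      have h1 : ((a⁻¹ : GL (Fin n) K) : Matrix (Fin n) (Fin n) K).det⁻¹ *
          ((b⁻¹ : GL (Fin n) K) : Matrix (Fin n) (Fin n) K).det⁻¹ *
          ((a : Matrix (Fin n) (Fin n) K).det⁻¹ * (b : Matrix (Fin n) (Fin n) K).det⁻¹) = 1 := by
        rw [Matrix.coe_units_inv, Matrix.coe_units_inv, Matrix.det_nonsing_inv,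
          Matrix.det_nonsing_inv, Ring.inverse_eq_inv', inv_inv, inv_inv]
        have := hdet a
        have := hdet b
        field_simp
      rw [h1, C_1, one_mul]
    · have key : ∀ (c d : GL (Fin n) K) (i j : Fin n),
          transl c d (X (some (i, j))) = ((c : Matrix (Fin n) (Fin n) K).map C * genMat n K *
            (d : Matrix (Fin n) (Fin n) K).map C : Matrix (Fin n) (Fin n) _) i j := by
        intro c d i j
        simp only [transl, aeval_X, Matrix.mul_apply, Matrix.map_apply, genMat, Matrix.of_apply,
          Finset.sum_mul]
        rw [Finset.sum_comm]
        refine Finset.sum_congr rfl fun l _ => Finset.sum_congr rfl fun k _ => ?_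
        rw [map_mul]; ring
      have key2 : (genMat n K).map (transl a b) = (a : Matrix (Fin n) (Fin n) K).map C *
          genMat n K * (b : Matrix (Fin n) (Fin n) K).map C := by
        ext1 i j
        rw [Matrix.map_apply, ← key a b i j]; rfl
      have hC : ∀ A : Matrix (Fin n) (Fin n) K, (A.map C).map (transl a b) = A.map C := by
        intro A; ext1 i j
        simp [algHom_C]
      have hinv : ∀ c : GL (Fin n) K, (c : Matrix (Fin n) (Fin n) K).map C *
          ((c⁻¹ : GL (Fin n) K) : Matrix (Fin n) (Fin n) K).map (C : K →+* MvPolynomial (Option (Fin n × Fin n)) K) = 1 := by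
        intro c
        rw [← Matrix.map_mul, ← Units.val_mul, mul_inv_cancel, Units.val_one, Matrix.map_one _ C_0 C_1]
      have hinv' : ∀ c : GL (Fin n) K, ((c⁻¹ : GL (Fin n) K) : Matrix (Fin n) (Fin n) K).map C *
          (c : Matrix (Fin n) (Fin n) K).map (C : K →+* MvPolynomial (Option (Fin n × Fin n)) K) = 1 := by
        intro c
        rw [← Matrix.map_mul, ← Units.val_mul, inv_mul_cancel, Units.val_one, Matrix.map_one _ C_0 C_1]
      rw [AlgHom.comp_apply, key, ← Matrix.map_apply (f := transl a b), Matrix.map_mul,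
        Matrix.map_mul, hC, hC, key2]
      simp only [← Matrix.mul_assoc, hinv', Matrix.one_mul]
      rw [Matrix.mul_assoc, hinv, Matrix.mul_one]
      rfl
  exact DFunLike.congr_fun this f

/-- Substitution of `x⁻¹` for `x` in polynomial functions on `GL_n`. -/
def invSubst (n : ℕ) (K : Type*) [Field K] :
    MvPolynomial (Option (Fin n × Fin n)) K →ₐ[K] MvPolynomial (Option (Fin n × Fin n)) K :=
  aeval fun o => match o with
    | some (i, j) => X none * (genMat n K).adjugate i j
    | none => (genMat n K).det

theorem aeval_invSubst (g : GL (Fin n) K) (f : MvPolynomial (Option (Fin n × Fin n)) K) :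
    aeval (R := K) (glEmbed g) (invSubst n K f) = aeval (R := K) (glEmbed g⁻¹) f := by
  have hm : (aeval (R := K) (glEmbed g) : _ →+* K).mapMatrix (genMat n K) =
      (g : Matrix (Fin n) (Fin n) K) := genMat_map g
  have : (aeval (R := K) (glEmbed g)).comp (invSubst n K) = aeval (R := K) (glEmbed g⁻¹) := by
    ext o
    rcases o with _ | ⟨i, j⟩
    · have := RingHom.map_det (aeval (R := K) (glEmbed g) : _ →+* K) (genMat n K)
      rw [hm] at this
      simp only [invSubst, AlgHom.coe_comp, Function.comp_apply, aeval_X, glEmbed,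
        Matrix.coe_units_inv, Matrix.det_nonsing_inv, Ring.inverse_eq_inv', inv_inv]
      exact this
    · have := congrFun₂ (RingHom.map_adjugate (aeval (R := K) (glEmbed g) : _ →+* K)
        (genMat n K)) i j
      rw [hm] at this
      simp only [invSubst, AlgHom.coe_comp, Function.comp_apply, aeval_X, map_mul, glEmbed,
        Matrix.coe_units_inv, Matrix.inv_def, Ring.inverse_eq_inv', Matrix.smul_apply, smul_eq_mul]
      rw [← this]
      rfl
  exact DFunLike.congr_fun this f

theorem isClosed_zariskiGL_iff {Z : Set (GL (Fin n) K)} :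
    IsClosed[zariskiGL n K] Z ↔ ∃ S : Set (MvPolynomial (Option (Fin n × Fin n)) K),
      Z = {g | ∀ f ∈ S, aeval (R := K) (glEmbed g) f = 0} := by
  let _ := zariski K (Option (Fin n × Fin n))
  rw [isClosed_induced_iff]
  have hz : ∀ t : Set (Option (Fin n × Fin n) → K), IsClosed t ↔
      ∃ I : Ideal (MvPolynomial (Option (Fin n × Fin n)) K), t = zeroLocus K I := by
    intro t
    rw [← isOpen_compl_iff]
    change tᶜᶜ ∈ _ ↔ _
    rw [compl_compl]
    rfl
  constructor
  · rintro ⟨t, ht, rfl⟩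
    obtain ⟨I, rfl⟩ := (hz t).1 ht
    exact ⟨I, rfl⟩
  · rintro ⟨S, rfl⟩
    refine ⟨zeroLocus K (Ideal.span S), (hz _).2 ⟨_, rfl⟩, ?_⟩
    rw [zeroLocus_span]
    rfl

/-- The ideal of polynomials vanishing on a subset of `GL_n`. -/
def glIdeal (Z : Set (GL (Fin n) K)) : Ideal (MvPolynomial (Option (Fin n × Fin n)) K) :=
  vanishingIdeal K (glEmbed '' Z)

theorem mem_glIdeal {Z : Set (GL (Fin n) K)} {f : MvPolynomial (Option (Fin n × Fin n)) K} :
    f ∈ glIdeal Z ↔ ∀ g ∈ Z, aeval (R := K) (glEmbed g) f = 0 := by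
  simp [glIdeal, mem_vanishingIdeal_iff]

theorem mem_of_forall_glIdeal {Z : Set (GL (Fin n) K)} (hZ : IsClosed[zariskiGL n K] Z)
    {g : GL (Fin n) K} (h : ∀ f ∈ glIdeal Z, aeval (R := K) (glEmbed g) f = 0) : g ∈ Z := by
  obtain ⟨S, rfl⟩ := isClosed_zariskiGL_iff.1 hZ
  exact fun f hf => h f (mem_glIdeal.2 fun g hg => hg f hf)

attribute [local instance] zariskiGL

theorem continuous_mul_mul (a b : GL (Fin n) K) : Continuous fun x : GL (Fin n) K => a * x * b := by
  refine continuous_iff_isClosed.2 fun Z hZ => ?_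
  obtain ⟨S, rfl⟩ := isClosed_zariskiGL_iff.1 hZ
  refine isClosed_zariskiGL_iff.2 ⟨transl a b '' S, ?_⟩
  ext g
  simp only [Set.mem_preimage, Set.mem_ofPred_eq, Set.forall_mem_image, aeval_transl]

/-- Joint continuity is not available: the Zariski topology of a product is in general finer than
the product topology. -/
instance : SeparatelyContinuousMul (GL (Fin n) K) where
  continuous_const_mul {a} := by simpa using continuous_mul_mul a 1
  continuous_mul_const {a} := by simpa using continuous_mul_mul 1 a

instance : ContinuousInv (GL (Fin n) K) where
  continuous_inv := by
    refine continuous_iff_isClosed.2 fun Z hZ => ?_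
    obtain ⟨S, rfl⟩ := isClosed_zariskiGL_iff.1 hZ
    refine isClosed_zariskiGL_iff.2 ⟨invSubst n K '' S, ?_⟩
    ext g
    simp only [Set.mem_preimage, Set.mem_ofPred_eq, Set.forall_mem_image, aeval_invSubst]

/-- A closed set is determined by its ideal, so strictly descending chains of closed sets give
strictly ascending chains of ideals. -/
instance : NoetherianSpace (GL (Fin n) K) := by
  refine ((noetherianSpace_TFAE (GL (Fin n) K)).out 0 1).2 ?_
  refine ⟨?_⟩
  have hanti : ∀ A B : Closeds (GL (Fin n) K), A < B →
      glIdeal (B : Set (GL (Fin n) K)) < glIdeal (A : Set (GL (Fin n) K)) := by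
    intro A B hAB
    refine lt_of_le_of_ne (fun f hf => mem_glIdeal.2 fun g hg => mem_glIdeal.1 hf g (hAB.le hg))
      fun heq => hAB.not_ge fun g hg => ?_
    exact mem_of_forall_glIdeal A.isClosed fun f hf => mem_glIdeal.1 (heq ▸ hf) g hg
  have hwf : WellFounded fun I J : Ideal (MvPolynomial (Option (Fin n × Fin n)) K) => J < I :=
    wellFounded_gt
  exact Subrelation.wf (r := InvImage (fun I J => J < I)
    fun A : Closeds (GL (Fin n) K) => glIdeal (A : Set (GL (Fin n) K)))
    (fun h => hanti _ _ h) (InvImage.wf _ hwf)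

theorem glIdeal_isPrime {Z : Set (GL (Fin n) K)} (hZ : IsIrreducible Z) : (glIdeal Z).IsPrime := by
  obtain ⟨g₀, hg₀⟩ := hZ.1
  refine ⟨fun h => ?_, fun {f₁ f₂} h => ?_⟩
  · have := mem_glIdeal.1 ((Ideal.eq_top_iff_one _).1 h) g₀ hg₀
    simp at this
  · have hcl : ∀ f : MvPolynomial (Option (Fin n × Fin n)) K,
        IsClosed {g : GL (Fin n) K | aeval (R := K) (glEmbed g) f = 0} := fun f =>
      isClosed_zariskiGL_iff.2 ⟨{f}, by simp⟩
    refine (isPreirreducible_iff_isClosed_union_isClosed.1 hZ.2 _ _ (hcl f₁) (hcl f₂) ?_).imp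
      (fun h => mem_glIdeal.2 fun g hg => h hg) fun h => mem_glIdeal.2 fun g hg => h hg
    intro g hg
    have := mem_glIdeal.1 h g hg
    rw [map_mul] at this
    exact mul_eq_zero.1 this

end

end UnipRad


namespace UnipRad

noncomputable section

open MvPolynomial Topology TopologicalSpace

attribute [local instance] LieRing.ofAssociativeRing
attribute [local instance] zariskiGL

variable {n : ℕ} {K : Type*} [Field K]

/-! ### Nilpotent and unipotent matrices in characteristic p > n -/

section Nilpotent

theorem pow_eq_zero_of_isNilpotent {A : Matrix (Fin n) (Fin n) K} (h : IsNilpotent A) :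
    A ^ n = 0 := by
  have h1 := (Matrix.isNilpotent_charpoly_sub_pow_of_isNilpotent h).eq_zero
  rw [Fintype.card_fin, sub_eq_zero] at h1
  have h2 := Matrix.aeval_self_charpoly A
  rwa [h1, map_pow, Polynomial.aeval_X] at h2

variable {p : ℕ} [CharP K p]

theorem natCast_ne_zero_of_lt {k : ℕ} (hk : 0 < k) (hkp : k < p) : (k : K) ≠ 0 := by
  rw [Ne, CharP.cast_eq_zero_iff K p]
  exact Nat.not_dvd_of_pos_of_lt hk hkp

/-- In characteristic `p > n`, a matrix all of whose positive powers have trace zero is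
nilpotent. -/
theorem isNilpotent_of_trace_pow_eq_zero (hnp : n < p) {A : Matrix (Fin n) (Fin n) K}
    (h : ∀ k, 0 < k → (A ^ k).trace = 0) : IsNilpotent A := by
  -- The extra factor X makes the exponent m positive even when A is invertible.
  obtain ⟨r, hr, hdvd⟩ := Polynomial.exists_eq_pow_rootMultiplicity_mul_and_not_dvd
    (Polynomial.X * A.charpoly) (mul_ne_zero Polynomial.X_ne_zero A.charpoly_monic.ne_zero) 0
  rw [map_zero, sub_zero] at hr hdvd
  set m := Polynomial.rootMultiplicity 0 (Polynomial.X * A.charpoly)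
  have hm : 0 < m := by
    rw [Polynomial.rootMultiplicity_pos
      (mul_ne_zero Polynomial.X_ne_zero A.charpoly_monic.ne_zero)]
    simp
  have hcop : IsCoprime (Polynomial.X ^ m) r :=
    ((Polynomial.irreducible_X.coprime_iff_not_dvd).2 hdvd).pow_left
  obtain ⟨u, v, huv⟩ := hcop
  have hzero : A ^ m * Polynomial.aeval A r = 0 := by
    have := congrArg (Polynomial.aeval A) hr
    rw [map_mul, map_mul, map_pow, Polynomial.aeval_X, Matrix.aeval_self_charpoly, mul_zero] at this
    exact this.symm
  -- e is the Fitting projection onto the part where A is invertible. It is a polynomial in A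
  -- without constant term, so its trace vanishes; but the trace of an idempotent is its rank, which
  -- is at most n < p. Hence e = 0.
  set e := Polynomial.aeval A (u * Polynomial.X ^ m) with he
  have hone : e + Polynomial.aeval A (v * r) = 1 := by
    rw [he, ← map_add, huv, map_one]
  have hmul : e * Polynomial.aeval A (v * r) = 0 := by
    rw [he, ← map_mul]
    have : u * Polynomial.X ^ m * (v * r) = u * v * (Polynomial.X ^ m * r) := by ring
    rw [this, map_mul, map_mul (Polynomial.aeval A) (Polynomial.X ^ m), map_pow,
      Polynomial.aeval_X, hzero, mul_zero]
  have hidem : IsIdempotentElem e := by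
    have := congrArg (e * ·) hone
    simp only [mul_add, hmul, mul_one, add_zero] at this
    exact this
  have htr : e.trace = 0 := by
    rw [he, mul_comm, Polynomial.aeval_eq_sum_range, Matrix.trace_sum]
    refine Finset.sum_eq_zero fun k _ => ?_
    rw [Matrix.trace_smul]
    rcases Nat.eq_zero_or_pos k with rfl | hk
    · rw [Polynomial.coeff_X_pow_mul', if_neg (by omega), zero_smul]
    · rw [h k hk, smul_zero]
  have he0 : e = 0 := by
    have hl : IsIdempotentElem (Matrix.toLin' e) := by
      rw [IsIdempotentElem, Module.End.mul_eq_comp, ← Matrix.toLin'_mul, hidem.eq]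
    have h1 := (LinearMap.IsIdempotentElem.isProj_range _ hl).trace
    rw [Matrix.trace_toLin'_eq, htr] at h1
    by_contra hne
    have hpos : 0 < Module.finrank K (LinearMap.range (Matrix.toLin' e)) := by
      rw [Module.finrank_pos_iff, Submodule.nontrivial_iff_ne_bot, Ne, LinearMap.range_eq_bot]
      simpa using hne
    have hle : Module.finrank K (LinearMap.range (Matrix.toLin' e)) ≤ n := by
      have := Submodule.finrank_le (LinearMap.range (Matrix.toLin' e))
      simpa using this
    exact natCast_ne_zero_of_lt (K := K) hpos (hle.trans_lt hnp) h1.symm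
  rw [he0, zero_add, map_mul] at hone
  refine ⟨m, ?_⟩
  have hc : Polynomial.aeval A v * Polynomial.aeval A r =
      Polynomial.aeval A r * Polynomial.aeval A v := by rw [← map_mul, mul_comm, map_mul]
  calc A ^ m = A ^ m * (Polynomial.aeval A r * Polynomial.aeval A v) := by
        rw [← hc, hone, mul_one]
    _ = 0 := by rw [← mul_assoc, hzero, zero_mul]

variable [Fact p.Prime]

theorem matrix_sub_one_pow_char [Nonempty (Fin n)] (k : ℕ) (A : Matrix (Fin n) (Fin n) K) :
    (A - 1) ^ p ^ k = A ^ p ^ k - 1 := by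
  rw [sub_pow_char_pow_of_commute p k (Commute.one_right A), one_pow]

/-- By Frobenius, g^p - 1 = (g - 1)^p. Together with `isNilpotent_of_pow_char_pow_eq_one` this makes
unipotency the same as having p-power order, a condition that is easy to check in products. -/
theorem pow_char_eq_one [Nonempty (Fin n)] (hnp : n < p) {g : GL (Fin n) K}
    (h : IsNilpotent ((g : Matrix (Fin n) (Fin n) K) - 1)) : g ^ p = 1 := by
  have h1 := matrix_sub_one_pow_char (p := p) 1 (g : Matrix (Fin n) (Fin n) K)
  rw [pow_one, pow_eq_zero_of_le hnp.le (pow_eq_zero_of_isNilpotent h)] at h1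
  ext1
  rw [Units.val_pow_eq_pow_val, Units.val_one]
  exact (sub_eq_zero.1 h1.symm)

theorem isNilpotent_of_pow_char_pow_eq_one [Nonempty (Fin n)] {g : GL (Fin n) K} (k : ℕ)
    (h : g ^ p ^ k = 1) : IsNilpotent ((g : Matrix (Fin n) (Fin n) K) - 1) := by
  refine ⟨p ^ k, ?_⟩
  rw [matrix_sub_one_pow_char, ← Units.val_pow_eq_pow_val, h, Units.val_one, sub_self]

end Nilpotent

/-! ### Truncated exponential and logarithm -/

section ExpLog

open Polynomial

/-- The polynomial giving the truncated exponential. -/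
def expPoly (n : ℕ) (K : Type*) [Field K] : K[X] :=
  ∑ k ∈ Finset.range (n + 1), Polynomial.C ((k.factorial : K)⁻¹) * Polynomial.X ^ k

/-- The polynomial giving the truncated logarithm of `1 + X`. -/
def logPoly (n : ℕ) (K : Type*) [Field K] : K[X] :=
  -∑ k ∈ Finset.Icc 1 n, Polynomial.C ((k : K)⁻¹) * (-Polynomial.X) ^ k

theorem matExp_eq_aeval (A : Matrix (Fin n) (Fin n) K) :
    matExp A = Polynomial.aeval A (expPoly n K) := by
  simp [matExp, expPoly, Algebra.smul_def]

theorem matLog_eq_aeval (A : Matrix (Fin n) (Fin n) K) :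
    matLog A = Polynomial.aeval (A - 1) (logPoly n K) := by
  simp [matLog, logPoly, Algebra.smul_def]

variable {p : ℕ} [CharP K p]

theorem derivative_expPoly (hnp : n < p) : Polynomial.derivative (expPoly n K) =
    expPoly n K - Polynomial.C ((n.factorial : K)⁻¹) * Polynomial.X ^ n := by
  have h1 : expPoly n K - Polynomial.C ((n.factorial : K)⁻¹) * Polynomial.X ^ n =
      ∑ k ∈ Finset.range n, Polynomial.C ((k.factorial : K)⁻¹) * Polynomial.X ^ k := by
    rw [expPoly, Finset.sum_range_succ, add_sub_cancel_right]
  rw [h1, expPoly, Finset.sum_range_succ', Polynomial.derivative_add, Polynomial.derivative_sum]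
  simp only [pow_zero, mul_one, Polynomial.derivative_C, add_zero]
  refine Finset.sum_congr rfl fun k hk => ?_
  rw [Polynomial.derivative_C_mul_X_pow]
  congr 2
  have hk1 : ((k + 1 : ℕ) : K) ≠ 0 :=
    natCast_ne_zero_of_lt k.succ_pos (by have := Finset.mem_range.1 hk; omega)
  rw [Nat.factorial_succ, Nat.cast_mul, mul_inv]
  field_simp

theorem one_add_X_mul_derivative_logPoly (hnp : n < p) :
    (1 + Polynomial.X) * Polynomial.derivative (logPoly n K) = 1 - (-Polynomial.X) ^ n := by
  have h1 : Polynomial.derivative (logPoly n K) =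
      ∑ i ∈ Finset.range n, (-Polynomial.X : K[X]) ^ i := by
    have hsum : ∀ (m : ℕ) (f : ℕ → K[X]),
        ∑ k ∈ Finset.Icc 1 m, f k = ∑ k ∈ Finset.range m, f (k + 1) := by
      intro m f
      induction m with
      | zero => simp
      | succ m ih => rw [Finset.sum_Icc_succ_top (by omega), ih, Finset.sum_range_succ]
    rw [logPoly, hsum, Polynomial.derivative_neg, Polynomial.derivative_sum,
      ← Finset.sum_neg_distrib]
    refine Finset.sum_congr rfl fun k hk => ?_
    have hk1 : ((k + 1 : ℕ) : K) ≠ 0 :=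
      natCast_ne_zero_of_lt k.succ_pos (by have := Finset.mem_range.1 hk; omega)
    rw [Polynomial.derivative_C_mul, Polynomial.derivative_pow, Polynomial.derivative_neg,
      Polynomial.derivative_X, ← mul_assoc, ← mul_assoc, ← Polynomial.C_mul,
      inv_mul_cancel₀ hk1]
    simp
  rw [h1]
  have := mul_neg_geom_sum (-Polynomial.X : K[X]) n
  rwa [sub_neg_eq_add] at this

/-- F = exp(log(1 + X)) satisfies (1 + X)F' ≡ F modulo X^n. This gives the recursion (k + 1)a_{k+1}
= (1 - k)a_k for k < n, and k + 1 ≤ n < p is invertible; so a_0 = a_1 = 1 and all later coefficients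
up to index n vanish. -/
theorem X_pow_dvd_expPoly_comp_logPoly (hn : 0 < n) (hnp : n < p) :
    (Polynomial.X : K[X]) ^ (n + 1) ∣ (expPoly n K).comp (logPoly n K) - (1 + Polynomial.X) := by
  set F := (expPoly n K).comp (logPoly n K) with hF
  have hXL : (Polynomial.X : K[X]) ∣ logPoly n K := by
    rw [logPoly, dvd_neg]
    refine Finset.dvd_sum fun k hk => dvd_mul_of_dvd_right ?_ _
    rw [neg_pow]
    exact dvd_mul_of_dvd_right (dvd_pow_self _ (by have := (Finset.mem_Icc.1 hk).1; omega)) _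
  have hdiff : (Polynomial.X : K[X]) ^ n ∣ (1 + Polynomial.X) * Polynomial.derivative F - F := by
    have : (1 + Polynomial.X) * Polynomial.derivative F - F =
        - (F * (-Polynomial.X) ^ n) - Polynomial.C ((n.factorial : K)⁻¹) * logPoly n K ^ n *
          (1 - (-Polynomial.X) ^ n) := by
      rw [hF, Polynomial.derivative_comp, ← mul_assoc, one_add_X_mul_derivative_logPoly hnp,
        derivative_expPoly hnp]
      simp only [Polynomial.sub_comp, Polynomial.mul_comp, Polynomial.C_comp, Polynomial.pow_comp,
        Polynomial.X_comp]
      ring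
    rw [this]
    refine dvd_sub ((dvd_neg.2 (dvd_mul_of_dvd_right ?_ _)))
      (dvd_mul_of_dvd_left (dvd_mul_of_dvd_right (pow_dvd_pow_of_dvd hXL n) _) _)
    rw [neg_pow]
    exact dvd_mul_left _ _
  have hrec : ∀ k < n, ((k + 1 : ℕ) : K) * F.coeff (k + 1) + (k : K) * F.coeff k = F.coeff k := by
    intro k hk
    have := Polynomial.X_pow_dvd_iff.1 hdiff k hk
    rw [Polynomial.coeff_sub, sub_eq_zero, add_mul, one_mul, Polynomial.coeff_add,
      Polynomial.coeff_derivative] at this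
    rcases k with _ | k
    · simpa using this
    · rw [Polynomial.coeff_X_mul, Polynomial.coeff_derivative] at this
      push_cast at this ⊢
      linear_combination this
  have h0 : F.coeff 0 = 1 := by
    obtain ⟨q, hq⟩ := hXL
    rw [Polynomial.coeff_zero_eq_eval_zero, hF, Polynomial.eval_comp, hq, expPoly]
    simp [Polynomial.eval_finsetSum, Finset.sum_range_succ']
  have h1 : F.coeff 1 = 1 := by
    have := hrec 0 hn
    simpa [h0] using this
  have h2 : ∀ k, 2 ≤ k → k ≤ n → F.coeff k = 0 := by
    intro k hk
    induction k, hk using Nat.le_induction with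
    | base =>
      intro h
      have := hrec 1 (by omega)
      have h3 : ((1 + 1 : ℕ) : K) ≠ 0 := natCast_ne_zero_of_lt (by omega) (by omega)
      rw [h1, Nat.cast_one, mul_one, add_eq_right] at this
      exact (mul_eq_zero.1 this).resolve_left h3
    | succ k hk ih =>
      intro h
      have := hrec k (by omega)
      rw [ih (by omega), mul_zero, add_zero] at this
      exact (mul_eq_zero.1 this).resolve_left (natCast_ne_zero_of_lt k.succ_pos (by omega))
  refine Polynomial.X_pow_dvd_iff.2 fun k hk => ?_
  rw [Polynomial.coeff_sub, Polynomial.coeff_add, Polynomial.coeff_one, Polynomial.coeff_X]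
  rcases k with _ | _ | k
  · simp [h0]
  · simp [h1]
  · simp [h2 (k + 2) (by omega) (by omega)]

theorem matExp_matLog (hn : 0 < n) (hnp : n < p) {A : Matrix (Fin n) (Fin n) K}
    (h : IsNilpotent (A - 1)) : matExp (matLog A) = A := by
  obtain ⟨q, hq⟩ := X_pow_dvd_expPoly_comp_logPoly (K := K) hn hnp
  rw [sub_eq_iff_eq_add] at hq
  rw [matExp_eq_aeval, matLog_eq_aeval, ← Polynomial.aeval_comp, hq]
  simp [pow_succ, pow_eq_zero_of_isNilpotent h]

end ExpLog

end

end UnipRad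


namespace UnipRad

noncomputable section

open MvPolynomial Topology TopologicalSpace

attribute [local instance] LieRing.ofAssociativeRing
attribute [local instance] zariskiGL

variable {n : ℕ} {K : Type*} [Field K]

/-! ### The unipotent radical is closed, connected, normal and unipotent -/

section Radical

/-- The closed connected normal unipotent subgroups of `G`. -/
def radicalFamily (G : Subgroup (GL (Fin n) K)) : Set (Subgroup (GL (Fin n) K)) :=
  {V | V ≤ G ∧ (V.subgroupOf G).Normal ∧ IsAlgebraic V ∧ IsConn V ∧ IsUnip V}

theorem isClosed_unipotent : IsClosed
    {g : GL (Fin n) K | ((g : Matrix (Fin n) (Fin n) K) - 1) ^ n = 0} := by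
  refine isClosed_zariskiGL_iff.2
    ⟨Set.range fun ij : Fin n × Fin n => ((genMat n K - 1) ^ n) ij.1 ij.2, ?_⟩
  have key : ∀ g : GL (Fin n) K, ((genMat n K - 1) ^ n).map (aeval (R := K) (glEmbed g)) =
      ((g : Matrix (Fin n) (Fin n) K) - 1) ^ n := by
    intro g
    have h := genMat_map g
    change (aeval (R := K) (glEmbed g)).mapMatrix ((genMat n K - 1) ^ n) = _
    change (aeval (R := K) (glEmbed g)).mapMatrix (genMat n K) = _ at h
    rw [map_pow, map_sub, map_one, h]
  ext g
  simp only [Set.mem_ofPred_eq, Set.forall_mem_range, Prod.forall]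
  rw [← key]
  refine ⟨fun h i j => ?_, fun h => ?_⟩
  · rw [← Matrix.map_apply (f := aeval (R := K) (glEmbed g)), h, Matrix.zero_apply]
  · ext i j
    exact h i j

theorem isUnip_closureSubgroup {H : Subgroup (GL (Fin n) K)} (h : IsUnip H) :
    IsUnip (closureSubgroup H) := by
  intro g hg
  have := closure_minimal (t := {g : GL (Fin n) K | ((g : Matrix (Fin n) (Fin n) K) - 1) ^ n = 0})
    (fun g hg => pow_eq_zero_of_isNilpotent (h g hg)) isClosed_unipotent hg
  exact ⟨n, this⟩

theorem closureSubgroup_mem_radicalFamily {G H : Subgroup (GL (Fin n) K)} (hG : IsAlgebraic G)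
    (hle : H ≤ G) (hconj : ∀ g ∈ G, ∀ x ∈ H, g * x * g⁻¹ ∈ H)
    (hconn : IsConnected (H : Set (GL (Fin n) K))) (hunip : IsUnip H) :
    closureSubgroup H ∈ radicalFamily G := by
  have hle' : closureSubgroup H ≤ G := closure_minimal hle hG
  refine ⟨hle', (Subgroup.normal_subgroupOf_iff hle').2 fun x g hx hg =>
    closureSubgroup_conj (hconj g hg) hx, isClosed_closure, hconn.closure,
    isUnip_closureSubgroup hunip⟩

theorem componentSubgroup_mem_radicalFamily {G H : Subgroup (GL (Fin n) K)}
    (hle : H ≤ G) (hconj : ∀ g ∈ G, ∀ x ∈ H, g * x * g⁻¹ ∈ H)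
    (hcl : IsClosed (H : Set (GL (Fin n) K))) (hunip : IsUnip H) :
    componentSubgroup H ∈ radicalFamily G := by
  have hle' : componentSubgroup H ≤ G := (componentSubgroup_le H).trans hle
  exact ⟨hle', (Subgroup.normal_subgroupOf_iff hle').2 fun x g hx hg =>
    componentSubgroup_conj (hconj g hg) hx, isClosed_componentSubgroup hcl,
    isConnected_componentSubgroup H, fun g hg => hunip g (componentSubgroup_le H hg)⟩

theorem conj_mem_of_mem_radicalFamily {G V : Subgroup (GL (Fin n) K)} (hV : V ∈ radicalFamily G)
    {g x : GL (Fin n) K} (hg : g ∈ G) (hx : x ∈ V) : g * x * g⁻¹ ∈ V :=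
  (Subgroup.normal_subgroupOf_iff hV.1).1 hV.2.1 x g hx hg

variable {p : ℕ} [CharP K p] [Fact p.Prime]

/-- VW is a group by normality, and connected because each translate x * W meets V in x. It is
unipotent since (xy)^p = x' y^p = x' for some x' ∈ V, whence (xy)^(p²) = 1. Its closure belongs to
the family. -/
theorem exists_sup_mem_radicalFamily [Nonempty (Fin n)] (hnp : n < p)
    {G V W : Subgroup (GL (Fin n) K)} (hG : IsAlgebraic G) (hV : V ∈ radicalFamily G)
    (hW : W ∈ radicalFamily G) : ∃ H ∈ radicalFamily G, V ≤ H ∧ W ≤ H := by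
  have hconjV : ∀ w ∈ W, ∀ x ∈ V, w * x * w⁻¹ ∈ V := fun w hw x hx =>
    conj_mem_of_mem_radicalFamily hV (hW.1 hw) hx
  let H : Subgroup (GL (Fin n) K) :=
    { carrier := {z | ∃ x ∈ V, ∃ y ∈ W, x * y = z}
      one_mem' := ⟨1, V.one_mem, 1, W.one_mem, mul_one 1⟩
      mul_mem' := by
        rintro _ _ ⟨x, hx, y, hy, rfl⟩ ⟨x', hx', y', hy', rfl⟩
        exact ⟨x * (y * x' * y⁻¹), V.mul_mem hx (hconjV y hy x' hx'), y * y', W.mul_mem hy hy',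
          by group⟩
      inv_mem' := by
        rintro _ ⟨x, hx, y, hy, rfl⟩
        refine ⟨y⁻¹ * x⁻¹ * y⁻¹⁻¹, hconjV _ (W.inv_mem hy) _ (V.inv_mem hx), y⁻¹, W.inv_mem hy, ?_⟩
        group }
  have hVH : V ≤ H := fun x hx => ⟨x, hx, 1, W.one_mem, mul_one x⟩
  have hWH : W ≤ H := fun y hy => ⟨1, V.one_mem, y, hy, one_mul y⟩
  refine ⟨closureSubgroup H, closureSubgroup_mem_radicalFamily hG ?_ ?_ ?_ ?_,
    fun x hx => subset_closure (hVH hx), fun x hx => subset_closure (hWH hx)⟩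
  · rintro _ ⟨x, hx, y, hy, rfl⟩
    exact G.mul_mem (hV.1 hx) (hW.1 hy)
  · rintro g hg _ ⟨x, hx, y, hy, rfl⟩
    exact ⟨g * x * g⁻¹, conj_mem_of_mem_radicalFamily hV hg hx, g * y * g⁻¹,
      conj_mem_of_mem_radicalFamily hW hg hy, by group⟩
  · refine ⟨⟨1, H.one_mem⟩, isPreconnected_of_forall 1 ?_⟩
    rintro _ ⟨x, hx, y, hy, rfl⟩
    have hc : Continuous fun z : GL (Fin n) K => x * z :=
      SeparatelyContinuousMul.continuous_const_mul (a := x)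
    refine ⟨V ∪ (fun z => x * z) '' W, ?_, Or.inl V.one_mem, Or.inr ⟨y, hy, rfl⟩,
      IsPreconnected.union x hx ⟨1, W.one_mem, mul_one x⟩ hV.2.2.2.1.2
        (hW.2.2.2.1.2.image _ hc.continuousOn)⟩
    rintro _ (hz | ⟨z, hz, rfl⟩)
    · exact hVH hz
    · exact ⟨x, hx, z, hz, rfl⟩
  · rintro _ ⟨x, hx, y, hy, rfl⟩
    have hpow : ∀ k : ℕ, ∃ x' ∈ V, (x * y) ^ k = x' * y ^ k := by
      intro k
      induction k with
      | zero => exact ⟨1, V.one_mem, by simp⟩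
      | succ k ih =>
        obtain ⟨x', hx', h⟩ := ih
        refine ⟨x' * (y ^ k * x * (y ^ k)⁻¹), V.mul_mem hx' (hconjV _ (W.pow_mem hy k) _ hx), ?_⟩
        rw [pow_succ, h]
        group
    obtain ⟨x', hx', h⟩ := hpow p
    rw [pow_char_eq_one hnp (hW.2.2.2.2 y hy), mul_one] at h
    refine isNilpotent_of_pow_char_pow_eq_one (p := p) 2 ?_
    rw [pow_two, pow_mul, h]
    exact pow_char_eq_one hnp (hV.2.2.2.2 x' hx')

/-- The family is directed, so its supremum is a union. That union is connected, normal and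
unipotent; its closure is a member of the family, hence no larger than the supremum. -/
theorem unipotentRadical_mem [Nonempty (Fin n)] (hnp : n < p) {G : Subgroup (GL (Fin n) K)}
    (hG : IsAlgebraic G) : unipotentRadical G ∈ radicalFamily G := by
  have hne : (radicalFamily G).Nonempty := by
    refine ⟨_, closureSubgroup_mem_radicalFamily (H := ⊥) hG bot_le ?_ ?_ ?_⟩
    · intro g _ x hx
      rw [Subgroup.mem_bot] at hx ⊢
      rw [hx, mul_one, mul_inv_cancel]
    · rw [Subgroup.coe_bot]
      exact isConnected_singleton
    · intro g hg
      rw [Subgroup.mem_bot] at hg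
      rw [hg, Units.val_one, sub_self]
      exact IsNilpotent.zero
  have hdir : DirectedOn (· ≤ ·) (radicalFamily G) := by
    intro V hV W hW
    obtain ⟨H, hH, h⟩ := exists_sup_mem_radicalFamily hnp hG hV hW
    exact ⟨H, hH, h⟩
  have hmem : ∀ {x}, x ∈ unipotentRadical G ↔ ∃ V ∈ radicalFamily G, x ∈ V :=
    Subgroup.mem_sSup_of_directedOn hne hdir
  have hcl : closureSubgroup (unipotentRadical G) ∈ radicalFamily G := by
    refine closureSubgroup_mem_radicalFamily hG (sSup_le fun V hV => hV.1) ?_ ?_ ?_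
    · intro g hg x hx
      obtain ⟨V, hV, hxV⟩ := hmem.1 hx
      exact hmem.2 ⟨V, hV, conj_mem_of_mem_radicalFamily hV hg hxV⟩
    · refine ⟨⟨1, Subgroup.one_mem _⟩, isPreconnected_of_forall 1 fun x hx => ?_⟩
      obtain ⟨V, hV, hxV⟩ := hmem.1 hx
      exact ⟨V, fun y hy => hmem.2 ⟨V, hV, hy⟩, V.one_mem, hxV, hV.2.2.2.1.2⟩
    · intro x hx
      obtain ⟨V, hV, hxV⟩ := hmem.1 hx
      exact hV.2.2.2.2 x hxV
  have : closureSubgroup (unipotentRadical G) = unipotentRadical G :=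
    le_antisymm (le_sSup hcl) subset_closure
  rwa [this] at hcl

theorem le_unipotentRadical {G V : Subgroup (GL (Fin n) K)} (hV : V ∈ radicalFamily G) :
    V ≤ unipotentRadical G :=
  le_sSup hV

end Radical

/-! ### The associative algebra spanned by the elements g - 1 -/

section SpanAlgebra

/-- The span of the matrices `g - 1` with `g ∈ U`. -/
def unipSpan (U : Subgroup (GL (Fin n) K)) : Submodule K (Matrix (Fin n) (Fin n) K) :=
  Submodule.span K {A | ∃ g ∈ U, A = (g : Matrix (Fin n) (Fin n) K) - 1}

/-- On generators, (g - 1)(h - 1) = (gh - 1) - (g - 1) - (h - 1). -/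
theorem mul_mem_unipSpan {U : Subgroup (GL (Fin n) K)} {A B : Matrix (Fin n) (Fin n) K}
    (hA : A ∈ unipSpan U) (hB : B ∈ unipSpan U) : A * B ∈ unipSpan U := by
  induction hA, hB using Submodule.span_induction₂ with
  | mem_mem x y hx hy =>
    obtain ⟨g, hg, rfl⟩ := hx
    obtain ⟨h, hh, rfl⟩ := hy
    have : ((g : Matrix (Fin n) (Fin n) K) - 1) * ((h : Matrix (Fin n) (Fin n) K) - 1) =
        (((g * h : GL (Fin n) K) : Matrix (Fin n) (Fin n) K) - 1) -
          ((g : Matrix (Fin n) (Fin n) K) - 1) - ((h : Matrix (Fin n) (Fin n) K) - 1) := by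
      rw [Units.val_mul]; noncomm_ring
    rw [this]
    exact Submodule.sub_mem _ (Submodule.sub_mem _
      (Submodule.subset_span ⟨_, U.mul_mem hg hh, rfl⟩) (Submodule.subset_span ⟨_, hg, rfl⟩))
      (Submodule.subset_span ⟨_, hh, rfl⟩)
  | zero_left y _ => rw [zero_mul]; exact Submodule.zero_mem _
  | zero_right x _ => rw [mul_zero]; exact Submodule.zero_mem _
  | add_left x y z _ _ _ h1 h2 => rw [add_mul]; exact Submodule.add_mem _ h1 h2
  | add_right x y z _ _ _ h1 h2 => rw [mul_add]; exact Submodule.add_mem _ h1 h2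
  | smul_left r x y _ _ h => rw [smul_mul_assoc]; exact Submodule.smul_mem _ _ h
  | smul_right r x y _ _ h => rw [mul_smul_comm]; exact Submodule.smul_mem _ _ h

theorem pow_mem_unipSpan {U : Subgroup (GL (Fin n) K)} {A : Matrix (Fin n) (Fin n) K}
    (hA : A ∈ unipSpan U) {k : ℕ} (hk : 0 < k) : A ^ k ∈ unipSpan U := by
  induction k, hk using Nat.le_induction with
  | base => simpa using hA
  | succ k _ ih => rw [pow_succ]; exact mul_mem_unipSpan ih hA

theorem trace_eq_zero_of_mem_unipSpan {U : Subgroup (GL (Fin n) K)} (hU : IsUnip U)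
    {A : Matrix (Fin n) (Fin n) K} (hA : A ∈ unipSpan U) : A.trace = 0 := by
  induction hA using Submodule.span_induction with
  | mem x hx =>
    obtain ⟨g, hg, rfl⟩ := hx
    exact (Matrix.isNilpotent_trace_of_isNilpotent (hU g hg)).eq_zero
  | zero => exact Matrix.trace_zero _ _
  | add x y _ _ hx hy => rw [Matrix.trace_add, hx, hy, add_zero]
  | smul a x _ hx => rw [Matrix.trace_smul, hx, smul_zero]

/-- The trace is linear and vanishes on the nilpotent generators, hence on the span, which contains
all positive powers of its elements. -/
theorem isNilpotent_of_mem_unipSpan {p : ℕ} [CharP K p] (hnp : n < p)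
    {U : Subgroup (GL (Fin n) K)} (hU : IsUnip U) {A : Matrix (Fin n) (Fin n) K}
    (hA : A ∈ unipSpan U) : IsNilpotent A :=
  isNilpotent_of_trace_pow_eq_zero hnp fun _ hk =>
    trace_eq_zero_of_mem_unipSpan hU (pow_mem_unipSpan hA hk)

theorem conj_mem_unipSpan {U : Subgroup (GL (Fin n) K)} {g : GL (Fin n) K}
    (hg : ∀ x ∈ U, g * x * g⁻¹ ∈ U) {A : Matrix (Fin n) (Fin n) K} (hA : A ∈ unipSpan U) :
    (g : Matrix (Fin n) (Fin n) K) * A * ((g⁻¹ : GL (Fin n) K) : Matrix (Fin n) (Fin n) K) ∈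
      unipSpan U := by
  induction hA using Submodule.span_induction with
  | mem x hx =>
    obtain ⟨u, hu, rfl⟩ := hx
    refine Submodule.subset_span ⟨_, hg u hu, ?_⟩
    rw [Units.val_mul, Units.val_mul, mul_sub, sub_mul, mul_one, ← Units.val_mul g g⁻¹,
      mul_inv_cancel, Units.val_one]
  | zero => rw [mul_zero, zero_mul]; exact Submodule.zero_mem _
  | add x y _ _ hx hy => rw [mul_add, add_mul]; exact Submodule.add_mem _ hx hy
  | smul a x _ hx => rw [mul_smul_comm, smul_mul_assoc]; exact Submodule.smul_mem _ _ hx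

theorem matLog_mem_unipSpan {U : Subgroup (GL (Fin n) K)} {g : GL (Fin n) K} (hg : g ∈ U) :
    matLog (g : Matrix (Fin n) (Fin n) K) ∈ unipSpan U := by
  refine Submodule.neg_mem _ (Submodule.sum_mem _ fun k hk => Submodule.smul_mem _ _
    (pow_mem_unipSpan ?_ (Finset.mem_Icc.1 hk).1))
  rw [← neg_sub]
  exact Submodule.neg_mem _ (Submodule.subset_span ⟨g, hg, rfl⟩)

theorem matExp_sub_one_mem_unipSpan {U : Subgroup (GL (Fin n) K)}
    {A : Matrix (Fin n) (Fin n) K} (hA : A ∈ unipSpan U) : matExp A - 1 ∈ unipSpan U := by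
  rw [matExp, Finset.sum_range_succ']
  simp only [Nat.factorial_zero, Nat.cast_one, inv_one, pow_zero, one_smul, add_sub_cancel_right]
  exact Submodule.sum_mem _ fun k _ => Submodule.smul_mem _ _ (pow_mem_unipSpan hA k.succ_pos)

theorem logLieAlgebra_le_unipSpan {U : Subgroup (GL (Fin n) K)} {A : Matrix (Fin n) (Fin n) K}
    (hA : A ∈ logLieAlgebra U) : A ∈ unipSpan U := by
  let L : LieSubalgebra K (Matrix (Fin n) (Fin n) K) :=
    { unipSpan U with
      lie_mem' := fun {x y} hx hy => by
        rw [LieRing.of_associative_ring_bracket]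
        exact Submodule.sub_mem _ (mul_mem_unipSpan hx hy) (mul_mem_unipSpan hy hx) }
  have : logLieAlgebra U ≤ L := by
    refine LieSubalgebra.lieSpan_le.2 ?_
    rintro _ ⟨g, hg, rfl⟩
    exact matLog_mem_unipSpan hg
  exact this hA

end SpanAlgebra

/-! ### The radical as an identity component -/

section RadicalExp

variable {p : ℕ} [CharP K p] [Fact p.Prime]

theorem unipotentRadical_eq_identityComponent [Nonempty (Fin n)] (hn : 0 < n) (hnp : n < p)
    {G : Subgroup (GL (Fin n) K)} (hG : IsAlgebraic G) :
    (unipotentRadical G : Set (GL (Fin n) K)) = identityComponent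
      (expSet (logLieAlgebra (unipotentRadical G)) ∩ (G : Set (GL (Fin n) K))) := by
  have hU := unipotentRadical_mem hnp hG
  set U := unipotentRadical G with hUdef
  refine Set.Subset.antisymm ?_ ?_
  · refine IsPreconnected.subset_connectedComponentIn hU.2.2.2.1.2 U.one_mem fun g hg => ⟨?_, hU.1 hg⟩
    refine ⟨matLog (g : Matrix (Fin n) (Fin n) K), LieSubalgebra.subset_lieSpan ⟨g, hg, rfl⟩, ?_⟩
    exact (matExp_matLog hn hnp (hU.2.2.2.2 g hg)).symm
  · have hnil : ∀ g : GL (Fin n) K, (g : Matrix (Fin n) (Fin n) K) - 1 ∈ unipSpan U →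
        IsNilpotent ((g : Matrix (Fin n) (Fin n) K) - 1) := fun g hg =>
      isNilpotent_of_mem_unipSpan hnp hU.2.2.2.2 hg
    let S : Submonoid (GL (Fin n) K) :=
      { carrier := {g | g ∈ G ∧ (g : Matrix (Fin n) (Fin n) K) - 1 ∈ unipSpan U}
        one_mem' := ⟨G.one_mem, by rw [Units.val_one, sub_self]; exact Submodule.zero_mem _⟩
        mul_mem' := by
          rintro g h ⟨hg, hg'⟩ ⟨hh, hh'⟩
          refine ⟨G.mul_mem hg hh, ?_⟩
          have : ((g * h : GL (Fin n) K) : Matrix (Fin n) (Fin n) K) - 1 =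
              ((g : Matrix (Fin n) (Fin n) K) - 1) * ((h : Matrix (Fin n) (Fin n) K) - 1) +
              ((g : Matrix (Fin n) (Fin n) K) - 1) + ((h : Matrix (Fin n) (Fin n) K) - 1) := by
            rw [Units.val_mul]; noncomm_ring
          rw [this]
          exact Submodule.add_mem _ (Submodule.add_mem _ (mul_mem_unipSpan hg' hh') hg') hh' }
    -- H is G ∩ (1 + A) with A the span of the g - 1. Inverses come for free: its elements are
    -- unipotent, so g⁻¹ = g^(p-1).
    let H : Subgroup (GL (Fin n) K) :=
      { S with
        inv_mem' := by
          intro g hg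
          have h1 : g ^ p = 1 := pow_char_eq_one hnp (hnil g hg.2)
          have h2 : g⁻¹ = g ^ (p - 1) := by
            rw [inv_eq_iff_mul_eq_one, ← pow_succ',
              Nat.sub_add_cancel (Fact.out : p.Prime).one_le, h1]
          rw [h2]
          exact S.pow_mem hg (p - 1) }
    have hconj : ∀ g ∈ G, ∀ x ∈ H, g * x * g⁻¹ ∈ H := by
      rintro g hg x ⟨hx, hx'⟩
      refine ⟨G.mul_mem (G.mul_mem hg hx) (G.inv_mem hg), ?_⟩
      have := conj_mem_unipSpan (fun y hy => conj_mem_of_mem_radicalFamily hU hg hy) hx'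
      rwa [mul_sub, sub_mul, mul_one, ← Units.val_mul g g⁻¹, mul_inv_cancel, Units.val_one,
        ← Units.val_mul, ← Units.val_mul] at this
    have hle : H ≤ G := fun x hx => hx.1
    -- Passing to the closure avoids checking that H is closed, and keeps normality and unipotency.
    have hfam := componentSubgroup_mem_radicalFamily (H := closureSubgroup H)
      (closure_minimal hle hG) (fun g hg x hx => closureSubgroup_conj (hconj g hg) hx)
      isClosed_closure (isUnip_closureSubgroup fun g hg => hnil g hg.2)
    refine Set.Subset.trans ?_ (le_unipotentRadical hfam)
    refine connectedComponentIn_mono 1 ?_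
    rintro g ⟨⟨A, hA, hgA⟩, hgG⟩
    refine subset_closure ⟨hgG, ?_⟩
    rw [hgA]
    exact matExp_sub_one_mem_unipSpan (logLieAlgebra_le_unipSpan hA)

end RadicalExp

end

end UnipRad


namespace UnipRad

noncomputable section

open MvPolynomial

/-! ### Systems of Frobenius equations -/

section FrobeniusSystem

theorem totalDegree_pow_of_domain {k S : Type*} [Field k] {a : MvPolynomial S k} (ha : a ≠ 0)
    (m : ℕ) : (a ^ m).totalDegree = m * a.totalDegree := by
  induction m with
  | zero => simp
  | succ m ih =>
    rw [pow_succ, totalDegree_mul_of_isDomain (pow_ne_zero m ha) ha, ih]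
    ring

variable {k S ι F : Type*} [Field k] [Fintype ι] [Field F] [Algebra (MvPolynomial S k) F]
  [IsFractionRing (MvPolynomial S k) F]

/-- Denominators cancel one prime at a time. If dψ = b is polynomial and the prime π divides d, then
b_l^p = d^(p-1) ∑ N_ml b_m is divisible by π, so π divides every b_l and can be removed from d. The
induction is on the degree of d. -/
theorem frobeniusSystem_integral [Finite S] {p : ℕ} (hp : 2 ≤ p) (ψ : ι → F)
    (N : ι → ι → MvPolynomial S k)
    (h : ∀ l, ψ l ^ p = ∑ m, algebraMap _ F (N m l) * ψ m) :
    ∃ a : ι → MvPolynomial S k, ∀ l, ψ l = algebraMap _ F (a l) := by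
  have hinj := IsFractionRing.injective (MvPolynomial S k) F
  have main : ∀ (D : ℕ) (d : MvPolynomial S k), d ≠ 0 → d.totalDegree ≤ D →
      (∃ b : ι → MvPolynomial S k, ∀ l, algebraMap _ F d * ψ l = algebraMap _ F (b l)) →
      ∃ a : ι → MvPolynomial S k, ∀ l, ψ l = algebraMap _ F (a l) := by
    intro D
    induction D with
    | zero =>
      rintro d hd hdeg ⟨b, hb⟩
      obtain ⟨c, rfl⟩ : ∃ c, d = C c := ⟨_, totalDegree_eq_zero_iff_eq_C.1 (Nat.le_zero.1 hdeg)⟩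
      have hc : c ≠ 0 := by rintro rfl; simp at hd
      refine ⟨fun l => C c⁻¹ * b l, fun l => ?_⟩
      rw [map_mul, ← hb, ← mul_assoc, ← map_mul, ← C_mul, inv_mul_cancel₀ hc, C_1, map_one, one_mul]
    | succ D ih =>
      rintro d hd hdeg ⟨b, hb⟩
      by_cases hu : IsUnit d
      · refine ih d hd ?_ ⟨b, hb⟩
        obtain ⟨e, he⟩ := hu.exists_right_inv
        have hz := totalDegree_mul_of_isDomain hd (right_ne_zero_of_mul_eq_one he)
        rw [he, totalDegree_one] at hz
        omega
      · obtain ⟨π, hπ, d', rfl⟩ := WfDvdMonoid.exists_irreducible_factor hu hd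
        have hπ0 := hπ.ne_zero
        have hd' : d' ≠ 0 := right_ne_zero_of_mul hd
        have hdvd : ∀ l, π ∣ b l := by
          intro l
          refine hπ.prime.dvd_of_dvd_pow (n := p) ?_
          have : b l ^ p = (π * d') ^ (p - 1) * ∑ m, N m l * b m := by
            apply hinj
            rw [map_pow, ← hb, mul_pow, h, map_mul _ (_ ^ _), map_sum, map_pow _ (π * d')]
            have : (algebraMap _ F (π * d')) ^ p =
                (algebraMap _ F (π * d')) ^ (p - 1) * algebraMap _ F (π * d') := by
              rw [← pow_succ]; congr 1; omega
            rw [this, mul_assoc, Finset.mul_sum]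
            congr 1
            refine Finset.sum_congr rfl fun m _ => ?_
            rw [map_mul _ (N m l), ← hb]; ring
          rw [this]
          exact dvd_mul_of_dvd_left ((dvd_mul_right π d').trans (dvd_pow_self _ (by omega))) _
        choose b' hb' using hdvd
        refine ih d' hd' ?_ ⟨b', fun l => ?_⟩
        · rw [totalDegree_mul_of_isDomain hπ0 hd'] at hdeg
          have : π.totalDegree ≠ 0 := by
            intro h0
            apply hπ.not_isUnit
            rw [totalDegree_eq_zero_iff_eq_C.1 h0] at hπ0 ⊢
            exact (isUnit_iff_ne_zero.2 fun hc => hπ0 (by rw [hc, C_0])).map C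
          omega
        · have hπF : algebraMap _ F π ≠ 0 := by
            rw [Ne, map_eq_zero_iff _ hinj]; exact hπ0
          apply mul_left_cancel₀ hπF
          rw [← mul_assoc, ← map_mul, hb, hb', map_mul]
  obtain ⟨d, hd⟩ := IsLocalization.exist_integer_multiples_of_finite
    (nonZeroDivisors (MvPolynomial S k)) ψ
  choose b hb using hd
  refine main _ d (nonZeroDivisors.ne_zero d.2) le_rfl ⟨b, fun l => ?_⟩
  rw [hb, Algebra.smul_def]

/-- If d is the largest degree of the a_l, the equations give pd ≤ B + d, and p ≥ 2 gives d ≤ B. -/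
theorem frobeniusSystem_degree {p : ℕ} (hp : 2 ≤ p) {B : ℕ} (a : ι → MvPolynomial S k)
    (N : ι → ι → MvPolynomial S k) (hN : ∀ m l, (N m l).totalDegree ≤ B)
    (h : ∀ l, a l ^ p = ∑ m, N m l * a m) (l : ι) : (a l).totalDegree ≤ B := by
  have : Nonempty ι := ⟨l⟩
  obtain ⟨l₀, hl₀⟩ := Finite.exists_max fun l => (a l).totalDegree
  refine (hl₀ l).trans ?_
  by_cases h0 : a l₀ = 0
  · simp [h0]
  have h1 := totalDegree_pow_of_domain h0 p
  have h2 : (a l₀ ^ p).totalDegree ≤ B + (a l₀).totalDegree := by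
    rw [h]
    exact totalDegree_finsetSum_le fun m _ =>
      (totalDegree_mul _ _).trans (add_le_add (hN m l₀) (hl₀ m))
  have h3 := Nat.mul_le_mul_right (a l₀).totalDegree hp
  omega

end FrobeniusSystem

/-! ### Pseudo-division and expansion modulo a monic polynomial -/

section Division

open Polynomial

theorem exists_pseudo_division {A : Type*} [CommRing A] (q : A[X]) (R : ℕ)
    (hq : ∀ i, R < i → q.coeff i = 0) (f : A[X]) :
    ∃ (m : ℕ) (u r : A[X]), Polynomial.C (q.coeff R) ^ m * f = q * u + r ∧
      ∀ i, R ≤ i → r.coeff i = 0 := by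
  have main : ∀ (N : ℕ) (f : A[X]), (∀ i, R + N ≤ i → f.coeff i = 0) →
      ∃ (m : ℕ) (u r : A[X]), Polynomial.C (q.coeff R) ^ m * f = q * u + r ∧
        ∀ i, R ≤ i → r.coeff i = 0 := by
    intro N
    induction N with
    | zero => exact fun f hf => ⟨0, 0, f, by simp, hf⟩
    | succ N ih =>
      intro f hf
      obtain ⟨m, u, r, h, hr⟩ := ih (Polynomial.C (q.coeff R) * f -
        Polynomial.C (f.coeff (R + N)) * (q * Polynomial.X ^ N)) (by
          intro i hi
          rw [Polynomial.coeff_sub, Polynomial.coeff_C_mul, Polynomial.coeff_C_mul,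
            Polynomial.coeff_mul_X_pow', if_pos (by omega)]
          rcases Nat.eq_or_lt_of_le hi with rfl | hi'
          · rw [Nat.add_sub_cancel]; ring
          · rw [hf i (by omega), hq (i - N) (by omega)]; ring)
      refine ⟨m + 1, u + Polynomial.C (q.coeff R) ^ m * Polynomial.C (f.coeff (R + N)) *
        Polynomial.X ^ N, r, ?_, hr⟩
      linear_combination h
  exact main (f.natDegree + 1) f fun i hi =>
    Polynomial.coeff_eq_zero_of_natDegree_lt (by omega)

theorem eq_sum_fin_of_degree_lt {F : Type*} [Field F] {s : F[X]} {R : ℕ} (hs : s.degree < R) :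
    s = ∑ l : Fin R, Polynomial.C (s.coeff l) * Polynomial.X ^ (l : ℕ) := by
  ext i
  rw [Polynomial.finsetSum_coeff]
  simp only [Polynomial.coeff_C_mul_X_pow]
  rw [← Finset.sum_range (fun l => if i = l then s.coeff l else 0), Finset.sum_ite_eq]
  split_ifs with h
  · rfl
  · exact Polynomial.coeff_eq_zero_of_degree_lt
      (hs.trans_le (by exact_mod_cast not_lt.1 (fun h' => h (Finset.mem_range.2 h'))))

/-- By hypothesis every X^l is, modulo h, a polynomial in X^p. So s ↦ s(X^p) mod h is a surjective
endomorphism of the finite-dimensional space of polynomials of degree less than deg h, hence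
injective. -/
theorem eq_zero_of_dvd_expand {F : Type*} [Field F] {h : F[X]} (hm : h.Monic) {p : ℕ}
    (c : Fin h.natDegree → F[X]) (hc : ∀ l, (c l).degree < h.natDegree)
    (hdvd : ∀ l : Fin h.natDegree, h ∣ Polynomial.X ^ (l : ℕ) - Polynomial.expand F p (c l)) {r : F[X]}
    (hr : r.degree < h.natDegree) (hhr : h ∣ Polynomial.expand F p r) : r = 0 := by
  have hdeg : ∀ s : F[X], s %ₘ h ∈ degreeLT F h.natDegree := fun s => by
    rw [mem_degreeLT, ← Polynomial.degree_eq_natDegree hm.ne_zero]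
    exact degree_modByMonic_lt s hm
  let T : degreeLT F h.natDegree →ₗ[F] degreeLT F h.natDegree :=
    ((modByMonicHom h).comp ((Polynomial.expand F p).toLinearMap.comp (degreeLT F h.natDegree).subtype)).codRestrict
      _ fun s => hdeg _
  have hsurj : Function.Surjective T := by
    rintro ⟨s, hs⟩
    have hs' := mem_degreeLT.1 hs
    refine ⟨⟨∑ l : Fin h.natDegree, Polynomial.C (s.coeff l) * c l, ?_⟩, ?_⟩
    · refine Submodule.sum_mem _ fun l _ => ?_
      rw [← Polynomial.smul_eq_C_mul]
      exact Submodule.smul_mem _ _ (mem_degreeLT.2 (hc l))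
    · ext1
      change Polynomial.expand F p (∑ l : Fin h.natDegree, Polynomial.C (s.coeff l) * c l) %ₘ h = s
      rw [← Polynomial.degree_eq_natDegree hm.ne_zero] at hs'
      refine Eq.trans ?_ ((modByMonic_eq_self_iff hm).2 hs')
      rw [← sub_eq_zero, ← sub_modByMonic, modByMonic_eq_zero_iff_dvd hm]
      rw [Polynomial.degree_eq_natDegree hm.ne_zero] at hs'
      nth_rewrite 2 [eq_sum_fin_of_degree_lt hs']
      rw [map_sum, ← Finset.sum_sub_distrib]
      refine Finset.dvd_sum fun l _ => ?_
      rw [map_mul, Polynomial.expand_C, ← mul_sub, ← neg_sub, mul_neg, dvd_neg]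
      exact dvd_mul_of_dvd_right (hdvd l) _
  have hinj := LinearMap.injective_iff_surjective.2 hsurj
  have := @hinj ⟨r, mem_degreeLT.2 hr⟩ 0 (by
    ext1
    rw [map_zero]
    exact (modByMonic_eq_zero_iff_dvd hm).2 hhr)
  exact congrArg Subtype.val this

end Division

end

end UnipRad


namespace UnipRad

noncomputable section

open MvPolynomial

/-! ### Generic presentations and their consequences -/

section Presentation

variable {k σ : Type*} [Field k] {S : Set σ}

/-- Substitution of the polynomial `z` for the indeterminate of `k[x_s : s ∈ S][Z]`. -/
def substZ (S : Set σ) (z : MvPolynomial σ k) :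
    Polynomial (MvPolynomial S k) →+* MvPolynomial σ k :=
  Polynomial.eval₂RingHom (rename ((↑) : S → σ) : MvPolynomial S k →ₐ[k] MvPolynomial σ k).toRingHom z

theorem substZ_C (z : MvPolynomial σ k) (a : MvPolynomial S k) :
    substZ S z (Polynomial.C a) = rename ((↑) : S → σ) a := by
  simp [substZ]

theorem substZ_X (z : MvPolynomial σ k) : substZ S z Polynomial.X = z := by
  simp [substZ]

variable {F : Type*} [Field F] [Algebra (MvPolynomial S k) F]

/-- Substitution of the polynomials `G s` over `F` for the variables of `k[x_s : s ∈ σ]`. -/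
def substG (G : σ → Polynomial F) : MvPolynomial σ k →+* Polynomial F :=
  eval₂Hom ((Polynomial.C.comp (algebraMap (MvPolynomial S k) F)).comp C) G

variable (F S) in
/-- A presentation of `k[x_s : s ∈ σ] / J` at the generic points: after inverting `δ`, it is
generated over `k[x_s : s ∈ S]` by a root `z` of the separable monic polynomial `h`. -/
structure GenericPresentation (J : Ideal (MvPolynomial σ k)) where
  /-- a common denominator -/
  δ : MvPolynomial S k
  /-- the minimal polynomial of the generator -/
  h : Polynomial F
  /-- the coordinates as polynomials in the generator -/
  G : σ → Polynomial F
  /-- the generator -/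
  z : MvPolynomial σ k
  /-- the minimal polynomial multiplied by the denominator -/
  hNum : Polynomial (MvPolynomial S k)
  /-- the coordinate polynomials multiplied by the denominator -/
  GNum : σ → Polynomial (MvPolynomial S k)
  δ_ne : δ ≠ 0
  monic : h.Monic
  separable : h.Separable
  map_hNum : hNum.map (algebraMap _ F) = Polynomial.C (algebraMap _ F δ) * h
  map_GNum : ∀ s, (GNum s).map (algebraMap _ F) = Polynomial.C (algebraMap _ F δ) * G s
  substZ_hNum : substZ S z hNum ∈ J
  substZ_GNum : ∀ s, rename ((↑) : S → σ) δ * X s - substZ S z (GNum s) ∈ J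
  dvd_of_mem : ∀ f ∈ J, h ∣ substG (k := k) (S := S) G f
  dvd_z : h ∣ substG (k := k) (S := S) G z - Polynomial.X
  dvd_coord : ∀ s : S, h ∣ substG (k := k) (S := S) G (X (s : σ)) - Polynomial.C (algebraMap (MvPolynomial S k) F (X s))

namespace GenericPresentation

variable {J : Ideal (MvPolynomial σ k)} (P : GenericPresentation S F J)

/-- Two ring homomorphisms to F[X]/(h) are compared on the constants, the variables in S and the
generator. -/
theorem dvd_substZ (f : Polynomial (MvPolynomial S k)) :
    P.h ∣ substG (S := S) P.G (substZ S P.z f) - f.map (algebraMap _ F) := by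
  have key : ((Ideal.Quotient.mk (Ideal.span {P.h})).comp (substG (S := S) P.G)).comp
      (substZ S P.z) = (Ideal.Quotient.mk (Ideal.span {P.h})).comp
        (Polynomial.mapRingHom (algebraMap (MvPolynomial S k) F)) := by
    refine Polynomial.ringHom_ext' (MvPolynomial.ringHom_ext (fun c => ?_) fun s => ?_) ?_
    · simp [substZ_C, substG]
    · have := P.dvd_coord s
      simp only [RingHom.comp_apply, substZ_C, rename_X, Polynomial.coe_mapRingHom,
        Polynomial.map_C]
      rwa [Ideal.Quotient.mk_eq_mk_iff_sub_mem, Ideal.mem_span_singleton]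
    · simp only [RingHom.comp_apply, substZ_X, Polynomial.coe_mapRingHom, Polynomial.map_X]
      rw [Ideal.Quotient.mk_eq_mk_iff_sub_mem, Ideal.mem_span_singleton]
      exact P.dvd_z
  have := RingHom.congr_fun key f
  simp only [RingHom.comp_apply, Polynomial.coe_mapRingHom] at this
  rwa [Ideal.Quotient.mk_eq_mk_iff_sub_mem, Ideal.mem_span_singleton] at this

/-- Modulo J, each variable times δ is a polynomial in z, so each factor of a monomial costs one
power of δ. -/
theorem exists_substZ_sub_mem (f : MvPolynomial σ k) :
    ∃ (N : ℕ) (f' : Polynomial (MvPolynomial S k)),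
      (rename ((↑) : S → σ) P.δ) ^ N * f - substZ S P.z f' ∈ J := by
  induction f using MvPolynomial.induction_on with
  | C a => exact ⟨0, Polynomial.C (C a), by simp [substZ_C]⟩
  | add f g hf hg =>
    obtain ⟨N, f', hf'⟩ := hf
    obtain ⟨M, g', hg'⟩ := hg
    refine ⟨N + M, Polynomial.C P.δ ^ M * f' + Polynomial.C P.δ ^ N * g', ?_⟩
    have := J.add_mem (J.mul_mem_left ((rename ((↑) : S → σ) P.δ) ^ M) hf')
      (J.mul_mem_left ((rename ((↑) : S → σ) P.δ) ^ N) hg')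
    convert this using 1
    simp only [map_add, map_mul, map_pow, substZ_C]
    ring
  | mul_X f s hf =>
    obtain ⟨N, f', hf'⟩ := hf
    refine ⟨N + 1, f' * P.GNum s, ?_⟩
    have := J.add_mem (J.mul_mem_left ((rename ((↑) : S → σ) P.δ) ^ N * f) (P.substZ_GNum s))
      (J.mul_mem_right (substZ S P.z (P.GNum s)) hf')
    convert this using 1
    rw [map_mul]
    ring

/-- Separability enters here: h is squarefree, so it divides a polynomial as soon as it divides a
positive power of it. -/
theorem dvd_of_mem_radical {f : MvPolynomial σ k} (hf : f ∈ J.radical) :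
    P.h ∣ substG (S := S) P.G f := by
  obtain ⟨m, hm⟩ := hf
  have h1 := P.dvd_of_mem _ hm
  rw [map_pow] at h1
  rcases Nat.eq_zero_or_pos m with rfl | hm0
  · rw [pow_zero] at h1
    exact h1.trans (one_dvd _)
  · exact (P.separable.squarefree.dvd_pow_iff_dvd hm0.ne').1 h1

variable [IsFractionRing (MvPolynomial S k) F]

/-- An element whose image vanishes generically is annihilated by a power of `δ` modulo `J`. -/
theorem exists_pow_mul_mem {f : MvPolynomial σ k} (hf : P.h ∣ substG (S := S) P.G f) :
    ∃ N : ℕ, (rename ((↑) : S → σ) P.δ) ^ N * f ∈ J := by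
  have hinj := IsFractionRing.injective (MvPolynomial S k) F
  obtain ⟨N, f', hf'⟩ := P.exists_substZ_sub_mem f
  have hdvd : P.h ∣ f'.map (algebraMap _ F) := by
    have h1 := P.dvd_of_mem _ hf'
    rw [map_sub, map_mul] at h1
    have h2 := (dvd_sub_right (dvd_mul_of_dvd_right hf _)).1 h1
    exact (dvd_sub_right h2).1 (P.dvd_substZ f')
  have hcoeff : ∀ i, algebraMap _ F (P.hNum.coeff i) = algebraMap _ F P.δ * P.h.coeff i := by
    intro i
    rw [← Polynomial.coeff_map, P.map_hNum, Polynomial.coeff_C_mul]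
  have hlead : P.hNum.coeff P.h.natDegree = P.δ := by
    apply hinj
    rw [hcoeff, P.monic.coeff_natDegree, mul_one]
  -- `hNum` has leading coefficient δ. The remainder is divisible by h over F and of smaller degree,
  -- hence zero, so a power of δ times f' is a multiple of `hNum`, whose value at z lies in J.
  obtain ⟨m, u, r, hur, hr⟩ := exists_pseudo_division P.hNum P.h.natDegree (fun i hi => by
    apply hinj
    rw [hcoeff, Polynomial.coeff_eq_zero_of_natDegree_lt hi, mul_zero, map_zero]) f'
  rw [hlead] at hur
  have hr0 : r = 0 := by
    have h1 : P.h ∣ r.map (algebraMap _ F) := by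
      have h2 := congrArg (Polynomial.map (algebraMap _ F)) hur
      rw [Polynomial.map_mul, Polynomial.map_add, Polynomial.map_mul, P.map_hNum] at h2
      have h3 := dvd_mul_of_dvd_right hdvd ((Polynomial.C P.δ ^ m).map (algebraMap _ F))
      rw [h2] at h3
      refine (dvd_add_right ?_).1 h3
      exact dvd_mul_of_dvd_left (dvd_mul_left _ _) _
    have h4 : r.map (algebraMap _ F) = 0 := by
      refine Polynomial.eq_zero_of_dvd_of_degree_lt h1 ?_
      rw [Polynomial.degree_eq_natDegree P.monic.ne_zero, Polynomial.degree_lt_iff_coeff_zero]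
      intro i hi
      rw [Polynomial.coeff_map, hr i hi, map_zero]
    exact (Polynomial.map_eq_zero_iff hinj).1 h4
  rw [hr0, add_zero] at hur
  refine ⟨m + N, ?_⟩
  have h1 := congrArg (substZ S P.z) hur
  rw [map_mul, map_mul, map_pow, substZ_C] at h1
  have h2 := J.add_mem (J.mul_mem_left ((rename ((↑) : S → σ) P.δ) ^ m) hf')
    (J.mul_mem_right (substZ S P.z u) P.substZ_hNum)
  convert h2 using 1
  rw [← h1]
  ring

/-- `J` is radical at its generic points. -/
theorem exists_pow_mul_mem_of_mem_radical {f : MvPolynomial σ k} (hf : f ∈ J.radical) :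
    ∃ N : ℕ, (rename ((↑) : S → σ) P.δ) ^ N * f ∈ J :=
  P.exists_pow_mul_mem (P.dvd_of_mem_radical hf)

/-- Functions that are fixed by the Frobenius modulo `J` are represented by polynomials of bounded
degree. -/
theorem exists_bounded_of_frobenius [Finite S] {p : ℕ} [Fact p.Prime] [CharP F p]
    (c : Fin P.h.natDegree → Polynomial F) (hc : ∀ l, (c l).degree < P.h.natDegree)
    (hdvd : ∀ l : Fin P.h.natDegree, P.h ∣ Polynomial.X ^ (l : ℕ) - Polynomial.expand F p (c l))
    (cNum : Fin P.h.natDegree → Polynomial (MvPolynomial S k))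
    (map_cNum : ∀ l, (cNum l).map (algebraMap _ F) = Polynomial.C (algebraMap _ F P.δ) * c l)
    {T : ℕ} (hδT : P.δ.totalDegree ≤ T) (hcT : ∀ l i, ((cNum l).coeff i).totalDegree ≤ T)
    (hzT : P.z.totalDegree ≤ T) {f : MvPolynomial σ k} (hf : f ^ p - f ∈ J.radical) :
    ∃ e : MvPolynomial σ k, e.totalDegree ≤ p * T + P.h.natDegree * T + T ∧
      ∃ N : ℕ, (rename ((↑) : S → σ) P.δ) ^ N * (e - rename ((↑) : S → σ) P.δ * f) ∈ J := by
  have hp : 2 ≤ p := (Fact.out : p.Prime).two_le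
  have hinj := IsFractionRing.injective (MvPolynomial S k) F
  -- φ is the image of f in F[X]/(h), and there φ^p = φ.
  set φ := substG (S := S) P.G f %ₘ P.h with hφ
  have hφdeg : φ.degree < P.h.natDegree := by
    rw [← Polynomial.degree_eq_natDegree P.monic.ne_zero]
    exact Polynomial.degree_modByMonic_lt _ P.monic
  have hφf : P.h ∣ substG (S := S) P.G f - φ := by
    rw [hφ, ← Polynomial.modByMonic_eq_zero_iff_dvd P.monic, Polynomial.sub_modByMonic,
      sub_eq_zero, eq_comm, Polynomial.modByMonic_eq_self_iff P.monic]
    exact Polynomial.degree_modByMonic_lt _ P.monic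
  have hφp : P.h ∣ φ - φ ^ p := by
    have h1 := P.dvd_of_mem_radical hf
    rw [map_sub, map_pow] at h1
    have h2 : P.h ∣ substG (S := S) P.G f ^ p - φ ^ p := hφf.trans (sub_dvd_pow_sub_pow _ _ p)
    have : φ - φ ^ p = (substG (S := S) P.G f ^ p - φ ^ p) -
      (substG (S := S) P.G f ^ p - substG (S := S) P.G f) - (substG (S := S) P.G f - φ) := by ring
    rw [this]
    exact dvd_sub (dvd_sub h2 h1) hφf
  have hφsum := eq_sum_fin_of_degree_lt hφdeg
  -- Modulo h, φ is ∑ φ_m c_m(X^p), while φ^p = ∑ φ_l^p X^(pl). Both are polynomials in X^p, so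
  -- their coefficients may be compared.
  have hzero : (∑ m : Fin P.h.natDegree, Polynomial.C (φ.coeff m) * c m) -
      ∑ l : Fin P.h.natDegree, Polynomial.C (φ.coeff l ^ p) * Polynomial.X ^ (l : ℕ) = 0 := by
    refine eq_zero_of_dvd_expand P.monic c hc hdvd ?_ ?_
    · refine (Polynomial.degree_sub_le _ _).trans_lt (max_lt ?_ ?_)
      · rw [← Polynomial.mem_degreeLT]
        refine Submodule.sum_mem _ fun l _ => ?_
        rw [← Polynomial.smul_eq_C_mul]
        exact Submodule.smul_mem _ _ (Polynomial.mem_degreeLT.2 (hc l))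
      · rw [← Polynomial.mem_degreeLT]
        refine Submodule.sum_mem _ fun l _ => Polynomial.mem_degreeLT.2 ?_
        exact (Polynomial.degree_C_mul_X_pow_le _ _).trans_lt (by exact_mod_cast l.2)
    · have hφpow : φ ^ p = Polynomial.expand F p (∑ l : Fin P.h.natDegree,
          Polynomial.C (φ.coeff l ^ p) * Polynomial.X ^ (l : ℕ)) := by
        conv_lhs => rw [hφsum]
        rw [sum_pow_char, map_sum]
        refine Finset.sum_congr rfl fun l _ => ?_
        rw [mul_pow, map_mul, Polynomial.expand_C, map_pow, map_pow, Polynomial.expand_X, ← pow_mul,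
          ← pow_mul, mul_comm p]
      rw [map_sub, ← hφpow]
      have : Polynomial.expand F p (∑ m : Fin P.h.natDegree, Polynomial.C (φ.coeff m) * c m) -
          φ ^ p = (φ - φ ^ p) - ∑ m : Fin P.h.natDegree, Polynomial.C (φ.coeff m) *
            (Polynomial.X ^ (m : ℕ) - Polynomial.expand F p (c m)) := by
        simp only [mul_sub, Finset.sum_sub_distrib]
        rw [← hφsum, map_sum]
        simp only [map_mul, Polynomial.expand_C]
        ring
      rw [this]
      exact dvd_sub hφp (Finset.dvd_sum fun m _ => dvd_mul_of_dvd_right (hdvd m) _)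
  have hsys : ∀ l : Fin P.h.natDegree,
      φ.coeff l ^ p = ∑ m : Fin P.h.natDegree, φ.coeff m * (c m).coeff l := by
    intro l
    have := congrArg (fun q => Polynomial.coeff q l) (sub_eq_zero.1 hzero)
    simp only [Polynomial.finsetSum_coeff, Polynomial.coeff_C_mul, Polynomial.coeff_X_pow] at this
    rw [this, Finset.sum_eq_single l]
    · simp
    · intro m _ hm
      rw [if_neg (fun h => hm (Fin.ext h.symm)), mul_zero]
    · simp
  -- After multiplication by δ^p, one factor δ clears the denominator of c_m, another is attached to
  -- φ_m, and δ^(p-2) is left over.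
  have hsys' : ∀ l : Fin P.h.natDegree, (algebraMap _ F P.δ * φ.coeff l) ^ p =
      ∑ m : Fin P.h.natDegree, algebraMap _ F (P.δ ^ (p - 2) * (cNum m).coeff l) *
        (algebraMap _ F P.δ * φ.coeff m) := by
    intro l
    rw [mul_pow, hsys, Finset.mul_sum]
    refine Finset.sum_congr rfl fun m _ => ?_
    rw [map_mul, ← Polynomial.coeff_map, map_cNum, Polynomial.coeff_C_mul, map_pow]
    have : (algebraMap _ F P.δ) ^ p = (algebraMap _ F P.δ) ^ (p - 2) *
        (algebraMap _ F P.δ * algebraMap _ F P.δ) := by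
      rw [← pow_two, ← pow_add]; congr 1; omega
    rw [this]; ring
  obtain ⟨a, ha⟩ := frobeniusSystem_integral hp (fun l : Fin P.h.natDegree =>
    algebraMap _ F P.δ * φ.coeff l) (fun m l => P.δ ^ (p - 2) * (cNum m).coeff l) hsys'
  have hadeg : ∀ l, (a l).totalDegree ≤ p * T := by
    refine frobeniusSystem_degree hp a (fun m l => P.δ ^ (p - 2) * (cNum m).coeff l)
      (fun m l => ?_) fun l => ?_
    · refine (totalDegree_mul _ _).trans ((add_le_add ((totalDegree_pow _ _).trans
        (Nat.mul_le_mul_left _ hδT)) (hcT m l)).trans ?_)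
      obtain ⟨q, rfl⟩ := Nat.exists_eq_add_of_le hp
      rw [Nat.add_sub_cancel_left]
      nlinarith
    · apply hinj
      rw [map_pow, ← ha, hsys', map_sum]
      refine Finset.sum_congr rfl fun m _ => ?_
      rw [map_mul _ (_ * _), ha]
  set e' : Polynomial (MvPolynomial S k) :=
    ∑ l : Fin P.h.natDegree, Polynomial.C (a l) * Polynomial.X ^ (l : ℕ) with he'
  have hmap : e'.map (algebraMap _ F) = Polynomial.C (algebraMap _ F P.δ) * φ := by
    rw [he', Polynomial.map_sum, hφsum, Finset.mul_sum]
    refine Finset.sum_congr rfl fun l _ => ?_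
    rw [Polynomial.map_mul, Polynomial.map_C, Polynomial.map_pow, Polynomial.map_X, ← ha,
      Polynomial.C_mul, mul_assoc]
  refine ⟨substZ S P.z e', ?_, P.exists_pow_mul_mem ?_⟩
  · rw [he', map_sum]
    refine totalDegree_finsetSum_le fun l _ => ?_
    rw [map_mul, substZ_C, map_pow, substZ_X]
    refine (totalDegree_mul _ _).trans ?_
    have h1 := (totalDegree_rename_le ((↑) : S → σ) (a l)).trans (hadeg l)
    have h2 := (totalDegree_pow P.z l).trans (Nat.mul_le_mul l.2.le hzT)
    omega
  · have h1 := P.dvd_substZ e'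
    have h2 := P.dvd_substZ (Polynomial.C P.δ)
    rw [substZ_C, Polynomial.map_C] at h2
    rw [hmap] at h1
    have : substG (S := S) P.G (substZ S P.z e' - rename ((↑) : S → σ) P.δ * f) =
        (substG (S := S) P.G (substZ S P.z e') - Polynomial.C (algebraMap _ F P.δ) * φ) -
        (substG (S := S) P.G (rename ((↑) : S → σ) P.δ) - Polynomial.C (algebraMap _ F P.δ)) *
          substG (S := S) P.G f -
        Polynomial.C (algebraMap _ F P.δ) * (substG (S := S) P.G f - φ) := by
      rw [map_sub, map_mul]; ring
    rw [this]
    exact dvd_sub (dvd_sub h1 (dvd_mul_of_dvd_left h2 _)) (dvd_mul_of_dvd_right hφf _)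

end GenericPresentation

end Presentation

end

end UnipRad


/-! ### Truncating the ideal of the radical at degree D -/

namespace UnipRad

noncomputable section

open MvPolynomial Topology TopologicalSpace

attribute [local instance] zariskiGL

/-- The ideal generated by the elements of degree at most `D` of an ideal. -/
def lowSpan {σ K : Type*} [Field K] (D : ℕ) (P : Ideal (MvPolynomial σ K)) :
    Ideal (MvPolynomial σ K) :=
  Ideal.span {f | f ∈ P ∧ f.totalDegree ≤ D}

theorem lowSpan_le {σ K : Type*} [Field K] (D : ℕ) (P : Ideal (MvPolynomial σ K)) :
    lowSpan D P ≤ P :=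
  Ideal.span_le.2 fun _ hf => hf.1

theorem mem_lowSpan {σ K : Type*} [Field K] {D : ℕ} {P : Ideal (MvPolynomial σ K)}
    {f : MvPolynomial σ K} (hf : f ∈ P) (hD : f.totalDegree ≤ D) : f ∈ lowSpan D P :=
  Ideal.subset_span ⟨hf, hD⟩

variable {n : ℕ} {K : Type*} [Field K]

section LowZeros

/-- The points of `GL_n` at which all polynomials of degree at most `D` vanishing on `U` vanish. -/
def lowZeros (D : ℕ) (U : Set (GL (Fin n) K)) : Set (GL (Fin n) K) :=
  {g | ∀ f ∈ glIdeal U, f.totalDegree ≤ D → aeval (R := K) (glEmbed g) f = 0}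

theorem subset_lowZeros (D : ℕ) (U : Set (GL (Fin n) K)) : U ⊆ lowZeros D U :=
  fun g hg _ hf _ => mem_glIdeal.1 hf g hg

theorem lowSpan_le_glIdeal_lowZeros (D : ℕ) (U : Set (GL (Fin n) K)) :
    lowSpan D (glIdeal U) ≤ glIdeal (lowZeros D U) :=
  Ideal.span_le.2 fun f hf => mem_glIdeal.2 fun _ hg => hg f hf.1 hf.2

theorem isClosed_lowZeros (D : ℕ) (U : Set (GL (Fin n) K)) : IsClosed (lowZeros D U) := by
  refine isClosed_zariskiGL_iff.2 ⟨{f | f ∈ glIdeal U ∧ f.totalDegree ≤ D}, ?_⟩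
  ext g
  simp [lowZeros, and_imp]

/-- Translations are linear substitutions and do not raise degrees, so the low-degree zero set
inherits the translation symmetries of U. -/
theorem mul_mul_mem_lowZeros {D : ℕ} {U W : Set (GL (Fin n) K)} {a b : GL (Fin n) K}
    (h : ∀ x ∈ U, a * x * b ∈ lowZeros D W) {g : GL (Fin n) K} (hg : g ∈ lowZeros D U) :
    a * g * b ∈ lowZeros D W := by
  intro f hf hfD
  rw [← aeval_transl]
  refine hg _ (mem_glIdeal.2 fun x hx => ?_) ((totalDegree_transl_le a b f).trans hfD)
  rw [aeval_transl]
  exact h x hx f hf hfD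

theorem mul_mem_lowZeros {D : ℕ} (U : Subgroup (GL (Fin n) K)) {g h : GL (Fin n) K}
    (hg : g ∈ lowZeros D (U : Set (GL (Fin n) K)))
    (hh : h ∈ lowZeros D (U : Set (GL (Fin n) K))) :
    g * h ∈ lowZeros D (U : Set (GL (Fin n) K)) := by
  have h1 : ∀ u ∈ U, g * u ∈ lowZeros D (U : Set (GL (Fin n) K)) := fun u hu => by
    have := mul_mul_mem_lowZeros (a := 1) (b := u) (W := (U : Set (GL (Fin n) K)))
      (fun x hx => by
        rw [one_mul]
        exact subset_lowZeros D _ (U.mul_mem hx hu)) hg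
    rwa [one_mul] at this
  have := mul_mul_mem_lowZeros (a := g) (b := 1) (W := (U : Set (GL (Fin n) K)))
    (fun x hx => by rw [mul_one]; exact h1 x hx) hh
  rwa [mul_one] at this

theorem totalDegree_det_genMat_le : (genMat n K).det.totalDegree ≤ n := by
  rw [Matrix.det_apply]
  refine totalDegree_finsetSum_le fun s _ => ?_
  rw [Units.smul_def]
  refine (totalDegree_smul_le _ _).trans ((totalDegree_finsetProd _ _).trans ?_)
  refine (Finset.sum_le_sum fun i _ => (show _ ≤ 1 by simp [genMat])).trans ?_
  simp

theorem aeval_det_genMat (x : Option (Fin n × Fin n) → K) :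
    aeval (R := K) x (genMat n K).det = (Matrix.of fun i j => x (some (i, j))).det := by
  have := RingHom.map_det (aeval (R := K) x : _ →+* K) (genMat n K)
  refine this.trans ?_
  congr 1
  ext i j
  simp [genMat]

/-- The equation det · X none = 1 has degree n + 1 ≤ D, so it belongs to the truncated ideal and
every zero of that ideal comes from an invertible matrix. -/
theorem exists_glEmbed_of_mem_zeroLocus {D : ℕ} (hD : n + 1 ≤ D) {U : Set (GL (Fin n) K)}
    {x : Option (Fin n × Fin n) → K} (hx : x ∈ zeroLocus K (lowSpan D (glIdeal U))) :
    ∃ g ∈ lowZeros D U, glEmbed g = x := by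
  have hdet : (Matrix.of fun i j => x (some (i, j))).det * x none = 1 := by
    have h1 := hx ((genMat n K).det * X none - 1) (mem_lowSpan (mem_glIdeal.2 fun g _ => ?_) ?_)
    · rw [map_sub, map_mul, aeval_det_genMat, aeval_X, map_one, sub_eq_zero] at h1
      exact h1
    · rw [map_sub, map_mul, aeval_det_genMat, aeval_X, map_one, sub_eq_zero]
      exact mul_inv_cancel₀ (Matrix.isUnits_det_units g).ne_zero
    · refine (totalDegree_sub _ _).trans (max_le ((totalDegree_mul _ _).trans ?_) (by simp))
      rw [totalDegree_X]
      exact (Nat.add_le_add_right totalDegree_det_genMat_le 1).trans hD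
  have hu : IsUnit (Matrix.of fun i j => x (some (i, j))) :=
    (Matrix.isUnit_iff_isUnit_det _).2 (IsUnit.of_mul_eq_one _ hdet)
  obtain ⟨g, hg⟩ := hu
  have hgx : glEmbed g = x := by
    ext o
    rcases o with _ | ⟨i, j⟩
    · simp only [glEmbed, hg]
      exact inv_eq_of_mul_eq_one_right hdet
    · simp only [glEmbed, hg, Matrix.of_apply]
  refine ⟨g, fun f hf hfD => ?_, hgx⟩
  rw [hgx]
  exact hx f (mem_lowSpan hf hfD)

theorem glIdeal_lowZeros_le_radical [IsAlgClosed K] {D : ℕ} (hD : n + 1 ≤ D)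
    (U : Set (GL (Fin n) K)) :
    glIdeal (lowZeros D U) ≤ (lowSpan D (glIdeal U)).radical := by
  intro f hf
  rw [← vanishingIdeal_zeroLocus_eq_radical (K := K)]
  intro x hx
  obtain ⟨g, hg, rfl⟩ := exists_glEmbed_of_mem_zeroLocus hD hx
  exact mem_glIdeal.1 hf g hg

end LowZeros

/-! ### Curves through unipotent elements in large characteristic -/

section Curve

open Polynomial in
/-- The coordinates of the curve `t ↦ g ^ t` through a unipotent matrix of determinant one. -/
def powCurve (g : GL (Fin n) K) : Option (Fin n × Fin n) → K[X]
  | some (i, j) => ∑ k ∈ Finset.range n,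
      Polynomial.C ((((g : Matrix (Fin n) (Fin n) K) - 1) ^ k) i j * (k.factorial : K)⁻¹) *
        descPochhammer K k
  | none => 1

theorem natDegree_powCurve_le (g : GL (Fin n) K) (o : Option (Fin n × Fin n)) :
    (powCurve g o).natDegree ≤ n := by
  rcases o with _ | ⟨i, j⟩
  · simp [powCurve]
  · refine Polynomial.natDegree_sum_le_of_forall_le _ _ fun k hk => ?_
    refine (Polynomial.natDegree_C_mul_le _ _).trans ?_
    rw [descPochhammer_natDegree]
    exact (Finset.mem_range.1 hk).le

variable {p : ℕ} [CharP K p] [Fact p.Prime] [Nonempty (Fin n)]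

/-- The determinant is a p-th root of unity in characteristic p. This is why the last coordinate of
`powCurve` is constant. -/
theorem det_eq_one_of_isNilpotent (hnp : n < p) {g : GL (Fin n) K}
    (h : IsNilpotent ((g : Matrix (Fin n) (Fin n) K) - 1)) :
    (g : Matrix (Fin n) (Fin n) K).det = 1 := by
  have h1 := congrArg (fun g : GL (Fin n) K => (g : Matrix (Fin n) (Fin n) K).det)
    (pow_char_eq_one hnp h)
  simp only [Units.val_pow_eq_pow_val, Matrix.det_pow, Units.val_one, Matrix.det_one] at h1
  have h2 := sub_pow_char_of_commute p (Commute.one_right (g : Matrix (Fin n) (Fin n) K).det)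
  rw [h1, one_pow, sub_self] at h2
  exact sub_eq_zero.1 (pow_eq_zero_iff (Fact.out : p.Prime).ne_zero |>.1 h2)

theorem eval_powCurve (hnp : n < p) {g : GL (Fin n) K}
    (h : IsNilpotent ((g : Matrix (Fin n) (Fin n) K) - 1)) (m : ℕ) (o : Option (Fin n × Fin n)) :
    (powCurve g o).eval (m : K) = glEmbed (g ^ m) o := by
  rcases o with _ | ⟨i, j⟩
  · simp [powCurve, glEmbed, det_eq_one_of_isNilpotent hnp h]
  · have hpow : ((g ^ m : GL (Fin n) K) : Matrix (Fin n) (Fin n) K) = ∑ k ∈ Finset.range n,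
        (m.choose k : K) • ((g : Matrix (Fin n) (Fin n) K) - 1) ^ k := by
      have h1 : (g : Matrix (Fin n) (Fin n) K) = ((g : Matrix (Fin n) (Fin n) K) - 1) + 1 := by
        simp
      rw [Units.val_pow_eq_pow_val, h1, (Commute.one_right _).add_pow, ← h1]
      have h2 : ∀ k, ((g : Matrix (Fin n) (Fin n) K) - 1) ^ k * 1 ^ (m - k) * (m.choose k : ℕ) =
          (m.choose k : K) • ((g : Matrix (Fin n) (Fin n) K) - 1) ^ k := by
        intro k
        rw [one_pow, mul_one, ← Nat.cast_comm, ← nsmul_eq_mul, Nat.cast_smul_eq_nsmul]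
      simp only [h2]
      rw [Finset.sum_subset (Finset.range_subset_range.2 (le_add_right le_rfl : m + 1 ≤ m + 1 + n)),
        Finset.sum_subset (Finset.range_subset_range.2 (le_add_left le_rfl : n ≤ m + 1 + n))]
      · intro k _ hk
        rw [pow_eq_zero_of_le (by simpa using hk) (pow_eq_zero_of_isNilpotent h), smul_zero]
      · intro k _ hk
        rw [Nat.choose_eq_zero_of_lt (by simpa using hk), Nat.cast_zero, zero_smul]
    simp only [powCurve, glEmbed, hpow, Matrix.sum_apply, Matrix.smul_apply, smul_eq_mul,
      Polynomial.eval_finsetSum, Polynomial.eval_mul, Polynomial.eval_C,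
      descPochhammer_eval_eq_descFactorial, Nat.descFactorial_eq_factorial_mul_choose]
    refine Finset.sum_congr rfl fun k hk => ?_
    have hk0 : (k.factorial : K) ≠ 0 := by
      rw [Ne, CharP.cast_eq_zero_iff K p, (Fact.out : p.Prime).dvd_factorial]
      have := Finset.mem_range.1 hk
      omega
    push_cast
    field_simp

/-- If the characteristic is large, a unipotent element of `lowZeros D U` is connected to the
identity by an irreducible curve. -/
theorem mem_connectedComponentIn_lowZeros [Infinite K] (hnp : n < p) {D : ℕ} (hD : n + 1 ≤ D)
    (hDp : D * n < p) {U : Subgroup (GL (Fin n) K)} {g : GL (Fin n) K}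
    (h : IsNilpotent ((g : Matrix (Fin n) (Fin n) K) - 1))
    (hg : g ∈ lowZeros D (U : Set (GL (Fin n) K))) :
    g ∈ connectedComponentIn (lowZeros D (U : Set (GL (Fin n) K))) 1 := by
  have hpt : ∀ (q : MvPolynomial (Option (Fin n × Fin n)) K) (t : K),
      (aeval (powCurve g) q).eval t = aeval (R := K) (fun o => (powCurve g o).eval t) q := by
    intro q t
    have : ((Polynomial.aeval t : Polynomial K →ₐ[K] K).comp (aeval (powCurve g))) =
        aeval (R := K) (fun o => (powCurve g o).eval t) := by
      ext o
      simp [Polynomial.coe_aeval_eq_eval]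
    have := DFunLike.congr_fun this q
    rwa [AlgHom.comp_apply, Polynomial.coe_aeval_eq_eval] at this
  have hpow : ∀ m : ℕ, g ^ m ∈ lowZeros D (U : Set (GL (Fin n) K)) := by
    intro m
    induction m with
    | zero => rw [pow_zero]; exact subset_lowZeros D _ U.one_mem
    | succ m ih => rw [pow_succ]; exact mul_mem_lowZeros U ih hg
  have hnat : ∀ m : ℕ, (fun o => (powCurve g o).eval (m : K)) = glEmbed (g ^ m) := fun m =>
    funext fun o => eval_powCurve hnp h m o
  have hzero : ∀ q ∈ glIdeal (U : Set (GL (Fin n) K)), q.totalDegree ≤ D →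
      aeval (powCurve g) q = 0 := by
    intro q hq hqD
    -- The pullback of q to the curve has degree at most Dn < p and vanishes at the p parameters 0,
    -- …, p - 1, where the curve passes through powers of g.
    refine Polynomial.eq_zero_of_natDegree_lt_card_of_eval_eq_zero _
      (f := fun i : Fin p => ((i : ℕ) : K)) ?_ ?_ ?_
    · intro i j hij
      exact Fin.ext (CharP.natCast_injOn_Iio K p i.2 j.2 hij)
    · intro i
      rw [hpt, hnat]
      exact hpow i q hq hqD
    · rw [Fintype.card_fin]
      exact ((natDegree_aeval_le _ n (natDegree_powCurve_le g) q).trans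
        (Nat.mul_le_mul_right n hqD)).trans_lt hDp
  have hex : ∀ t : K, ∃ x ∈ lowZeros D (U : Set (GL (Fin n) K)),
      glEmbed x = fun o => (powCurve g o).eval t := by
    intro t
    refine exists_glEmbed_of_mem_zeroLocus hD ?_
    rw [lowSpan, zeroLocus_span]
    rintro q ⟨hq, hqD⟩
    rw [← hpt, hzero q hq hqD, Polynomial.eval_zero]
  choose γ hγ hγt using hex
  have hinj : ∀ x y : GL (Fin n) K, glEmbed x = glEmbed y → x = y := by
    intro x y hxy
    ext i j
    exact congrFun hxy (some (i, j))
  have hm : ∀ m : ℕ, γ m = g ^ m := fun m => hinj _ _ ((hγt m).trans (hnat m))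
  -- The image of the affine line is irreducible, because K[t] is a domain and a polynomial
  -- vanishing on the infinite field K is zero.
  have hirr : IsPreirreducible (Set.range γ) := by
    refine isPreirreducible_iff_isClosed_union_isClosed.2 fun Z₁ Z₂ h₁ h₂ hsub => ?_
    by_contra hcon
    rw [not_or, Set.not_subset, Set.not_subset] at hcon
    obtain ⟨⟨_, ⟨t₁, rfl⟩, ht₁⟩, ⟨_, ⟨t₂, rfl⟩, ht₂⟩⟩ := hcon
    obtain ⟨S₁, rfl⟩ := isClosed_zariskiGL_iff.1 h₁
    obtain ⟨S₂, rfl⟩ := isClosed_zariskiGL_iff.1 h₂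
    simp only [Set.mem_ofPred_eq, not_forall] at ht₁ ht₂
    obtain ⟨f₁, hf₁, ht₁⟩ := ht₁
    obtain ⟨f₂, hf₂, ht₂⟩ := ht₂
    rw [hγt, ← hpt] at ht₁ ht₂
    have hprod : aeval (powCurve g) f₁ * aeval (powCurve g) f₂ = 0 := by
      refine Polynomial.funext fun t => ?_
      rw [Polynomial.eval_mul, Polynomial.eval_zero, hpt, hpt, ← hγt]
      rcases hsub ⟨t, rfl⟩ with h | h
      · rw [h f₁ hf₁, zero_mul]
      · rw [h f₂ hf₂, mul_zero]
    rcases mul_eq_zero.1 hprod with h | h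
    · exact ht₁ (by rw [h, Polynomial.eval_zero])
    · exact ht₂ (by rw [h, Polynomial.eval_zero])
  have h0 := hm 0
  have h1 := hm 1
  rw [pow_zero] at h0
  rw [pow_one] at h1
  exact mem_connectedComponentIn_of_isPreconnected hirr.isPreconnected
    (Set.range_subset_iff.2 hγ) ⟨_, h0⟩ ⟨_, h1⟩

end Curve

/-! ### The truncated ideal is the full ideal -/

section LowDegree

variable {p : ℕ} [CharP K p] [Fact p.Prime] [Nonempty (Fin n)]

/-- The zeros of the polynomials of low degree vanishing on the unipotent radical form a closed
normal unipotent subgroup. -/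
theorem exists_subgroup_lowZeros (hnp : n < p) {G : Subgroup (GL (Fin n) K)} (hG : IsAlgebraic G)
    {D : ℕ} (hD : n + 1 ≤ D)
    (hGD : lowZeros D (G : Set (GL (Fin n) K)) ⊆ G) :
    ∃ V : Subgroup (GL (Fin n) K),
      (V : Set (GL (Fin n) K)) = lowZeros D (unipotentRadical G : Set (GL (Fin n) K)) ∧
      unipotentRadical G ≤ V ∧ IsUnip V ∧ componentSubgroup V = unipotentRadical G := by
  have hU := unipotentRadical_mem hnp hG
  set U := unipotentRadical G
  have hunip : ∀ g ∈ lowZeros D (U : Set (GL (Fin n) K)),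
      IsNilpotent ((g : Matrix (Fin n) (Fin n) K) - 1) := by
    intro g hg
    have hmap : ∀ x : GL (Fin n) K, ((genMat n K - 1) ^ n).map (aeval (R := K) (glEmbed x)) =
        ((x : Matrix (Fin n) (Fin n) K) - 1) ^ n := by
      intro x
      have h := genMat_map x
      change (aeval (R := K) (glEmbed x)).mapMatrix ((genMat n K - 1) ^ n) = _
      change (aeval (R := K) (glEmbed x)).mapMatrix (genMat n K) = _ at h
      rw [map_pow, map_sub, map_one, h]
    -- The entries of (x - 1)^n have degree at most n < D, so unipotency is among the low-degree
    -- equations of U.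
    have hdeg : ∀ (m : ℕ) (i j : Fin n), (((genMat n K - 1) ^ m) i j).totalDegree ≤ m := by
      intro m
      induction m with
      | zero =>
        intro i j
        rw [pow_zero, Matrix.one_apply]
        split_ifs <;> simp
      | succ m ih =>
        intro i j
        rw [pow_succ, Matrix.mul_apply]
        refine totalDegree_finsetSum_le fun l _ => (totalDegree_mul _ _).trans
          (add_le_add (ih i l) ?_)
        rw [Matrix.sub_apply, Matrix.one_apply]
        refine (totalDegree_sub _ _).trans (max_le (by simp [genMat]) ?_)
        split_ifs <;> simp
    refine ⟨n, ?_⟩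
    rw [← hmap]
    ext i j
    refine hg _ (mem_glIdeal.2 fun x hx => ?_) ((hdeg n i j).trans (by omega))
    have := congrFun₂ (hmap x) i j
    rw [Matrix.map_apply, pow_eq_zero_of_isNilpotent (hU.2.2.2.2 x hx), Matrix.zero_apply] at this
    exact this
  let V' : Submonoid (GL (Fin n) K) :=
    { carrier := lowZeros D (U : Set (GL (Fin n) K))
      one_mem' := subset_lowZeros D _ U.one_mem
      mul_mem' := mul_mem_lowZeros U }
  let V : Subgroup (GL (Fin n) K) :=
    { V' with
      inv_mem' := by
        intro g hg
        have h1 : g ^ p = 1 := pow_char_eq_one hnp (hunip g hg)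
        have h2 : g⁻¹ = g ^ (p - 1) := by
          rw [inv_eq_iff_mul_eq_one, ← pow_succ',
            Nat.sub_add_cancel (Fact.out : p.Prime).one_le, h1]
        rw [h2]
        exact V'.pow_mem hg (p - 1) }
  have hUV : U ≤ V := subset_lowZeros D _
  have hVG : V ≤ G := fun g hg => hGD fun f hf hfD => hg f
    (mem_glIdeal.2 fun x hx => mem_glIdeal.1 hf x (hU.1 hx)) hfD
  have hconj : ∀ g ∈ G, ∀ x ∈ V, g * x * g⁻¹ ∈ V := fun g hg x hx =>
    mul_mul_mem_lowZeros (W := (U : Set (GL (Fin n) K))) (fun y hy =>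
      subset_lowZeros D _ (conj_mem_of_mem_radicalFamily hU hg hy)) hx
  refine ⟨V, rfl, hUV, hunip, le_antisymm ?_ ?_⟩
  · exact le_unipotentRadical
      (componentSubgroup_mem_radicalFamily hVG hconj (isClosed_lowZeros D _) hunip)
  · exact IsPreconnected.subset_connectedComponentIn hU.2.2.2.1.2 U.one_mem hUV

/-- The ideal of the unipotent radical is generated in degree at most `D`, provided that it is so
up to a sufficiently large degree `t`. -/
theorem lowSpan_eq_glIdeal [IsAlgClosed K] (hnp : n < p) {G : Subgroup (GL (Fin n) K)} (hG : IsAlgebraic G)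
    {D : ℕ} (hD : n + 1 ≤ D) (hGD : lowZeros D (G : Set (GL (Fin n) K)) ⊆ G) {t : ℕ}
    (ht : ∀ f ∈ glIdeal (unipotentRadical G : Set (GL (Fin n) K)), f.totalDegree ≤ t →
      f ∈ lowSpan D (glIdeal (unipotentRadical G : Set (GL (Fin n) K))))
    {δ : MvPolynomial (Option (Fin n × Fin n)) K} (hδt : δ.totalDegree ≤ t)
    (hδ : δ ∉ glIdeal (unipotentRadical G : Set (GL (Fin n) K)))
    (hrad : ∀ f ∈ (lowSpan D (glIdeal (unipotentRadical G : Set (GL (Fin n) K)))).radical,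
      ∃ N : ℕ, δ ^ N * f ∈ lowSpan D (glIdeal (unipotentRadical G : Set (GL (Fin n) K))))
    (hfrob : D * n < p ∨
      ∀ f, f ^ p - f ∈ (lowSpan D (glIdeal (unipotentRadical G : Set (GL (Fin n) K)))).radical →
        ∃ e : MvPolynomial (Option (Fin n × Fin n)) K, e.totalDegree ≤ t ∧ ∃ N : ℕ,
          δ ^ N * (e - δ * f) ∈ lowSpan D (glIdeal (unipotentRadical G : Set (GL (Fin n) K)))) :
    lowSpan D (glIdeal (unipotentRadical G : Set (GL (Fin n) K))) =
      glIdeal (unipotentRadical G : Set (GL (Fin n) K)) := by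
  obtain ⟨V, hV, hUV, hunip, hcomp⟩ := exists_subgroup_lowZeros hnp hG hD hGD
  have hU := unipotentRadical_mem hnp hG
  set U := unipotentRadical G
  set J := lowSpan D (glIdeal (U : Set (GL (Fin n) K))) with hJ
  have hprime : (glIdeal (U : Set (GL (Fin n) K))).IsPrime :=
    glIdeal_isPrime (isIrreducible_of_isConnected hU.2.2.1 hU.2.2.2.1)
  have hJV : ∀ f ∈ J, ∀ g ∈ V, aeval (R := K) (glEmbed g) f = 0 := by
    intro f hf g hg
    refine mem_glIdeal.1 (lowSpan_le_glIdeal_lowZeros D _ hf) g ?_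
    rw [← hV]
    exact hg
  have hVJ : ∀ f, (∀ g ∈ V, aeval (R := K) (glEmbed g) f = 0) → f ∈ J.radical := by
    intro f hf
    refine glIdeal_lowZeros_le_radical hD _ (mem_glIdeal.2 fun g hg => hf g ?_)
    rw [← hV] at hg
    exact hg
  -- Polynomials of degree at most t cannot tell U from its cosets Uw in V: those vanishing on U lie
  -- in J and so vanish on V. The converse uses w⁻¹.
  have hcoset : ∀ w ∈ V, ∀ f, f.totalDegree ≤ t →
      (transl 1 w f ∈ glIdeal (U : Set (GL (Fin n) K)) ↔
        f ∈ glIdeal (U : Set (GL (Fin n) K))) := by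
    have h1 : ∀ w ∈ V, ∀ f, f.totalDegree ≤ t → f ∈ glIdeal (U : Set (GL (Fin n) K)) →
        transl 1 w f ∈ glIdeal (U : Set (GL (Fin n) K)) := by
      intro w hw f hft hf
      refine mem_glIdeal.2 fun u hu => ?_
      rw [aeval_transl, one_mul]
      exact hJV f (ht f hf hft) _ (V.mul_mem (hUV hu) hw)
    intro w hw f hft
    refine ⟨fun h => ?_, h1 w hw f hft⟩
    have := h1 w⁻¹ (V.inv_mem hw) _ ((totalDegree_transl_le 1 w f).trans hft) h
    have h2 := transl_transl_inv 1 w⁻¹ f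
    rw [inv_one, inv_inv] at h2
    rwa [h2] at this
  have hVU : V ≤ U := by
    rcases hfrob with hp | hfrob
    · intro g hg
      rw [← hcomp]
      have hg' := hg
      rw [← SetLike.mem_coe, hV] at hg'
      have := mem_connectedComponentIn_lowZeros hnp hD hp (hunip g hg) hg'
      rw [← hV] at this
      exact this
    · have hcl : IsClosed ((V : Set (GL (Fin n) K)) \ U) := by
        rw [← hcomp]
        exact isClosed_diff_componentSubgroup (by rw [hV]; exact isClosed_lowZeros D _)
      intro w hw
      by_contra hwU
      -- U and V \ U are disjoint closed sets, so by the Nullstellensatz their ideals are comaximal.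
      have htop : glIdeal (U : Set (GL (Fin n) K)) ⊔
          glIdeal ((V : Set (GL (Fin n) K)) \ U) = ⊤ := by
        by_contra hne
        obtain ⟨m, hm, hle⟩ := Ideal.exists_le_maximal _ hne
        obtain ⟨x, rfl⟩ := isMaximal_iff_eq_vanishingIdeal_singleton.1 hm
        have hx : ∀ f ∈ glIdeal (U : Set (GL (Fin n) K)) ⊔
            glIdeal ((V : Set (GL (Fin n) K)) \ U), aeval (R := K) x f = 0 := fun f hf =>
          (mem_vanishingIdeal_singleton_iff x f).1 (hle hf)
        obtain ⟨g, -, rfl⟩ := exists_glEmbed_of_mem_zeroLocus (D := D) hD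
          (U := (U : Set (GL (Fin n) K))) (x := x)
          fun f hf => hx f (Ideal.mem_sup_left (lowSpan_le D _ hf))
        have h1 := mem_of_forall_glIdeal hU.2.2.1 fun f hf => hx f (Ideal.mem_sup_left hf)
        have h2 := mem_of_forall_glIdeal hcl fun f hf => hx f (Ideal.mem_sup_right hf)
        exact h2.2 h1
      -- On V, b is the indicator function of U, so b^p - b vanishes on V and lies in the radical of
      -- J.
      obtain ⟨a, ha, b, hb, hab⟩ := Submodule.mem_sup.1 ((Ideal.eq_top_iff_one _).1 htop)
      have hbU : ∀ u ∈ U, aeval (R := K) (glEmbed u) b = 1 := by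
        intro u hu
        have := congrArg (aeval (R := K) (glEmbed u)) hab
        rwa [map_add, mem_glIdeal.1 ha u hu, zero_add, map_one] at this
      have hbV : ∀ v ∈ V, v ∉ U → aeval (R := K) (glEmbed v) b = 0 := fun v hv hvU =>
        mem_glIdeal.1 hb v ⟨hv, hvU⟩
      obtain ⟨e, het, N, heN⟩ := hfrob b (hVJ _ fun v hv => by
        rw [map_sub, map_pow]
        by_cases hvU : v ∈ U
        · rw [hbU v hvU, one_pow, sub_self]
        · rw [hbV v hv hvU, zero_pow (Fact.out : p.Prime).ne_zero, sub_self])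
      -- On V, δ^N e = δ^(N+1) b, which vanishes on Uw. By `hcoset`, δ is not identically zero on
      -- Uw, so e vanishes on Uw and then on U. But on U the same equation reads δ^N e = δ^(N+1), a
      -- contradiction.
      have hw1 : transl 1 w (δ ^ N * e) ∈ glIdeal (U : Set (GL (Fin n) K)) := by
        refine mem_glIdeal.2 fun u hu => ?_
        have huwV : u * w ∈ V := V.mul_mem (hUV hu) hw
        have huwU : u * w ∉ U := fun h => hwU (by simpa using U.mul_mem (U.inv_mem hu) h)
        have := hJV _ heN (u * w) huwV
        rw [map_mul, map_sub, map_mul, hbV _ huwV huwU, mul_zero, sub_zero, ← map_mul] at this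
        rw [aeval_transl, one_mul, this]
      rw [map_mul, map_pow] at hw1
      have heU : e ∈ glIdeal (U : Set (GL (Fin n) K)) := by
        rcases hprime.mem_or_mem hw1 with h | h
        · exact absurd ((hcoset w hw δ hδt).1 (hprime.mem_of_pow_mem N h)) hδ
        · exact (hcoset w hw e het).1 h
      have h2 : δ ^ N * δ ∈ glIdeal (U : Set (GL (Fin n) K)) := by
        refine mem_glIdeal.2 fun u hu => ?_
        have := hJV _ heN u (hUV hu)
        rw [map_mul, map_sub, map_mul, hbU u hu, mul_one, mem_glIdeal.1 heU u hu, zero_sub,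
          mul_neg, neg_eq_zero] at this
        rw [map_mul, this]
      rw [← pow_succ] at h2
      exact hδ (hprime.mem_of_pow_mem _ h2)
  refine le_antisymm (lowSpan_le D _) fun f hf => ?_
  have htransl : ∀ u ∈ U, ∀ q ∈ J, transl 1 u q ∈ J := by
    intro u hu q hq
    have : J ≤ J.comap (transl 1 u).toRingHom := by
      rw [hJ, lowSpan, Ideal.span_le]
      rintro q ⟨hq, hqD⟩
      refine mem_lowSpan (mem_glIdeal.2 fun x hx => ?_) ((totalDegree_transl_le _ _ _).trans hqD)
      change aeval (R := K) (glEmbed x) (transl 1 u q) = 0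
      rw [aeval_transl, one_mul]
      exact mem_glIdeal.1 hq _ (U.mul_mem hx hu)
    exact this hq
  -- J is stable under right translation by U, so δ may be replaced by any of its translates.
  have hann : ∀ u ∈ U, ∃ N : ℕ, (transl 1 u δ) ^ N * f ∈ J := by
    intro u hu
    obtain ⟨N, hN⟩ := hrad (transl 1 u⁻¹ f) (hVJ _ fun g hg => by
      rw [aeval_transl, one_mul]
      exact mem_glIdeal.1 hf _ (U.mul_mem (hVU hg) (U.inv_mem hu)))
    refine ⟨N, ?_⟩
    have h1 := htransl u hu _ hN
    have h2 := transl_transl_inv 1 u f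
    rw [inv_one] at h2
    rwa [map_mul, map_pow, h2] at h1
  -- Otherwise J : f lies in the maximal ideal of some point g ∈ V = U at which all translates of δ
  -- vanish. The values of these translates at g are all the values of δ on U, forcing δ ∈ I(U).
  by_contra hfJ
  have hne : J.colon {f} ≠ ⊤ := by
    intro h
    have := (Ideal.eq_top_iff_one _).1 h
    rw [Submodule.mem_colon_singleton, one_smul] at this
    exact hfJ this
  obtain ⟨m, hm, hle⟩ := Ideal.exists_le_maximal _ hne
  obtain ⟨x, rfl⟩ := isMaximal_iff_eq_vanishingIdeal_singleton.1 hm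
  have hx : ∀ q, q * f ∈ J → aeval (R := K) x q = 0 := fun q hq =>
    (mem_vanishingIdeal_singleton_iff x q).1 (hle (Submodule.mem_colon_singleton.2 hq))
  obtain ⟨g, hg, rfl⟩ := exists_glEmbed_of_mem_zeroLocus (D := D) hD
    (U := (U : Set (GL (Fin n) K))) (x := x) fun q hq => hx q (J.mul_mem_right f hq)
  rw [← hV] at hg
  refine hδ (mem_glIdeal.2 fun u hu => ?_)
  obtain ⟨N, hN⟩ := hann (g⁻¹ * u) (U.mul_mem (U.inv_mem (hVU hg)) hu)
  have := hx _ hN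
  rw [map_pow, aeval_transl, one_mul, mul_inv_cancel_left] at this
  exact eq_zero_of_pow_eq_zero this

end LowDegree

end

end UnipRad


namespace UnipRad

noncomputable section

open MvPolynomial

/-! ### Ultraproducts of rings and fields -/

section Ultraproduct

variable (𝒰 : Ultrafilter ℕ)

/-- The ideal of sequences that vanish almost everywhere. -/
def upIdeal (R : ℕ → Type*) [∀ i, CommRing (R i)] : Ideal (∀ i, R i) where
  carrier := {f | ∀ᶠ i in 𝒰, f i = 0}
  add_mem' ha hb := by
    filter_upwards [ha, hb] with i h1 h2
    rw [Pi.add_apply, h1, h2, add_zero]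
  zero_mem' := by
    filter_upwards with i using rfl
  smul_mem' c f hf := by
    filter_upwards [hf] with i h1
    rw [smul_eq_mul, Pi.mul_apply, h1, mul_zero]

/-- The ultraproduct of a sequence of rings. -/
abbrev Up (R : ℕ → Type*) [∀ i, CommRing (R i)] : Type _ := (∀ i, R i) ⧸ upIdeal 𝒰 R

namespace Up

variable {R T V : ℕ → Type*} [∀ i, CommRing (R i)] [∀ i, CommRing (T i)] [∀ i, CommRing (V i)]

/-- The class of a sequence in the ultraproduct. -/
def mk : (∀ i, R i) →+* Up 𝒰 R := Ideal.Quotient.mk _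

variable {𝒰}

theorem mk_surjective : Function.Surjective (mk 𝒰 (R := R)) := Ideal.Quotient.mk_surjective

theorem mk_eq_zero {a : ∀ i, R i} : mk 𝒰 a = 0 ↔ ∀ᶠ i in 𝒰, a i = 0 :=
  Ideal.Quotient.eq_zero_iff_mem

theorem mk_eq_mk {a b : ∀ i, R i} : mk 𝒰 a = mk 𝒰 b ↔ ∀ᶠ i in 𝒰, a i = b i := by
  rw [← sub_eq_zero, ← map_sub, mk_eq_zero]
  simp only [Pi.sub_apply, sub_eq_zero]

/-- The ring homomorphism of ultraproducts induced by a sequence of ring homomorphisms. -/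
def map (φ : ∀ i, R i →+* T i) : Up 𝒰 R →+* Up 𝒰 T :=
  Ideal.Quotient.lift (upIdeal 𝒰 R)
    ((mk 𝒰).comp (RingHom.pi fun i => (φ i).comp (Pi.evalRingHom R i))) fun a ha => by
      rw [RingHom.comp_apply, mk_eq_zero]
      filter_upwards [ha] with i hi
      change φ i (a i) = 0
      rw [hi, map_zero]

@[simp]
theorem map_mk (φ : ∀ i, R i →+* T i) (a : ∀ i, R i) :
    map φ (mk 𝒰 a) = mk 𝒰 fun i => φ i (a i) :=
  rfl

theorem map_injective {φ : ∀ i, R i →+* T i} (hφ : ∀ i, Function.Injective (φ i)) :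
    Function.Injective (map (𝒰 := 𝒰) φ) := by
  refine (injective_iff_map_eq_zero _).2 fun x hx => ?_
  obtain ⟨a, rfl⟩ := mk_surjective x
  rw [map_mk, mk_eq_zero] at hx
  rw [mk_eq_zero]
  filter_upwards [hx] with i hi
  exact (map_eq_zero_iff _ (hφ i)).1 hi

instance [∀ i, IsDomain (R i)] : IsDomain (Up 𝒰 R) := by
  have : Nontrivial (Up 𝒰 R) := ⟨⟨0, 1, fun h => by
    rw [← map_zero (mk 𝒰), ← map_one (mk 𝒰), mk_eq_mk] at h
    obtain ⟨i, hi⟩ := h.exists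
    exact zero_ne_one hi⟩⟩
  have : NoZeroDivisors (Up 𝒰 R) := ⟨fun {x y} h => by
    obtain ⟨a, rfl⟩ := mk_surjective x
    obtain ⟨b, rfl⟩ := mk_surjective y
    rw [← map_mul, mk_eq_zero] at h
    rw [mk_eq_zero, mk_eq_zero, ← Ultrafilter.eventually_or]
    filter_upwards [h] with i hi
    exact mul_eq_zero.1 hi⟩
  exact NoZeroDivisors.to_isDomain _

end Up

variable {𝒰} {K : ℕ → Type*} [∀ i, Field (K i)]

instance upIdeal_isMaximal : (upIdeal 𝒰 K).IsMaximal := by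
  refine Ideal.Quotient.maximal_of_isField _ ⟨⟨0, 1, zero_ne_one⟩, mul_comm, fun {x} hx => ?_⟩
  obtain ⟨a, rfl⟩ := Up.mk_surjective (𝒰 := 𝒰) x
  refine ⟨Up.mk 𝒰 fun i => (a i)⁻¹, ?_⟩
  rw [← map_mul, ← map_one (Up.mk 𝒰), Up.mk_eq_mk]
  have h : ∀ᶠ i in 𝒰, ¬ a i = 0 := Ultrafilter.eventually_not.2 fun h => hx (Up.mk_eq_zero.2 h)
  filter_upwards [h] with i hi
  exact mul_inv_cancel₀ hi

instance : Field (Up 𝒰 K) := Ideal.Quotient.field _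

theorem Up.charP {p : ℕ} (hp : ∀ᶠ i in 𝒰, CharP (K i) p) : CharP (Up 𝒰 K) p := by
  refine ⟨fun m => ?_⟩
  rw [← map_natCast (Up.mk 𝒰), Up.mk_eq_zero]
  constructor
  · intro h
    obtain ⟨i, h1, h2⟩ := (h.and hp).exists
    exact (CharP.cast_eq_zero_iff (K i) p m).1 h1
  · intro h
    filter_upwards [hp] with i hi
    exact (CharP.cast_eq_zero_iff (K i) p m).2 h

/-- A monic polynomial lifts to monic polynomials of the same degree over the factors, and roots are
chosen factor by factor. -/
instance [∀ i, IsAlgClosed (K i)] : IsAlgClosed (Up 𝒰 K) := by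
  refine IsAlgClosed.of_exists_root _ fun f hf hirr => ?_
  choose c hc using fun k => Up.mk_surjective (𝒰 := 𝒰) (f.coeff k)
  set R := f.natDegree with hR
  have hR0 : 0 < R := hirr.natDegree_pos
  have hroot : ∀ i, ∃ x : K i, x ^ R + ∑ k ∈ Finset.range R, c k i * x ^ k = 0 := by
    intro i
    set g : Polynomial (K i) := ∑ k ∈ Finset.range R, Polynomial.C (c k i) * Polynomial.X ^ k with hg
    have hgd : g.degree < R := by
      refine (Polynomial.degree_sum_le _ _).trans_lt ((Finset.sup_lt_iff (WithBot.bot_lt_coe _)).2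
        fun k hk => (Polynomial.degree_C_mul_X_pow_le k _).trans_lt ?_)
      exact_mod_cast Finset.mem_range.1 hk
    have hd : (Polynomial.X ^ R + g).degree ≠ 0 := by
      rw [Polynomial.degree_add_eq_left_of_degree_lt (by rwa [Polynomial.degree_X_pow]),
        Polynomial.degree_X_pow]
      exact_mod_cast hR0.ne'
    obtain ⟨x, hx⟩ := IsAlgClosed.exists_root _ hd
    refine ⟨x, ?_⟩
    rw [Polynomial.IsRoot.def, hg] at hx
    simpa [Polynomial.eval_finsetSum] using hx
  choose x hx using hroot
  refine ⟨Up.mk 𝒰 x, ?_⟩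
  rw [Polynomial.eval_eq_sum_range, Finset.sum_range_succ, ← hR]
  have h1 : f.coeff R = 1 := hf
  rw [h1, one_mul, add_comm]
  simp_rw [← hc, ← map_pow, ← map_mul, ← map_sum]
  rw [← map_add, Up.mk_eq_zero]
  filter_upwards with i
  simpa using hx i

end Ultraproduct

/-! ### Polynomials over an ultraproduct and limits of ideals -/

section Polynomials

variable {𝒰 : Ultrafilter ℕ} {K : ℕ → Type*} [∀ i, Field (K i)] {σ : Type*}

variable (𝒰 K σ) in
/-- The embedding of the polynomial ring over the ultraproduct into the ultraproduct of the
polynomial rings. -/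
def jMv : MvPolynomial σ (Up 𝒰 K) →+* Up 𝒰 (fun i => MvPolynomial σ (K i)) :=
  eval₂Hom (Up.map fun _ => C) fun s => Up.mk 𝒰 fun _ => X s

theorem jMv_X (s : σ) : jMv 𝒰 K σ (X s) = Up.mk 𝒰 fun _ => X s := by simp [jMv]

theorem jMv_C (c : Up 𝒰 K) : jMv 𝒰 K σ (C c) = Up.map (fun _ => C) c := by simp [jMv]

theorem jMv_monomial (m : σ →₀ ℕ) (c : ∀ i, K i) :
    jMv 𝒰 K σ (monomial m (Up.mk 𝒰 c)) = Up.mk 𝒰 fun i => monomial m (c i) := by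
  rw [monomial_eq, Finsupp.prod, map_mul, jMv_C, Up.map_mk, map_prod]
  simp_rw [map_pow, jMv_X, ← map_pow, ← map_prod, ← map_mul]
  congr 1
  funext i
  rw [Pi.mul_apply, Finset.prod_apply, monomial_eq, Finsupp.prod]
  rfl

theorem jMv_sum_monomial (t : Finset (σ →₀ ℕ)) (c : (σ →₀ ℕ) → ∀ i, K i) :
    jMv 𝒰 K σ (∑ m ∈ t, monomial m (Up.mk 𝒰 (c m))) =
      Up.mk 𝒰 fun i => ∑ m ∈ t, monomial m (c m i) := by
  rw [map_sum]
  simp_rw [jMv_monomial]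
  rw [← map_sum]
  congr 1
  funext i
  simp

/-- Every polynomial over the ultraproduct is represented by polynomials of no larger degree. -/
theorem exists_jMv_eq_mk (f : MvPolynomial σ (Up 𝒰 K)) :
    ∃ a : ∀ i, MvPolynomial σ (K i), jMv 𝒰 K σ f = Up.mk 𝒰 a ∧
      ∀ i, (a i).totalDegree ≤ f.totalDegree := by
  choose c hc using fun m => Up.mk_surjective (𝒰 := 𝒰) (f.coeff m)
  refine ⟨fun i => ∑ m ∈ f.support, monomial m (c m i), ?_, fun i => ?_⟩
  · rw [← jMv_sum_monomial]
    simp_rw [hc]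
    rw [support_sum_monomial_coeff]
  · refine totalDegree_finsetSum_le fun m hm => (totalDegree_monomial_le _ _).trans ?_
    exact le_totalDegree hm

theorem jMv_injective : Function.Injective (jMv 𝒰 K σ) := by
  classical
  refine (injective_iff_map_eq_zero _).2 fun f hf => ?_
  choose c hc using fun m => Up.mk_surjective (𝒰 := 𝒰) (f.coeff m)
  have h : jMv 𝒰 K σ f = Up.mk 𝒰 fun i => ∑ m ∈ f.support, monomial m (c m i) := by
    rw [← jMv_sum_monomial]
    simp_rw [hc]
    rw [support_sum_monomial_coeff]
  rw [h, Up.mk_eq_zero] at hf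
  ext m
  by_cases hm : m ∈ f.support
  · rw [← hc, coeff_zero, Up.mk_eq_zero]
    filter_upwards [hf] with i hi
    have := congrArg (coeff m) hi
    rw [coeff_sum, Finset.sum_eq_single m (fun b _ hb => by rw [coeff_monomial, if_neg hb])
      (fun h => absurd hm h), coeff_monomial, if_pos rfl, coeff_zero] at this
    exact this
  · simpa using hm

/-- A sequence of polynomials of bounded degree represents a polynomial over the ultraproduct. -/
theorem exists_jMv_eq [Finite σ] (a : ∀ i, MvPolynomial σ (K i)) {t : ℕ}
    (ha : ∀ᶠ i in 𝒰, (a i).totalDegree ≤ t) : ∃ f, jMv 𝒰 K σ f = Up.mk 𝒰 a := by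
  have hfin : {m : σ →₀ ℕ | m.degree ≤ t}.Finite := Finsupp.finite_of_degree_le t
  refine ⟨∑ m ∈ hfin.toFinset, monomial m (Up.mk 𝒰 fun i => (a i).coeff m), ?_⟩
  rw [jMv_sum_monomial hfin.toFinset fun m i => (a i).coeff m, Up.mk_eq_mk]
  filter_upwards [ha] with i hi
  rw [← Finset.sum_subset (s₁ := (a i).support), support_sum_monomial_coeff]
  · intro m hm
    rw [Set.Finite.mem_toFinset, Set.mem_ofPred_eq, Finsupp.degree_apply]
    exact (le_totalDegree hm).trans hi
  · intro m _ hm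
    simpa using hm

/-- The ideal of polynomials over the ultraproduct that lie almost everywhere in `𝔭 i`. -/
def upLimit (𝒰 : Ultrafilter ℕ) (𝔭 : ∀ i, Ideal (MvPolynomial σ (K i))) :
    Ideal (MvPolynomial σ (Up 𝒰 K)) :=
  RingHom.ker ((Up.map fun i => Ideal.Quotient.mk (𝔭 i)).comp (jMv 𝒰 K σ))

variable {𝔭 : ∀ i, Ideal (MvPolynomial σ (K i))}

theorem mem_upLimit {f : MvPolynomial σ (Up 𝒰 K)} {a : ∀ i, MvPolynomial σ (K i)}
    (h : jMv 𝒰 K σ f = Up.mk 𝒰 a) : f ∈ upLimit 𝒰 𝔭 ↔ ∀ᶠ i in 𝒰, a i ∈ 𝔭 i := by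
  rw [upLimit, RingHom.mem_ker, RingHom.comp_apply, h, Up.map_mk, Up.mk_eq_zero]
  simp only [Ideal.Quotient.eq_zero_iff_mem]

instance upLimit_isPrime [∀ i, (𝔭 i).IsPrime] : (upLimit 𝒰 𝔭).IsPrime :=
  RingHom.ker_isPrime _

/-- The finitely many generators of the limit ideal are represented by elements of degree at most D,
so truncating every 𝔭 i at degree D does not change the limit. -/
theorem eventually_mem_lowSpan {D : ℕ} {t : Finset (MvPolynomial σ (Up 𝒰 K))}
    (ht : Ideal.span (t : Set (MvPolynomial σ (Up 𝒰 K))) = upLimit 𝒰 𝔭)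
    (hD : ∀ g ∈ t, g.totalDegree ≤ D) {f : MvPolynomial σ (Up 𝒰 K)} (hf : f ∈ upLimit 𝒰 𝔭)
    {a : ∀ i, MvPolynomial σ (K i)} (h : jMv 𝒰 K σ f = Up.mk 𝒰 a) :
    ∀ᶠ i in 𝒰, a i ∈ lowSpan D (𝔭 i) := by
  have : upLimit 𝒰 𝔭 ≤ upLimit 𝒰 fun i => lowSpan D (𝔭 i) := by
    rw [← ht, Ideal.span_le]
    intro g hg
    obtain ⟨b, hb, hbd⟩ := exists_jMv_eq_mk g
    have h1 : g ∈ upLimit 𝒰 𝔭 := ht ▸ Ideal.subset_span hg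
    rw [SetLike.mem_coe, mem_upLimit hb]
    filter_upwards [(mem_upLimit hb).1 h1] with i hi
    exact mem_lowSpan hi ((hbd i).trans (hD g hg))
  exact (mem_upLimit h).1 (this hf)

/-- A uniform bound: almost everywhere, the elements of `𝔭 i` of degree at most `t` lie in the ideal
generated by the elements of degree at most `D`. -/
theorem eventually_forall_mem_lowSpan [Finite σ] {D : ℕ} {u : Finset (MvPolynomial σ (Up 𝒰 K))}
    (hu : Ideal.span (u : Set (MvPolynomial σ (Up 𝒰 K))) = upLimit 𝒰 𝔭)
    (hD : ∀ g ∈ u, g.totalDegree ≤ D) (t : ℕ) :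
    ∀ᶠ i in 𝒰, ∀ f ∈ 𝔭 i, f.totalDegree ≤ t → f ∈ lowSpan D (𝔭 i) := by
  by_contra hcon
  rw [← Ultrafilter.eventually_not] at hcon
  -- Counterexamples of degree at most t over the factors assemble into one polynomial over the
  -- ultraproduct, because their degrees are bounded.
  have : ∀ i, ∃ f : MvPolynomial σ (K i), (¬ ∀ f ∈ 𝔭 i, f.totalDegree ≤ t → f ∈ lowSpan D (𝔭 i)) →
      f ∈ 𝔭 i ∧ f.totalDegree ≤ t ∧ f ∉ lowSpan D (𝔭 i) := by
    intro i
    by_cases h : ∀ f ∈ 𝔭 i, f.totalDegree ≤ t → f ∈ lowSpan D (𝔭 i)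
    · exact ⟨0, fun h' => absurd h h'⟩
    · push Not at h
      obtain ⟨f, hf⟩ := h
      exact ⟨f, fun _ => hf⟩
  choose a ha using this
  replace ha := hcon.mono fun i hi => ha i hi
  obtain ⟨f, hf⟩ := exists_jMv_eq (𝒰 := 𝒰) a (t := t) (ha.mono fun i hi => hi.2.1)
  have hfI : f ∈ upLimit 𝒰 𝔭 := (mem_upLimit hf).2 (ha.mono fun i hi => hi.1)
  obtain ⟨i, h1, h2⟩ := ((eventually_mem_lowSpan hu hD hfI hf).and ha).exists
  exact h2.2.2 h1

end Polynomials

end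

end UnipRad


namespace UnipRad

noncomputable section

open MvPolynomial

/-! ### Univariate polynomials over an ultraproduct -/

section UpPolynomial

variable {𝒰 : Ultrafilter ℕ} {A : Type*} [CommRing A] {R : ℕ → Type*} [∀ i, CommRing (R i)]

/-- The extension to polynomials of a ring homomorphism to an ultraproduct. -/
def jPoly (j : A →+* Up 𝒰 R) : Polynomial A →+* Up 𝒰 (fun i => Polynomial (R i)) :=
  Polynomial.eval₂RingHom ((Up.map fun _ => Polynomial.C).comp j) (Up.mk 𝒰 fun _ => Polynomial.X)

variable (j : A →+* Up 𝒰 R)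

theorem jPoly_C (a : A) : jPoly j (Polynomial.C a) = Up.map (fun _ => Polynomial.C) (j a) := by
  simp [jPoly]

theorem jPoly_X : jPoly j Polynomial.X = Up.mk 𝒰 fun _ => Polynomial.X := by
  simp [jPoly]

theorem jPoly_C_mul_X_pow {c : A} {a : ∀ i, R i} (h : j c = Up.mk 𝒰 a) (k : ℕ) :
    jPoly j (Polynomial.C c * Polynomial.X ^ k) =
      Up.mk 𝒰 fun i => Polynomial.C (a i) * Polynomial.X ^ k := by
  rw [map_mul, map_pow, jPoly_C, jPoly_X, h, Up.map_mk, ← map_pow, ← map_mul]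
  rfl

theorem jPoly_sum {c : ℕ → A} {a : ℕ → ∀ i, R i} (h : ∀ k, j (c k) = Up.mk 𝒰 (a k)) (N : ℕ)
    (e : ℕ → ℕ) :
    jPoly j (∑ k ∈ Finset.range N, Polynomial.C (c k) * Polynomial.X ^ e k) =
      Up.mk 𝒰 fun i => ∑ k ∈ Finset.range N, Polynomial.C (a k i) * Polynomial.X ^ e k := by
  rw [map_sum]
  simp_rw [jPoly_C_mul_X_pow j (h _)]
  rw [← map_sum]
  congr 1
  funext i
  simp

theorem jPoly_derivative {f : Polynomial A} {a : ∀ i, Polynomial (R i)}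
    (h : jPoly j f = Up.mk 𝒰 a) :
    jPoly j (Polynomial.derivative f) = Up.mk 𝒰 fun i => Polynomial.derivative (a i) := by
  choose c hc using fun k => Up.mk_surjective (𝒰 := 𝒰) (j (f.coeff k))
  have hf := f.as_sum_range_C_mul_X_pow
  have h1 := jPoly_sum j (fun k => (hc k).symm) (f.natDegree + 1) id
  simp only [id] at h1
  rw [← hf, h, Up.mk_eq_mk] at h1
  have h2 : Polynomial.derivative f = ∑ k ∈ Finset.range (f.natDegree + 1),
      Polynomial.C (f.coeff k * k) * Polynomial.X ^ (k - 1) := by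
    conv_lhs => rw [hf]
    rw [Polynomial.derivative_sum]
    exact Finset.sum_congr rfl fun k _ => Polynomial.derivative_C_mul_X_pow _ _
  rw [h2, jPoly_sum j (c := fun k => f.coeff k * k) (a := fun k i => c k i * k) (fun k => by
    rw [map_mul, ← hc, map_natCast, ← map_natCast (Up.mk 𝒰), ← map_mul]; rfl) _ fun k => k - 1,
    Up.mk_eq_mk]
  filter_upwards [h1] with i hi
  rw [hi, Polynomial.derivative_sum]
  exact Finset.sum_congr rfl fun k _ => (Polynomial.derivative_C_mul_X_pow _ _).symm

theorem jPoly_expand {p : ℕ} {f : Polynomial A} {a : ∀ i, Polynomial (R i)}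
    (h : jPoly j f = Up.mk 𝒰 a) :
    jPoly j (Polynomial.expand A p f) = Up.mk 𝒰 fun i => Polynomial.expand (R i) p (a i) := by
  have key : (jPoly j).comp (Polynomial.expand A p).toRingHom =
      (Up.map fun i => (Polynomial.expand (R i) p).toRingHom).comp (jPoly j) := by
    refine Polynomial.ringHom_ext (fun c => ?_) ?_
    · obtain ⟨b, hb⟩ := Up.mk_surjective (𝒰 := 𝒰) (j c)
      simp [jPoly_C, ← hb]
    · simp only [AlgHom.toRingHom_eq_coe, RingHom.coe_comp, RingHom.coe_coe, Function.comp_apply,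
        Polynomial.expand_X, jPoly_X, Up.map_mk, map_pow]
      rw [← map_pow]
      rfl
  have := RingHom.congr_fun key f
  rw [RingHom.comp_apply, RingHom.comp_apply, h, Up.map_mk] at this
  exact this

theorem exists_jPoly_monic {h : Polynomial A} (hm : h.Monic) [∀ i, Nontrivial (R i)] :
    ∃ a : ∀ i, Polynomial (R i), jPoly j h = Up.mk 𝒰 a ∧
      ∀ i, (a i).Monic ∧ (a i).natDegree = h.natDegree := by
  choose c hc using fun k => Up.mk_surjective (𝒰 := 𝒰) (j (h.coeff k))
  have hdeg : ∀ i, (∑ k ∈ Finset.range h.natDegree,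
      Polynomial.C (c k i) * Polynomial.X ^ k).degree < (h.natDegree : WithBot ℕ) := by
    intro i
    refine (Polynomial.degree_sum_le _ _).trans_lt ((Finset.sup_lt_iff (WithBot.bot_lt_coe _)).2
        fun k hk => (Polynomial.degree_C_mul_X_pow_le k _).trans_lt ?_)
    exact_mod_cast Finset.mem_range.1 hk
  refine ⟨fun i => Polynomial.X ^ h.natDegree + ∑ k ∈ Finset.range h.natDegree,
    Polynomial.C (c k i) * Polynomial.X ^ k, ?_, fun i => ⟨Polynomial.monic_X_pow_add (hdeg i), ?_⟩⟩
  · conv_lhs => rw [hm.as_sum]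
    have h1 := jPoly_sum j (fun k => (hc k).symm) h.natDegree id
    simp only [id] at h1
    rw [map_add, map_pow, jPoly_X, h1, ← map_pow, ← map_add]
    rfl
  · refine Polynomial.natDegree_eq_of_degree_eq_some ?_
    rw [Polynomial.degree_add_eq_left_of_degree_lt (by rw [Polynomial.degree_X_pow]; exact hdeg i),
      Polynomial.degree_X_pow]

theorem exists_jPoly_degree_lt {f : Polynomial A} {N : ℕ} (hf : f.degree < N) :
    ∃ a : ∀ i, Polynomial (R i), jPoly j f = Up.mk 𝒰 a ∧ ∀ i, (a i).degree < N := by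
  choose c hc using fun k => Up.mk_surjective (𝒰 := 𝒰) (j (f.coeff k))
  refine ⟨fun i => ∑ k ∈ Finset.range N, Polynomial.C (c k i) * Polynomial.X ^ k, ?_, fun i => ?_⟩
  · have h1 := jPoly_sum j (fun k => (hc k).symm) N id
    simp only [id] at h1
    rw [← h1]
    congr 1
    ext m
    rw [Polynomial.finsetSum_coeff]
    simp only [Polynomial.coeff_C_mul, Polynomial.coeff_X_pow, mul_ite, mul_one, mul_zero,
      Finset.sum_ite_eq, Finset.mem_range]
    split_ifs with hm
    · rfl
    · exact Polynomial.coeff_eq_zero_of_degree_lt (hf.trans_le (by exact_mod_cast not_lt.1 hm))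
  · refine (Polynomial.degree_sum_le _ _).trans_lt ((Finset.sup_lt_iff (WithBot.bot_lt_coe _)).2
        fun k hk => (Polynomial.degree_C_mul_X_pow_le k _).trans_lt ?_)
    exact_mod_cast Finset.mem_range.1 hk

theorem eventually_dvd_of_dvd {f g : Polynomial A} {a b : ∀ i, Polynomial (R i)}
    (hf : jPoly j f = Up.mk 𝒰 a) (hg : jPoly j g = Up.mk 𝒰 b) (h : f ∣ g) :
    ∀ᶠ i in 𝒰, a i ∣ b i := by
  obtain ⟨q, rfl⟩ := h
  obtain ⟨c, hc⟩ := Up.mk_surjective (𝒰 := 𝒰) (jPoly j q)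
  rw [map_mul, hf, ← hc, ← map_mul, Up.mk_eq_mk] at hg
  filter_upwards [hg] with i hi
  exact ⟨c i, hi.symm⟩

theorem eventually_separable {f : Polynomial A} {a : ∀ i, Polynomial (R i)}
    (hf : jPoly j f = Up.mk 𝒰 a) (h : f.Separable) : ∀ᶠ i in 𝒰, (a i).Separable := by
  obtain ⟨u, v, huv⟩ := h
  obtain ⟨u', hu'⟩ := Up.mk_surjective (𝒰 := 𝒰) (jPoly j u)
  obtain ⟨v', hv'⟩ := Up.mk_surjective (𝒰 := 𝒰) (jPoly j v)
  have := congrArg (jPoly j) huv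
  rw [map_add, map_mul, map_mul, hf, jPoly_derivative j hf, ← hu', ← hv', ← map_mul, ← map_mul,
    ← map_add, map_one, ← map_one (Up.mk 𝒰), Up.mk_eq_mk] at this
  filter_upwards [this] with i hi
  exact ⟨u' i, v' i, hi⟩

end UpPolynomial

/-! ### Descent of generic presentations to the factors -/

section Transfer

variable {𝒰 : Ultrafilter ℕ} {K : ℕ → Type*} [∀ i, Field (K i)] {σ : Type*} {S : Set σ}

/-- A polynomial with multivariate coefficients is represented with coefficients of bounded
degree. -/
theorem exists_jPoly_jMv_eq_mk (f : Polynomial (MvPolynomial S (Up 𝒰 K))) :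
    ∃ (T : ℕ) (a : ∀ i, Polynomial (MvPolynomial S (K i))), jPoly (jMv 𝒰 K S) f = Up.mk 𝒰 a ∧
      ∀ i k, ((a i).coeff k).totalDegree ≤ T := by
  choose c hc hcd using fun k => exists_jMv_eq_mk (f.coeff k)
  refine ⟨(Finset.range (f.natDegree + 1)).sup fun k => (f.coeff k).totalDegree,
    fun i => ∑ k ∈ Finset.range (f.natDegree + 1), Polynomial.C (c k i) * Polynomial.X ^ k,
    ?_, fun i k => ?_⟩
  · have h1 := jPoly_sum (jMv 𝒰 K S) hc (f.natDegree + 1) id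
    simp only [id] at h1
    rw [← h1, ← f.as_sum_range_C_mul_X_pow]
  · rw [Polynomial.finsetSum_coeff]
    simp only [Polynomial.coeff_C_mul, Polynomial.coeff_X_pow, mul_ite, mul_one, mul_zero,
      Finset.sum_ite_eq]
    split_ifs with hk
    · exact (hcd k i).trans
        (Finset.le_sup (f := fun k => (f.coeff k).totalDegree) hk)
    · simp

variable (𝒰 K S) in
/-- The embedding of the field of rational functions over the ultraproduct. -/
def jFrac : FractionRing (MvPolynomial S (Up 𝒰 K)) →+*
    Up 𝒰 (fun i => FractionRing (MvPolynomial S (K i))) :=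
  IsFractionRing.lift (A := MvPolynomial S (Up 𝒰 K))
    (g := (Up.map fun i => algebraMap (MvPolynomial S (K i))
      (FractionRing (MvPolynomial S (K i)))).comp (jMv 𝒰 K S))
    ((Up.map_injective fun _ => IsFractionRing.injective _ _).comp jMv_injective)

theorem jFrac_algebraMap (a : MvPolynomial S (Up 𝒰 K)) :
    jFrac 𝒰 K S (algebraMap _ _ a) = Up.map (fun i => algebraMap (MvPolynomial S (K i))
      (FractionRing (MvPolynomial S (K i)))) (jMv 𝒰 K S a) := by
  rw [jFrac, IsFractionRing.lift_algebraMap, RingHom.comp_apply]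

theorem jPoly_jFrac_map {f : Polynomial (MvPolynomial S (Up 𝒰 K))}
    {a : ∀ i, Polynomial (MvPolynomial S (K i))} (h : jPoly (jMv 𝒰 K S) f = Up.mk 𝒰 a) :
    jPoly (jFrac 𝒰 K S) (f.map (algebraMap _ _)) =
      Up.mk 𝒰 fun i => (a i).map (algebraMap _ (FractionRing (MvPolynomial S (K i)))) := by
  have key : (jPoly (jFrac 𝒰 K S)).comp (Polynomial.mapRingHom (algebraMap _ _)) =
      (Up.map fun i => Polynomial.mapRingHom (algebraMap _ (FractionRing (MvPolynomial S (K i))))).comp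
        (jPoly (jMv 𝒰 K S)) := by
    refine Polynomial.ringHom_ext (fun c => ?_) ?_
    · obtain ⟨b, hb⟩ := Up.mk_surjective (𝒰 := 𝒰) (jMv 𝒰 K S c)
      simp [jPoly_C, jFrac_algebraMap, ← hb]
    · simp [jPoly_X]
  have := RingHom.congr_fun key f
  rw [RingHom.comp_apply, RingHom.comp_apply, h, Up.map_mk] at this
  exact this

theorem jMv_rename {f : MvPolynomial S (Up 𝒰 K)} {a : ∀ i, MvPolynomial S (K i)}
    (h : jMv 𝒰 K S f = Up.mk 𝒰 a) :
    jMv 𝒰 K σ (rename ((↑) : S → σ) f) = Up.mk 𝒰 fun i => rename ((↑) : S → σ) (a i) := by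
  have key : (jMv 𝒰 K σ).comp (rename ((↑) : S → σ)).toRingHom =
      (Up.map fun i => (rename ((↑) : S → σ) : MvPolynomial S (K i) →ₐ[K i] _).toRingHom).comp
        (jMv 𝒰 K S) := by
    refine MvPolynomial.ringHom_ext (fun c => ?_) fun s => ?_
    · obtain ⟨b, rfl⟩ := Up.mk_surjective (𝒰 := 𝒰) c
      simp [jMv_C]
    · simp [jMv_X]
  have := RingHom.congr_fun key f
  rw [RingHom.comp_apply, RingHom.comp_apply, h, Up.map_mk] at this
  exact this

theorem jMv_substZ {z : MvPolynomial σ (Up 𝒰 K)} {z' : ∀ i, MvPolynomial σ (K i)}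
    (hz : jMv 𝒰 K σ z = Up.mk 𝒰 z') {f : Polynomial (MvPolynomial S (Up 𝒰 K))}
    {a : ∀ i, Polynomial (MvPolynomial S (K i))} (h : jPoly (jMv 𝒰 K S) f = Up.mk 𝒰 a) :
    jMv 𝒰 K σ (substZ S z f) = Up.mk 𝒰 fun i => substZ S (z' i) (a i) := by
  have key : (jMv 𝒰 K σ).comp (substZ S z) =
      (Up.map fun i => substZ S (z' i)).comp (jPoly (jMv 𝒰 K S)) := by
    refine Polynomial.ringHom_ext (fun c => ?_) ?_
    · obtain ⟨b, hb⟩ := Up.mk_surjective (𝒰 := 𝒰) (jMv 𝒰 K S c)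
      rw [RingHom.comp_apply, substZ_C, jMv_rename hb.symm, RingHom.comp_apply, jPoly_C, ← hb,
        Up.map_mk, Up.map_mk]
      simp_rw [substZ_C]
    · rw [RingHom.comp_apply, substZ_X, hz, RingHom.comp_apply, jPoly_X, Up.map_mk]
      simp_rw [substZ_X]
  have := RingHom.congr_fun key f
  rw [RingHom.comp_apply, RingHom.comp_apply, h, Up.map_mk] at this
  exact this

theorem jPoly_substG {G : σ → Polynomial (FractionRing (MvPolynomial S (Up 𝒰 K)))}
    {G' : ∀ i, σ → Polynomial (FractionRing (MvPolynomial S (K i)))}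
    (hG : ∀ s, jPoly (jFrac 𝒰 K S) (G s) = Up.mk 𝒰 fun i => G' i s)
    {f : MvPolynomial σ (Up 𝒰 K)} {a : ∀ i, MvPolynomial σ (K i)}
    (h : jMv 𝒰 K σ f = Up.mk 𝒰 a) :
    jPoly (jFrac 𝒰 K S) (substG (S := S) G f) =
      Up.mk 𝒰 fun i => substG (S := S) (G' i) (a i) := by
  have key : (jPoly (jFrac 𝒰 K S)).comp (substG (S := S) G) =
      (Up.map fun i => substG (S := S) (G' i)).comp (jMv 𝒰 K σ) := by
    refine MvPolynomial.ringHom_ext (fun c => ?_) fun s => ?_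
    · obtain ⟨b, rfl⟩ := Up.mk_surjective (𝒰 := 𝒰) c
      simp [jMv_C, substG, jPoly_C, jFrac_algebraMap]
    · simp [jMv_X, substG, hG]
  have := RingHom.congr_fun key f
  rw [RingHom.comp_apply, RingHom.comp_apply, h, Up.map_mk] at this
  exact this

variable {𝔭 : ∀ i, Ideal (MvPolynomial σ (K i))}

/-- A generic presentation over the ultraproduct induces generic presentations almost everywhere,
with uniform bounds on the degrees. -/
theorem GenericPresentation.eventually [Finite σ]
    (P : GenericPresentation S (FractionRing (MvPolynomial S (Up 𝒰 K))) (upLimit 𝒰 𝔭))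
    (hδ : rename ((↑) : S → σ) P.δ ∉ upLimit 𝒰 𝔭)
    {D : ℕ} {u : Finset (MvPolynomial σ (Up 𝒰 K))}
    (hu : Ideal.span (u : Set (MvPolynomial σ (Up 𝒰 K))) = upLimit 𝒰 𝔭)
    (hD : ∀ g ∈ u, g.totalDegree ≤ D) {m p : ℕ}
    (c : Fin m → Polynomial (FractionRing (MvPolynomial S (Up 𝒰 K))))
    (hc : ∀ l, (c l).degree < P.h.natDegree)
    (hdvd : ∀ l : Fin m, P.h ∣ Polynomial.X ^ (l : ℕ) - Polynomial.expand _ p (c l))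
    (cNum : Fin m → Polynomial (MvPolynomial S (Up 𝒰 K)))
    (map_cNum : ∀ l, (cNum l).map (algebraMap _ _) = Polynomial.C (algebraMap _ _ P.δ) * c l) :
    ∃ T, ∀ᶠ i in 𝒰, ∃ (Q : GenericPresentation S (FractionRing (MvPolynomial S (K i)))
        (lowSpan D (𝔭 i))) (c' : Fin m → Polynomial (FractionRing (MvPolynomial S (K i))))
        (cNum' : Fin m → Polynomial (MvPolynomial S (K i))),
      Q.h.natDegree = P.h.natDegree ∧ Q.δ.totalDegree ≤ T ∧ Q.z.totalDegree ≤ T ∧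
      rename ((↑) : S → σ) Q.δ ∉ 𝔭 i ∧ (∀ l, (c' l).degree < P.h.natDegree) ∧
      (∀ l : Fin m, Q.h ∣ Polynomial.X ^ (l : ℕ) - Polynomial.expand _ p (c' l)) ∧
      (∀ l, (cNum' l).map (algebraMap _ _) = Polynomial.C (algebraMap _ _ Q.δ) * c' l) ∧
      ∀ l k, ((cNum' l).coeff k).totalDegree ≤ T := by
  obtain ⟨δ, hδ', hδd⟩ := exists_jMv_eq_mk P.δ
  obtain ⟨z, hz, hzd⟩ := exists_jMv_eq_mk P.z
  obtain ⟨h, hh, hhm⟩ := exists_jPoly_monic (jFrac 𝒰 K S) P.monic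
  choose G₀ hG₀ using fun s => Up.mk_surjective (𝒰 := 𝒰) (jPoly (jFrac 𝒰 K S) (P.G s))
  set G : ∀ i, σ → Polynomial (FractionRing (MvPolynomial S (K i))) := fun i s => G₀ s i with hGdef
  have hG : ∀ s, jPoly (jFrac 𝒰 K S) (P.G s) = Up.mk 𝒰 fun i => G i s := fun s => (hG₀ s).symm
  obtain ⟨hNum, hhNum⟩ := Up.mk_surjective (𝒰 := 𝒰) (jPoly (jMv 𝒰 K S) P.hNum)
  choose GNum hGNum using fun s => Up.mk_surjective (𝒰 := 𝒰) (jPoly (jMv 𝒰 K S) (P.GNum s))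
  choose c' hc' hc'd using fun l => exists_jPoly_degree_lt (jFrac 𝒰 K S) (hc l)
  choose T cNum' hcNum' hcNumT using fun l => exists_jPoly_jMv_eq_mk (cNum l)
  have hCδ : jPoly (jFrac 𝒰 K S) (Polynomial.C (algebraMap _ _ P.δ)) = Up.mk 𝒰 fun i =>
      Polynomial.C (algebraMap _ (FractionRing (MvPolynomial S (K i))) (δ i)) := by
    rw [jPoly_C, jFrac_algebraMap, hδ', Up.map_mk, Up.map_mk]
  have eδ : ∀ᶠ i in 𝒰, rename ((↑) : S → σ) (δ i) ∉ 𝔭 i := by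
    rw [Ultrafilter.eventually_not]
    rwa [← mem_upLimit (jMv_rename hδ')]
  have esep := eventually_separable _ hh P.separable
  have emap : ∀ {f : Polynomial (MvPolynomial S (Up 𝒰 K))}
      {g : Polynomial (FractionRing (MvPolynomial S (Up 𝒰 K)))}
      {a : ∀ i, Polynomial (MvPolynomial S (K i))}
      {b : ∀ i, Polynomial (FractionRing (MvPolynomial S (K i)))},
      jPoly (jMv 𝒰 K S) f = Up.mk 𝒰 a → jPoly (jFrac 𝒰 K S) g = Up.mk 𝒰 b →
      f.map (algebraMap _ _) = Polynomial.C (algebraMap _ _ P.δ) * g →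
      ∀ᶠ i in 𝒰, (a i).map (algebraMap _ _) = Polynomial.C (algebraMap _ _ (δ i)) * b i := by
    intro f g a b hf hg hfg
    have := congrArg (jPoly (jFrac 𝒰 K S)) hfg
    rwa [jPoly_jFrac_map hf, map_mul, hCδ, hg, ← map_mul, Up.mk_eq_mk] at this
  have ehNum := emap hhNum.symm hh P.map_hNum
  have eGNum : ∀ᶠ i in 𝒰, ∀ s, (GNum s i).map (algebraMap _ _) =
      Polynomial.C (algebraMap _ _ (δ i)) * G i s :=
    Filter.eventually_all.2 fun s => emap (hGNum s).symm (hG s) (P.map_GNum s)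
  have ecNum : ∀ᶠ i in 𝒰, ∀ l, (cNum' l i).map (algebraMap _ _) =
      Polynomial.C (algebraMap _ _ (δ i)) * c' l i :=
    Filter.eventually_all.2 fun l => emap (hcNum' l) (hc' l) (map_cNum l)
  have esub := eventually_mem_lowSpan hu hD P.substZ_hNum (jMv_substZ hz hhNum.symm)
  have esubG : ∀ᶠ i in 𝒰, ∀ s, rename ((↑) : S → σ) (δ i) * X s - substZ S (z i) (GNum s i) ∈
      lowSpan D (𝔭 i) := by
    refine Filter.eventually_all.2 fun s => eventually_mem_lowSpan hu hD (P.substZ_GNum s) ?_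
    rw [map_sub, map_mul, jMv_rename hδ', jMv_X, jMv_substZ hz (hGNum s).symm, ← map_mul,
      ← map_sub]
    rfl
  have edvdz : ∀ᶠ i in 𝒰, h i ∣ substG (S := S) (G i) (z i) - Polynomial.X := by
    refine eventually_dvd_of_dvd _ hh ?_ P.dvd_z
    rw [map_sub, jPoly_substG hG hz, jPoly_X, ← map_sub]
    rfl
  have ecoord : ∀ᶠ i in 𝒰, ∀ s : S, h i ∣ substG (k := K i) (S := S) (G i) (X (s : σ)) -
      Polynomial.C (algebraMap (MvPolynomial S (K i)) (FractionRing (MvPolynomial S (K i))) (X s)) := by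
    refine Filter.eventually_all.2 fun s => eventually_dvd_of_dvd _ hh ?_ (P.dvd_coord s)
    rw [map_sub, jPoly_substG hG (jMv_X _), jPoly_C, jFrac_algebraMap, jMv_X, Up.map_mk,
      Up.map_mk, ← map_sub]
    rfl
  have efrob : ∀ᶠ i in 𝒰, ∀ l : Fin m, h i ∣ Polynomial.X ^ (l : ℕ) -
      Polynomial.expand _ p (c' l i) := by
    refine Filter.eventually_all.2 fun l => eventually_dvd_of_dvd _ hh ?_ (hdvd l)
    rw [map_sub, map_pow, jPoly_X, jPoly_expand _ (hc' l), ← map_pow, ← map_sub]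
    rfl
  -- The truncated ideal is generated in degree at most D, so divisibility need only be tested
  -- there; a sequence of failures would assemble into a failure over the ultraproduct.
  have emem : ∀ᶠ i in 𝒰, ∀ f ∈ 𝔭 i, f.totalDegree ≤ D → h i ∣ substG (S := S) (G i) f := by
    by_contra hcon
    rw [← Ultrafilter.eventually_not] at hcon
    have : ∀ i, ∃ f : MvPolynomial σ (K i),
        (¬ ∀ f ∈ 𝔭 i, f.totalDegree ≤ D → h i ∣ substG (S := S) (G i) f) →
        f ∈ 𝔭 i ∧ f.totalDegree ≤ D ∧ ¬ h i ∣ substG (S := S) (G i) f := by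
      intro i
      by_cases h' : ∀ f ∈ 𝔭 i, f.totalDegree ≤ D → h i ∣ substG (S := S) (G i) f
      · exact ⟨0, fun h'' => absurd h' h''⟩
      · push Not at h'
        obtain ⟨f, hf⟩ := h'
        exact ⟨f, fun _ => hf⟩
    choose a ha using this
    replace ha := hcon.mono fun i hi => ha i hi
    obtain ⟨f, hf⟩ := exists_jMv_eq (𝒰 := 𝒰) a (t := D) (ha.mono fun i hi => hi.2.1)
    have hfI : f ∈ upLimit 𝒰 𝔭 := (mem_upLimit hf).2 (ha.mono fun i hi => hi.1)
    obtain ⟨i, h1, h2⟩ := ((eventually_dvd_of_dvd _ hh (jPoly_substG hG hf)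
      (P.dvd_of_mem f hfI)).and ha).exists
    exact h2.2.2 h1
  refine ⟨P.δ.totalDegree + P.z.totalDegree + Finset.univ.sup T, ?_⟩
  filter_upwards [eδ, esep, ehNum, eGNum, ecNum, esub, esubG, edvdz, ecoord, efrob, emem] with i
    eδ esep ehNum eGNum ecNum esub esubG edvdz ecoord efrob emem
  refine ⟨⟨δ i, h i, G i, z i, hNum i, fun s => GNum s i, fun h0 => eδ (by rw [h0]; simp),
    (hhm i).1, esep, ehNum, eGNum, esub, esubG, fun f hf => ?_, edvdz, ecoord⟩,
    fun l => c' l i, fun l => cNum' l i, (hhm i).2, (hδd i).trans (by omega),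
    (hzd i).trans (by omega), eδ, fun l => hc'd l i, efrob, ecNum, fun l k => ?_⟩
  · have h1 : lowSpan D (𝔭 i) ≤ (Ideal.span {h i}).comap (substG (S := S) (G i)) :=
      Ideal.span_le.2 fun g hg => Ideal.mem_comap.2 (Ideal.mem_span_singleton.2 (emem g hg.1 hg.2))
    exact Ideal.mem_span_singleton.1 (h1 hf)
  · exact (hcNumT l i k).trans ((Finset.le_sup (Finset.mem_univ l)).trans (by omega))

end Transfer

end

end UnipRad


namespace UnipRad

noncomputable section

open MvPolynomial

/-! ### Separating transcendence bases -/

section SeparatingBasis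

open IntermediateField

/-- A field generated over a perfect field by finitely many elements has a separating transcendence
basis among the generators. -/
theorem exists_separating_subset {k L σ : Type*} [Field k] [Field L] [Algebra k L]
    [PerfectField k] [Finite σ] (a : σ → L) (ha : adjoin k (Set.range a) = ⊤) :
    ∃ S : Set σ, IsTranscendenceBasis k (fun s : S => a s) ∧
      Algebra.IsSeparable (adjoin k (a '' S)) L := by
  have hex : ∃ S : Set σ, IsTranscendenceBasis k (fun s : S => a s) := by
    have : Algebra.IsAlgebraic (Algebra.adjoin k (Set.range a)) L := by
      rw [← isAlgebraic_adjoin_iff_top, ha, Algebra.isAlgebraic_iff_isIntegral]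
      exact Algebra.isIntegral_of_surjective topEquiv.surjective
    obtain ⟨t, hts, ht⟩ := exists_isTranscendenceBasis_subset (R := k) (Set.range a)
    obtain ⟨S, hSt⟩ := (Set.exists_image_eq_injOn_of_subset_range hts)
    obtain ⟨rfl, hinj⟩ := hSt
    exact ⟨S, ht.comp_equiv (Equiv.Set.imageOfInjOn a S hinj)⟩
  obtain _ | ⟨p, hp, hpk⟩ := CharP.exists' k
  · obtain ⟨S, hS⟩ := hex
    have : Algebra.IsAlgebraic (adjoin k (a '' S)) L := by
      convert! hS.isAlgebraic_field <;> ext <;> simp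
    exact ⟨S, hS, inferInstance⟩
  have : ExpChar k p := .prime hp.out
  have : CharP L p := .of_ringHom_of_ne_zero (algebraMap k L) p hp.out.ne_zero
  -- Since k is perfect, scalars have p-th roots, and linear independence passes to p-th powers.
  have H : ∀ s : Finset L, LinearIndepOn k _root_.id (s : Set L) →
      LinearIndepOn k (· ^ p) (s : Set L) := by
    intro s hs
    refine hs.map_of_injective_injective (frobeniusEquiv k p).symm (frobenius L p).toAddMonoidHom
      (fun r hr => by simpa using hr) (fun m hm => by simpa using hm) fun r m => ?_
    change ((frobeniusEquiv k p).symm r • m) ^ p = r • m ^ p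
    rw [Algebra.smul_def, Algebra.smul_def, mul_pow, ← map_pow,
      frobeniusEquiv_symm_pow_p]
  -- S is chosen with maximal relative separable closure. A generator outside that closure could be
  -- exchanged for some member i of the enlarged set, with a i separable over the new basis; this
  -- would enlarge the closure.
  obtain ⟨S, hS, hmax⟩ := Set.Finite.exists_maximalFor
    (fun S : Set σ => (separableClosure (adjoin k (a '' S)) L).restrictScalars k)
    {S : Set σ | IsTranscendenceBasis k (fun s : S => a s)} (Set.toFinite _) hex
  refine ⟨S, hS, ?_⟩
  rw [← separableClosure.eq_top_iff, ← (restrictScalars_injective k).eq_iff,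
    restrictScalars_top, eq_top_iff, ← ha, adjoin_le_iff]
  rintro _ ⟨n, rfl⟩
  by_contra hn
  have hns : n ∉ S := fun h => hn
    (le_restrictScalars_separableClosure _ (subset_adjoin _ _ ⟨n, h, rfl⟩))
  obtain ⟨i, hi₁, hi₂⟩ := exists_isTranscendenceBasis_and_isSeparable_of_linearIndepOn_pow'
    p hp.out (a := a) H S n hS hns
  refine not_lt_iff_le_imp_ge.mpr (hmax hi₁) (SetLike.lt_iff_le_and_exists.mpr ⟨?_, a n, ?_, hn⟩)
  · rw [separableClosure_le_separableClosure_iff, adjoin_le_iff]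
    rintro _ ⟨x, hx, rfl⟩
    obtain rfl | ne := eq_or_ne x i
    exacts [hi₂, le_restrictScalars_separableClosure _ (subset_adjoin _ _ ⟨x, ⟨.inr hx, ne⟩, rfl⟩)]
  · obtain rfl | ne := eq_or_ne n i
    exacts [hi₂, le_restrictScalars_separableClosure _ (subset_adjoin _ _ ⟨n, ⟨.inl rfl, ne⟩, rfl⟩)]

end SeparatingBasis

/-! ### Common denominators -/

section Denominators

/-- Finitely many polynomials over a fraction field have a common denominator. -/
theorem exists_common_denominator {A F ι : Type*} [CommRing A] [IsDomain A] [Field F] [Algebra A F]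
    [IsFractionRing A F] [Finite ι] (g : ι → Polynomial F) :
    ∃ (b : A) (N : ι → Polynomial A), b ≠ 0 ∧
      ∀ i, (N i).map (algebraMap A F) = Polynomial.C (algebraMap A F b) * g i := by
  classical
  have := Fintype.ofFinite ι
  choose b hb hbN using fun i => IsLocalization.integerNormalization_spec (nonZeroDivisors A) (g i)
  refine ⟨∏ i, b i, fun i => Polynomial.C (∏ j ∈ Finset.univ.erase i, b j) *
    IsLocalization.integerNormalization (nonZeroDivisors A) (g i), ?_, fun i => ?_⟩
  · exact Finset.prod_ne_zero_iff.2 fun i _ => nonZeroDivisors.ne_zero (hb i)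
  · rw [Polynomial.map_mul, Polynomial.map_C, hbN, ← Finset.mul_prod_erase _ _ (Finset.mem_univ i),
      map_mul, Polynomial.C_mul, Algebra.smul_def, Polynomial.algebraMap_apply]
    ring

end Denominators

/-! ### Existence of generic presentations -/

section Existence

variable {k σ : Type*} [Field k] {S : Set σ} {F L : Type*} [Field F] [Field L]
  [Algebra (MvPolynomial S k) F] [Algebra k L] [Algebra (MvPolynomial S k) L] [Algebra F L]
  [IsScalarTower k (MvPolynomial S k) L] [IsScalarTower (MvPolynomial S k) F L]
  {x : σ → L}

theorem aeval_rename_eq (hx : ∀ s : S, algebraMap (MvPolynomial S k) L (X s) = x s)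
    (a : MvPolynomial S k) : aeval x (rename ((↑) : S → σ) a) = algebraMap (MvPolynomial S k) L a := by
  have : (aeval x).comp (rename ((↑) : S → σ)) = IsScalarTower.toAlgHom k (MvPolynomial S k) L := by
    ext s
    simp [hx]
  exact DFunLike.congr_fun this a

theorem aeval_substZ (hx : ∀ s : S, algebraMap (MvPolynomial S k) L (X s) = x s)
    (z : MvPolynomial σ k) (f : Polynomial (MvPolynomial S k)) :
    aeval x (substZ S z f) = Polynomial.aeval (aeval x z) (f.map (algebraMap _ F)) := by
  have : (aeval x : MvPolynomial σ k →ₐ[k] L).toRingHom.comp (substZ S z) =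
      (Polynomial.aeval (R := F) (aeval x z)).toRingHom.comp
        (Polynomial.mapRingHom (algebraMap _ F)) := by
    refine Polynomial.ringHom_ext (fun a => ?_) ?_
    · simp [substZ_C, aeval_rename_eq hx, ← IsScalarTower.algebraMap_apply]
    · simp [substZ_X]
  exact RingHom.congr_fun this f

theorem aeval_substG {G : σ → Polynomial F} {ζ : L} (hG : ∀ s, Polynomial.aeval ζ (G s) = x s)
    (f : MvPolynomial σ k) : Polynomial.aeval ζ (substG (S := S) G f) = aeval x f := by
  have : (Polynomial.aeval (R := F) ζ).toRingHom.comp (substG (k := k) (S := S) G) =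
      (aeval x : MvPolynomial σ k →ₐ[k] L).toRingHom := by
    refine MvPolynomial.ringHom_ext (fun a => ?_) fun s => ?_
    · simp only [AlgHom.toRingHom_eq_coe, RingHom.coe_comp, RingHom.coe_coe, Function.comp_apply,
        substG, coe_eval₂Hom, eval₂_C, Polynomial.aeval_C, algHom_C]
      rw [← IsScalarTower.algebraMap_apply, ← algebraMap_eq, ← IsScalarTower.algebraMap_apply]
    · simp [substG, hG]
  exact RingHom.congr_fun this f

variable [IsFractionRing (MvPolynomial S k) F]

open IntermediateField in
/-- Every element becomes a polynomial in the generators after multiplication by a denominator. -/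
theorem exists_mul_eq_aeval [Algebra.IsAlgebraic F L]
    (hx : ∀ s : S, algebraMap (MvPolynomial S k) L (X s) = x s)
    (htop : adjoin F (Set.range x) = ⊤) (y : L) :
    ∃ a : MvPolynomial S k, a ≠ 0 ∧ ∃ f : MvPolynomial σ k,
      aeval x f = algebraMap (MvPolynomial S k) L a * y := by
  have hy : y ∈ Algebra.adjoin F (Set.range x) := by
    rw [← adjoin_toSubalgebra, htop]
    trivial
  induction hy using Algebra.adjoin_induction with
  | mem y hy =>
    obtain ⟨s, rfl⟩ := hy
    exact ⟨1, one_ne_zero, X s, by simp⟩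
  | algebraMap c =>
    obtain ⟨a, b, hb, rfl⟩ := IsFractionRing.div_surjective (MvPolynomial S k) c
    have hb0 := nonZeroDivisors.ne_zero hb
    have hb1 : algebraMap (MvPolynomial S k) F b ≠ 0 := by
      rwa [Ne, map_eq_zero_iff _ (IsFractionRing.injective _ F)]
    refine ⟨b, hb0, rename ((↑) : S → σ) a, ?_⟩
    rw [aeval_rename_eq hx, IsScalarTower.algebraMap_apply _ F L b, ← map_mul,
      mul_div_cancel₀ _ hb1, ← IsScalarTower.algebraMap_apply]
  | add y y' _ _ hy hy' =>
    obtain ⟨a, ha, f, hf⟩ := hy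
    obtain ⟨a', ha', f', hf'⟩ := hy'
    refine ⟨a * a', mul_ne_zero ha ha', rename ((↑) : S → σ) a' * f + rename ((↑) : S → σ) a * f', ?_⟩
    rw [map_add, map_mul, map_mul, aeval_rename_eq hx, aeval_rename_eq hx, hf, hf', map_mul]
    ring
  | mul y y' _ _ hy hy' =>
    obtain ⟨a, ha, f, hf⟩ := hy
    obtain ⟨a', ha', f', hf'⟩ := hy'
    refine ⟨a * a', mul_ne_zero ha ha', f * f', ?_⟩
    rw [map_mul, hf, hf', map_mul]
    ring

open IntermediateField in
theorem exists_aeval_eq_of_adjoin_eq_top [Algebra.IsAlgebraic F L] {ζ : L} (hζ : F⟮ζ⟯ = ⊤) (y : L) :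
    ∃ g : Polynomial F, Polynomial.aeval ζ g = y ∧ g.degree < (Module.finrank F L : WithBot ℕ) := by
  have hint : IsIntegral F ζ := Algebra.IsIntegral.isIntegral ζ
  have hy : y ∈ Algebra.adjoin F {ζ} := by
    rw [← adjoin_toSubalgebra, hζ]
    trivial
  rw [Algebra.adjoin_singleton_eq_range_aeval] at hy
  obtain ⟨g, rfl⟩ := hy
  refine ⟨g %ₘ minpoly F ζ, ?_, ?_⟩
  · exact Polynomial.aeval_modByMonic_eq_self_of_root (minpoly.aeval F ζ)
  · refine (Polynomial.degree_modByMonic_lt g (minpoly.monic hint)).trans_eq ?_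
    rw [Polynomial.degree_eq_natDegree (minpoly.ne_zero hint), ← adjoin.finrank hint, hζ,
      finrank_top']

open IntermediateField in
/-- The generic presentation of a prime ideal obtained from a primitive element. -/
theorem exists_genericPresentation_of_isSeparable [Finite σ] (q : ℕ) [ExpChar F q]
    [Algebra.IsSeparable F L]
    (hx : ∀ s : S, algebraMap (MvPolynomial S k) L (X s) = x s)
    (htop : adjoin F (Set.range x) = ⊤) {I : Ideal (MvPolynomial σ k)}
    (hI : ∀ f : MvPolynomial σ k, f ∈ I ↔ aeval x f = 0) :
    ∃ P : GenericPresentation S F I, rename ((↑) : S → σ) P.δ ∉ I ∧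
      ∃ (c : Fin P.h.natDegree → Polynomial F)
        (cNum : Fin P.h.natDegree → Polynomial (MvPolynomial S k)),
        (∀ l, (c l).degree < P.h.natDegree) ∧
        (∀ l : Fin P.h.natDegree, P.h ∣ Polynomial.X ^ (l : ℕ) - Polynomial.expand F q (c l)) ∧
        ∀ l, (cNum l).map (algebraMap _ F) = Polynomial.C (algebraMap _ F P.δ) * c l := by
  have hinjL : Function.Injective (algebraMap (MvPolynomial S k) L) := by
    rw [IsScalarTower.algebraMap_eq _ F L]
    exact (algebraMap F L).injective.comp (IsFractionRing.injective _ F)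
  have : FiniteDimensional F L := by
    have h1 : FiniteDimensional F (adjoin F (Set.range x)) :=
      finiteDimensional_adjoin fun y _ => Algebra.IsIntegral.isIntegral y
    rw [htop] at h1
    exact topEquiv.toLinearEquiv.finiteDimensional
  obtain ⟨α, hα⟩ := Field.exists_primitive_element F L
  -- The primitive element is scaled by a denominator so that it becomes the value of a polynomial z
  -- in the coordinates.
  obtain ⟨a, ha, z, hz⟩ := exists_mul_eq_aeval hx htop α
  set ζ : L := aeval x z with hζdef
  have hζ : F⟮ζ⟯ = ⊤ := by
    rw [eq_top_iff, ← hα, adjoin_simple_le_iff]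
    have ha' : algebraMap (MvPolynomial S k) L a ≠ 0 := by rwa [Ne, map_eq_zero_iff _ hinjL]
    have h1 : α = (algebraMap F L (algebraMap _ F a))⁻¹ * ζ := by
      rw [hz, ← IsScalarTower.algebraMap_apply, inv_mul_cancel_left₀ ha']
    rw [h1]
    exact mul_mem (inv_mem (IntermediateField.algebraMap_mem _ _)) (mem_adjoin_simple_self F ζ)
  have hint : IsIntegral F ζ := Algebra.IsIntegral.isIntegral ζ
  have hdeg : (minpoly F ζ).natDegree = Module.finrank F L := by
    rw [← adjoin.finrank hint, hζ, finrank_top']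
  choose G hG _ using fun s => exists_aeval_eq_of_adjoin_eq_top hζ (x s)
  -- By separability ζ^q is again primitive, so each ζ^l is a polynomial c_l in ζ^q.
  have hζq : F⟮ζ ^ q⟯ = ⊤ := by
    rw [← adjoin_simple_eq_adjoin_pow_expChar_of_isSeparable' F L ζ q, hζ]
  choose c hc hcdeg using fun l : Fin (minpoly F ζ).natDegree =>
    exists_aeval_eq_of_adjoin_eq_top hζq (ζ ^ (l : ℕ))
  have hcdvd : ∀ l : Fin (minpoly F ζ).natDegree,
      minpoly F ζ ∣ Polynomial.X ^ (l : ℕ) - Polynomial.expand F q (c l) := by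
    intro l
    apply minpoly.dvd
    rw [map_sub, Polynomial.expand_aeval, hc, map_pow, Polynomial.aeval_X, sub_self]
  obtain ⟨δ, N, hδ, hN⟩ := exists_common_denominator (A := MvPolynomial S k)
    (fun o : Option (σ ⊕ Fin (minpoly F ζ).natDegree) => o.elim (minpoly F ζ) (Sum.elim G c))
  refine ⟨⟨δ, minpoly F ζ, G, z, N none, fun s => N (some (.inl s)), hδ, minpoly.monic hint,
    Algebra.IsSeparable.isSeparable F ζ, hN none, fun s => hN (some (.inl s)), ?_, fun s => ?_,
    fun f hf => ?_, ?_, fun s => ?_⟩, ?_, c, fun l => N (some (.inr l)), fun l => ?_, fun l => ?_,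
    fun l => hN (some (.inr l))⟩
  · rw [hI, aeval_substZ (F := F) hx, hN]
    simp [← hζdef]
  · rw [hI, map_sub, aeval_substZ (F := F) hx, hN, map_mul, aeval_rename_eq hx]
    simp [← hζdef, hG, ← IsScalarTower.algebraMap_apply]
  · apply minpoly.dvd
    rw [aeval_substG hG]
    exact (hI f).1 hf
  · apply minpoly.dvd
    rw [map_sub, aeval_substG hG, Polynomial.aeval_X, sub_self]
  · apply minpoly.dvd
    rw [map_sub, aeval_substG hG, Polynomial.aeval_C, ← IsScalarTower.algebraMap_apply, hx, aeval_X,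
      sub_self]
  · rw [hI, aeval_rename_eq hx]
    rwa [map_eq_zero_iff _ hinjL]
  · change _ < ((minpoly F ζ).natDegree : WithBot ℕ)
    rw [hdeg]
    exact hcdeg l
  · exact hcdvd l

open IntermediateField in
theorem exists_genericPresentation_of_adjoin_eq_top {k σ L : Type*} [Field k] [Field L] [Algebra k L]
    [PerfectField k] [Finite σ] (q : ℕ) [ExpChar k q] {I : Ideal (MvPolynomial σ k)} {x : σ → L}
    (hxtop : adjoin k (Set.range x) = ⊤) (hI : ∀ f : MvPolynomial σ k, f ∈ I ↔ aeval x f = 0) :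
    ∃ (S : Set σ) (P : GenericPresentation S (FractionRing (MvPolynomial S k)) I),
      rename ((↑) : S → σ) P.δ ∉ I ∧
      ∃ (c : Fin P.h.natDegree → Polynomial (FractionRing (MvPolynomial S k)))
        (cNum : Fin P.h.natDegree → Polynomial (MvPolynomial S k)),
        (∀ l, (c l).degree < P.h.natDegree) ∧
        (∀ l : Fin P.h.natDegree, P.h ∣ Polynomial.X ^ (l : ℕ) - Polynomial.expand _ q (c l)) ∧
        ∀ l, (cNum l).map (algebraMap _ _) = Polynomial.C (algebraMap _ _ P.δ) * c l := by
  obtain ⟨S, hS, hsep⟩ := exists_separating_subset x hxtop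
  let : Algebra (MvPolynomial S k) L := (aeval fun s : S => x s).toAlgebra
  have hinj : Function.Injective (algebraMap (MvPolynomial S k) L) := hS.1
  have : IsScalarTower k (MvPolynomial S k) L := IsScalarTower.of_algebraMap_eq fun c => by
    change _ = aeval (fun s : S => x s) (C c)
    simp
  have : FaithfulSMul (MvPolynomial S k) L := (faithfulSMul_iff_algebraMap_injective _ _).2 hinj
  let : Algebra (FractionRing (MvPolynomial S k)) L := FractionRing.liftAlgebra _ _
  have : IsScalarTower (MvPolynomial S k) (FractionRing (MvPolynomial S k)) L :=
    FractionRing.isScalarTower_liftAlgebra _ _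
  have hx : ∀ s : S, algebraMap (MvPolynomial S k) L (X s) = x s := by
    intro s
    change aeval (fun s : S => x s) (X s) = x s
    simp
  have hrange : Set.range (fun s : S => x s) = x '' S := by ext; simp
  have : Algebra.IsSeparable (FractionRing (MvPolynomial S k)) L := by
    rw [← hrange] at hsep
    refine Algebra.IsSeparable.of_equiv_equiv hS.1.aevalEquivField.symm.toRingEquiv
      (RingEquiv.refl L) ?_
    ext y
    obtain ⟨w, rfl⟩ := hS.1.aevalEquivField.surjective y
    simp
    rfl
  have : ExpChar (FractionRing (MvPolynomial S k)) q :=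
    expChar_of_injective_algebraMap (algebraMap k (FractionRing (MvPolynomial S k))).injective q
  have htop : adjoin (FractionRing (MvPolynomial S k)) (Set.range x) = ⊤ := by
    have : IsScalarTower k (FractionRing (MvPolynomial S k)) L := IsScalarTower.to₁₃₄ _ (MvPolynomial S k) _ _
    exact adjoin_eq_top_of_adjoin_eq_top k hxtop
  obtain ⟨P, hP⟩ := exists_genericPresentation_of_isSeparable q hx htop hI
  exact ⟨S, P, hP⟩

open IntermediateField in
/-- Every prime ideal of a polynomial ring over a perfect field has a generic presentation over the
polynomial ring in a subset of the variables. -/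
theorem exists_genericPresentation {k σ : Type*} [Field k] [PerfectField k] [Finite σ] (q : ℕ)
    [ExpChar k q] (I : Ideal (MvPolynomial σ k)) [I.IsPrime] :
    ∃ (S : Set σ) (P : GenericPresentation S (FractionRing (MvPolynomial S k)) I),
      rename ((↑) : S → σ) P.δ ∉ I ∧
      ∃ (c : Fin P.h.natDegree → Polynomial (FractionRing (MvPolynomial S k)))
        (cNum : Fin P.h.natDegree → Polynomial (MvPolynomial S k)),
        (∀ l, (c l).degree < P.h.natDegree) ∧
        (∀ l : Fin P.h.natDegree, P.h ∣ Polynomial.X ^ (l : ℕ) - Polynomial.expand _ q (c l)) ∧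
        ∀ l, (cNum l).map (algebraMap _ _) = Polynomial.C (algebraMap _ _ P.δ) * c l := by
  let B := MvPolynomial σ k ⧸ I
  let L := FractionRing B
  let x : σ → L := fun s => algebraMap B L (Ideal.Quotient.mk I (X s))
  have hI : ∀ f : MvPolynomial σ k, f ∈ I ↔ aeval x f = 0 := by
    intro f
    have h1 : aeval x f = algebraMap B L (Ideal.Quotient.mk I f) := by
      have : aeval x = ((IsScalarTower.toAlgHom k B L).comp (Ideal.Quotient.mkₐ k I)) := by
        ext s
        simp only [aeval_X]
        rfl
      rw [this]
      rfl
    rw [h1, map_eq_zero_iff _ (IsFractionRing.injective B L), Ideal.Quotient.eq_zero_iff_mem]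
  have hxtop : adjoin k (Set.range x) = ⊤ := by
    rw [eq_top_iff]
    intro y _
    obtain ⟨a, b, _, rfl⟩ := IsFractionRing.div_surjective B y
    have hmem : ∀ a : B, algebraMap B L a ∈ adjoin k (Set.range x) := by
      intro a
      obtain ⟨f, rfl⟩ := Ideal.Quotient.mk_surjective a
      induction f using MvPolynomial.induction_on with
      | C c => exact IntermediateField.algebraMap_mem (adjoin k (Set.range x)) c
      | add f g hf hg => rw [map_add, map_add]; exact add_mem hf hg
      | mul_X f s hf =>
        rw [map_mul, map_mul]
        exact mul_mem hf (subset_adjoin _ _ ⟨s, rfl⟩)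
    exact div_mem (hmem a) (hmem b)
  exact exists_genericPresentation_of_adjoin_eq_top q hxtop hI

end Existence

end

end UnipRad


namespace UnipRad

noncomputable section

open MvPolynomial Topology TopologicalSpace

attribute [local instance] zariskiGL

/-! ### Generation in bounded degree bounds the complexity -/

section Complexity

/-- If the ideal of `V` is generated in degree at most `D`, then the complexity of `V` is bounded
independently of the field. -/
theorem complexity_le_of_lowSpan_eq {K σ : Type*} [Field K] [Fintype σ] {V : Set (σ → K)} {D : ℕ}
    (hV : lowSpan D (vanishingIdeal K V) = vanishingIdeal K V) :
    complexity V ≤ 1 + Fintype.card σ + D +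
      Nat.card {m : σ →₀ ℕ | (m.sum fun _ e => e) ≤ D} := by
  classical
  have hrank : Module.finrank K (restrictTotalDegree σ K D) =
      Nat.card {m : σ →₀ ℕ | (m.sum fun _ e => e) ≤ D} :=
    Module.finrank_eq_nat_card_basis (basisRestrictSupport K _)
  -- A basis of the degree-at-most-D part of the ideal generates it, and has no more elements than
  -- there are monomials of degree at most D, a number independent of K.
  set W : Submodule K (MvPolynomial σ K) :=
    (vanishingIdeal K V).restrictScalars K ⊓ restrictTotalDegree σ K D with hW
  have hWle : W ≤ restrictTotalDegree σ K D := inf_le_right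
  have hWfin : Module.Finite K W := Submodule.finiteDimensional_of_le hWle
  have hWrank : Module.finrank K W ≤ Nat.card {m : σ →₀ ℕ | (m.sum fun _ e => e) ≤ D} :=
    hrank ▸ Submodule.finrank_mono hWle
  let b := Module.finBasis K W
  set B : Finset (MvPolynomial σ K) := Finset.univ.image fun i => (b i : MvPolynomial σ K) with hB
  have hBW : ∀ f ∈ B, f ∈ W := by
    intro f hf
    obtain ⟨i, _, rfl⟩ := Finset.mem_image.1 hf
    exact (b i).2
  have hBcard : B.card ≤ Module.finrank K W := Finset.card_image_le.trans (by simp)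
  refine Nat.sInf_le ⟨by omega, by omega, B, by omega, fun f hf => ?_, le_antisymm ?_ ?_⟩
  · have := (mem_restrictTotalDegree _ _ _).1 (hBW f hf).2
    omega
  · exact Ideal.span_le.2 fun f hf => (hBW f hf).1
  · rw [← hV, lowSpan, Ideal.span_le]
    intro f hf
    have hfW : f ∈ W := ⟨hf.1, (mem_restrictTotalDegree _ _ _).2 hf.2⟩
    have h1 : f = ∑ i, b.repr ⟨f, hfW⟩ i • (b i : MvPolynomial σ K) := by
      have := congrArg Subtype.val (b.sum_repr ⟨f, hfW⟩)
      rw [Submodule.coe_sum] at this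
      exact this.symm
    rw [h1]
    refine Submodule.sum_mem _ fun i _ => ?_
    rw [smul_eq_C_mul]
    exact Ideal.mul_mem_left _ _
      (Ideal.subset_span (Finset.mem_coe.2 (Finset.mem_image_of_mem _ (Finset.mem_univ i))))

variable {n : ℕ} {K : Type*} [Field K]

theorem complexityBound_groupComplexity (G : Subgroup (GL (Fin n) K)) :
    ComplexityBound (glEmbed '' (G : Set (GL (Fin n) K))) (groupComplexity G) :=
  Nat.sInf_mem (exists_complexityBound _)

theorem le_groupComplexity (G : Subgroup (GL (Fin n) K)) : n ≤ groupComplexity G := by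
  have := (complexityBound_groupComplexity G).2.1
  rw [Fintype.card_option, Fintype.card_prod, Fintype.card_fin] at this
  nlinarith

theorem lowZeros_subset_of_groupComplexity_le {G : Subgroup (GL (Fin n) K)} (hG : IsAlgebraic G)
    {D : ℕ} (hD : groupComplexity G ≤ D) : lowZeros D (G : Set (GL (Fin n) K)) ⊆ G := by
  intro g hg
  obtain ⟨_, _, B, _, hdeg, hspan⟩ := complexityBound_groupComplexity G
  refine mem_of_forall_glIdeal hG fun f hf => ?_
  have h1 : glIdeal (G : Set (GL (Fin n) K)) ≤
      RingHom.ker (aeval (R := K) (glEmbed g) : MvPolynomial _ K →ₐ[K] K) := by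
    rw [glIdeal, ← hspan, Ideal.span_le]
    intro f hf
    exact hg f (by rw [glIdeal, ← hspan]; exact Ideal.subset_span hf) ((hdeg f hf).trans hD)
  exact h1 hf

end Complexity

/-! ### The uniform bound by compactness -/

section Uniform

/-- In a sequence of groups of bounded complexity, the ideals of the unipotent radicals are almost
everywhere generated in bounded degree. -/
theorem exists_eventually_lowSpan_eq {n M : ℕ} [Nonempty (Fin n)] {K : ℕ → Type*}
    [∀ i, Field (K i)] [∀ i, IsAlgClosed (K i)] {p : ℕ → ℕ} [∀ i, Fact (p i).Prime]
    [∀ i, CharP (K i) (p i)] (hnp : ∀ i, n < p i) {G : ∀ i, Subgroup (GL (Fin n) (K i))}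
    (hG : ∀ i, IsAlgebraic (G i)) (hM : ∀ i, groupComplexity (G i) ≤ M) (𝒰 : Ultrafilter ℕ) :
    ∃ D, ∀ᶠ i in 𝒰, lowSpan D (glIdeal (unipotentRadical (G i) : Set (GL (Fin n) (K i)))) =
      glIdeal (unipotentRadical (G i) : Set (GL (Fin n) (K i))) := by
  set 𝔭 : ∀ i, Ideal (MvPolynomial (Option (Fin n × Fin n)) (K i)) := fun i =>
    glIdeal (unipotentRadical (G i) : Set (GL (Fin n) (K i))) with h𝔭
  have : ∀ i, (𝔭 i).IsPrime := fun i => by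
    have hU := unipotentRadical_mem (hnp i) (hG i)
    exact glIdeal_isPrime (isIrreducible_of_isConnected hU.2.2.1 hU.2.2.2.1)
  obtain ⟨q, hq⟩ := ExpChar.exists (Up 𝒰 K)
  obtain ⟨S, P, hδ, c, cNum, hc, hdvd, hcNum⟩ := exists_genericPresentation q (upLimit 𝒰 𝔭)
  obtain ⟨u, hu⟩ := (isNoetherianRing_iff_ideal_fg _).1 inferInstance (upLimit 𝒰 𝔭)
  -- D exceeds the degrees of the generators of the limit ideal, those of the equations of G i (at
  -- most M), and n + 1, which captures invertibility and unipotency.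
  set D := u.sup totalDegree + M + n + 1 with hDdef
  have hD : ∀ g ∈ u, g.totalDegree ≤ D := fun g hg => by
    have := Finset.le_sup (f := totalDegree) hg
    omega
  obtain ⟨T, hT⟩ := P.eventually hδ hu hD c hc hdvd cNum hcNum
  -- Either p i is almost everywhere constant, and then equal to the characteristic q of the
  -- ultraproduct, or it almost everywhere avoids each of the finitely many values up to Dn.
  have hp : ∀ᶠ i in 𝒰, D * n < p i ∨ p i = q := by
    by_cases hfix : ∃ v, ∀ᶠ i in 𝒰, p i = v
    · obtain ⟨v, hv⟩ := hfix
      have hchar : CharP (Up 𝒰 K) v := Up.charP (hv.mono fun i hi => hi ▸ inferInstance)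
      obtain ⟨i, hi⟩ := hv.exists
      have hvp : v.Prime := hi ▸ Fact.out
      have : ExpChar (Up 𝒰 K) v := .prime hvp
      have hqv : v = q := ExpChar.eq this hq
      exact hv.mono fun i hi => Or.inr (hi.trans hqv)
    · push Not at hfix
      have h1 : ∀ᶠ i in 𝒰, ∀ v : Fin (D * n + 1), p i ≠ v :=
        Filter.eventually_all.2 fun v => hfix v
      refine h1.mono fun i hi => Or.inl ?_
      by_contra hlt
      exact hi ⟨p i, by omega⟩ rfl
  refine ⟨D, ?_⟩
  -- This degree bounds both δ and the polynomial e supplied by `exists_bounded_of_frobenius`.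
  filter_upwards [hT, hp, eventually_forall_mem_lowSpan hu hD (q * T + P.h.natDegree * T + T)]
    with i hTi hpi hti
  obtain ⟨Q, c', cNum', hQh, hQδ, hQz, hQ𝔭, hc', hdvd', hcNum', hcT⟩ := hTi
  refine lowSpan_eq_glIdeal (hnp i) (hG i) (by omega)
    (lowZeros_subset_of_groupComplexity_le (hG i) ((hM i).trans (by omega))) hti
    (δ := rename ((↑) : S → Option (Fin n × Fin n)) Q.δ)
    ((totalDegree_rename_le _ _).trans (hQδ.trans (by omega))) hQ𝔭
    (fun f hf => Q.exists_pow_mul_mem_of_mem_radical hf) (hpi.imp_right fun hpq f hf => ?_)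
  have : Fact q.Prime := ⟨hpq ▸ Fact.out⟩
  have : CharP (K i) q := hpq ▸ inferInstance
  have : CharP (FractionRing (MvPolynomial S (K i))) q :=
    charP_of_injective_algebraMap (algebraMap (K i) _).injective q
  rw [hpq] at hf
  obtain ⟨e, he, heN⟩ := Q.exists_bounded_of_frobenius (p := q) (fun l => c' (Fin.cast hQh l))
    (fun l => (hc' _).trans_eq (by rw [hQh])) (fun l => hdvd' (Fin.cast hQh l))
    (fun l => cNum' (Fin.cast hQh l)) (fun l => hcNum' _) hQδ (fun l k => hcT _ k) hQz hf
  exact ⟨e, hQh ▸ he, heN⟩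

universe u

/-- The complexity of the unipotent radical is bounded in terms of `n` and the complexity of the
group. -/
theorem exists_groupComplexity_unipotentRadical_le (n M : ℕ) (hn : 0 < n) :
    ∃ b : ℕ, ∀ (K : Type u) [Field K] [IsAlgClosed K] (p : ℕ) [CharP K p] (_ : n < p)
      (G : Subgroup (GL (Fin n) K)) (_ : IsAlgebraic G) (_ : groupComplexity G = M),
      groupComplexity (unipotentRadical G) ≤ b := by
  have : Nonempty (Fin n) := ⟨⟨0, hn⟩⟩
  by_contra hcon
  have hseq : ∀ b : ℕ, ∃ (K : Type u) (_ : Field K) (_ : IsAlgClosed K) (p : ℕ) (_ : CharP K p)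
      (_ : n < p) (G : Subgroup (GL (Fin n) K)), IsAlgebraic G ∧ groupComplexity G = M ∧
      b < groupComplexity (unipotentRadical G) := by
    intro b
    by_contra hb
    refine hcon ⟨b, fun K _ _ p _ hnp G hG hM => ?_⟩
    by_contra hlt
    exact hb ⟨K, inferInstance, inferInstance, p, inferInstance, hnp, G, hG, hM, not_le.1 hlt⟩
  choose K hK hKc p hp hnp G hG hM hb using hseq
  have hprime : ∀ i, Fact (p i).Prime := fun i =>
    ⟨(CharP.char_is_prime_or_zero (K i) (p i)).resolve_right (by have := hnp i; omega)⟩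
  obtain ⟨D, hD⟩ := exists_eventually_lowSpan_eq hnp hG (fun i => (hM i).le)
    (Filter.hyperfilter ℕ)
  -- The ultrafilter refines `atTop`, so the index i can be taken beyond the uniform bound while the
  -- complexity there exceeds i.
  have hlarge := Filter.eventually_gt_atTop (1 + Fintype.card (Option (Fin n × Fin n)) + D +
      Nat.card {m : Option (Fin n × Fin n) →₀ ℕ | (m.sum fun _ e => e) ≤ D})
  obtain ⟨i, hi, hi'⟩ := (hD.and (Nat.hyperfilter_le_atTop hlarge)).exists
  have h1 := complexity_le_of_lowSpan_eq hi
  exact absurd (h1.trans (le_of_lt hi')) (not_le.2 (hb i))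

end Uniform

end

end UnipRad

/-! ### The main theorem -/

theorem mainTheorem10 :
    ∃ C : ℕ → ℕ, StrictMono C ∧
      ∀ (n : ℕ) (_ : 0 < n) (K : Type*) [Field K] [IsAlgClosed K] (p : ℕ) [CharP K p] (_ : n < p)
        (G : Subgroup (GL (Fin n) K)) (_ : UnipRad.IsAlgebraic G) (_ : UnipRad.IsConn G)
        (M : ℕ) (_ : UnipRad.groupComplexity G = M),
        UnipRad.groupComplexity (UnipRad.unipotentRadical G) ≤ C M ∧
        (∀ X ∈ UnipRad.logLieAlgebra (UnipRad.unipotentRadical G), IsNilpotent X) ∧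
        (UnipRad.unipotentRadical G : Set (GL (Fin n) K)) =
          UnipRad.identityComponent
            (UnipRad.expSet (UnipRad.logLieAlgebra (UnipRad.unipotentRadical G)) ∩ (G : Set (GL (Fin n) K))) := by
  choose b hb using UnipRad.exists_groupComplexity_unipotentRadical_le
  -- The summand 1 makes C strictly increasing. Summing over n ≤ j removes the dependence on n,
  -- since the complexity of a subgroup of GL_n is at least n² + 1 ≥ n.
  set C : ℕ → ℕ := fun m => ∑ j ∈ Finset.range (m + 1),
    (1 + ∑ n ∈ Finset.range (j + 1), if hn : 0 < n then b n j hn else 0) with hC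
  refine ⟨C, strictMono_nat_of_lt_succ fun m => ?_, ?_⟩
  · simp only [hC]
    rw [Finset.sum_range_succ _ (m + 1)]
    omega
  · intro n hn K _ _ p _ hnp G hG _ M hM
    have : Fact p.Prime :=
      ⟨(CharP.char_is_prime_or_zero K p).resolve_right (by omega)⟩
    have : Nonempty (Fin n) := ⟨⟨0, hn⟩⟩
    refine ⟨(hb n M hn K p hnp G hG hM).trans ?_, fun X hX => ?_,
      UnipRad.unipotentRadical_eq_identityComponent hn hnp hG⟩
    · have hnM : n ≤ M := hM ▸ UnipRad.le_groupComplexity G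
      have h1 : b n M hn ≤ ∑ n ∈ Finset.range (M + 1), if hn : 0 < n then b n M hn else 0 := by
        have := Finset.single_le_sum (f := fun n => if hn : 0 < n then b n M hn else 0)
          (fun _ _ => Nat.zero_le _) (Finset.mem_range.2 (Nat.lt_succ_of_le hnM))
        simpa only [dif_pos hn] using this
      have h2 := Finset.single_le_sum (f := fun j => 1 + ∑ n ∈ Finset.range (j + 1),
        if hn : 0 < n then b n j hn else 0) (fun _ _ => Nat.zero_le _)
        (Finset.mem_range.2 (Nat.lt_succ_self M))
      exact h1.trans ((Nat.le_add_left _ _).trans h2)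
    · exact UnipRad.isNilpotent_of_mem_unipSpan hnp
        (UnipRad.unipotentRadical_mem hnp hG).2.2.2.2 (UnipRad.logLieAlgebra_le_unipSpan hX)
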